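/- Let $a>-1$, $0<\xi\le 1$ and $s>0$ be fixed. Let $L_n^{(a)}$ denote the Laguerre polynomials (standard normalisation) and, for $x,y>0$, let $$K_N(x,y)=\big(x^ae^{-x}\,y^ae^{-y}\big)^{1/2}\sum_{n=0}^{N-1}\frac{n!}{\Gamma(a+n+1)}L_n^{(a)}(x)L_n^{(a)}(y)$$ be the correlation kernel of the Laguerre unitary ensemble ($\beta=2$), whose $N$ eigenvalues have joint density proportional to $\prod_{l}x_l^ae^{-x_l}\prod_{j<k}|x_k-x_j|^2$ on $(0,\infty)^N$. Let $J_a$ be the Bessel function of the first kind, $$K_\infty(x,y)=\frac{\sqrt y\,J_a(\sqrt x)J_a'(\sqrt y)-\sqrt x\,J_a'(\sqrt x)J_a(\sqrt y)}{2(x-y)}\quad(x\ne y),$$ $$K_\infty(x,x)=\tfrac14\big(J_a(\sqrt x)^2-J_{a+1}(\sqrt x)J_{a-1}(\sqrt x)\big),$$ and $$\hat L_2(x,y)=-\tfrac1{192}\Big((a^2+x+y)J_a(\sqrt x)J_a(\sqrt y)+\sqrt{xy}\,J_a'(\sqrt x)J_a'(\sqrt y)+2\sqrt y\,J_a(\sqrt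 x)J_a'(\sqrt y)+2\sqrt x\,J_a'(\sqrt x)J_a(\sqrt y)\Big).$$ Denote by $\mathbb K_{N,(0,t)}$, $\mathbb K_{\infty,(0,t)}$, $\hat{\mathbb L}_{2,(0,t)}$ the integral operators on $L^2(0,t)$ with these kernels, by $\det(\mathbb I-\mathbb K)$ the Fredholm determinant, and put $\Omega(\mathbb K):\mathbb L=-\det(\mathbb I-\mathbb K)\,\mathrm{Tr}\big((\mathbb I-\mathbb K)^{-1}\mathbb L\big)$. Then the Fredholm series for $\xi\mathbb K_{N,(0,s/(4N+2a))}$ ($N\ge 1$) and $\xi\mathbb K_{\infty,(0,s)}$ converge absolutely, $\mathbb K_{\infty,(0,s)}$ and $\hat{\mathbb L}_{2,(0,s)}$ are bounded operators on $L^2(0,s)$, $\mathbb I-\xi\mathbb K_{\infty,(0,s)}$ is invertible, $(\mathbb I-\xi\mathbb K_{\infty,(0,s)})^{-1}\xi\hat{\mathbb L}_{2,(0,s)}$ is trace class, and as $N\to\infty$ $$\det\big(\mathbb I-\xi\mathbb K_{N,(0,s/(4N+2a))}\big)=\det\big(\mathbb I-\xi\mathbb K_{\infty,(0,s)}\big)+\frac1{N^2}\,\Omega\big(\xi\mathbb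 K_{\infty,(0,s)}\big):\xi\hat{\mathbb L}_{2,(0,s)}+O\Big(\frac1{N^3}\Big).$$ Consequently the gap probability $E_N(\xi)$ that, after each eigenvalue has been deleted independently with probability $1-\xi$, no eigenvalue remains in $(0,s/(4N+2a))$ satisfies $$E_N(\xi)=\det\big(\mathbb I-\xi\mathbb K_{\infty,(0,s)}\big)+O\Big(\frac1{N^2}\Big).$$ -/

import Mathlib

open MeasureTheory Filter Asymptotics Topology

noncomputable section

namespace HardEdge

/-! ### Special functions -/

/-- The Bessel function of the first kind `J_α(u)` of real order, for `u > 0`. Since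
`Real.Gamma` vanishes (by convention) at its poles, the reciprocal `(Real.Gamma z)⁻¹` is the
reciprocal Gamma function for every real `z`. -/
def besselJ (α u : ℝ) : ℝ :=
  ∑' m : ℕ, (-1 : ℝ) ^ m * (Real.Gamma (m + 1))⁻¹ * (Real.Gamma (m + α + 1))⁻¹ *
    (u / 2) ^ (2 * (m : ℝ) + α)

/-- The derivative `J_α'(u)`. -/
def besselJ' (α u : ℝ) : ℝ := deriv (besselJ α) u

/-- The Laguerre polynomial `L_n^{(a)}(x)` in the standard normalisation, for `a > -1`:
`∑_{k ≤ n} (-1)^k * Γ(n+a+1) / (Γ(k+a+1) (n-k)! k!) * x^k`. -/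
def laguerreL (a : ℝ) (n : ℕ) (x : ℝ) : ℝ :=
  ∑ k ∈ Finset.range (n + 1),
    (-1 : ℝ) ^ k * (Real.Gamma (n + a + 1) /
      (Real.Gamma (k + a + 1) * ((n - k).factorial : ℝ) * (k.factorial : ℝ))) * x ^ k

/-! ### Kernels -/

/-- The Laguerre weight `w(x) = x^a e^{-x}` on `x > 0`. -/
def weight (a x : ℝ) : ℝ := if 0 < x then x ^ a * Real.exp (-x) else 0

/-- The correlation kernel of the Laguerre unitary ensemble with `N` eigenvalues; the squared norm
of the standard Laguerre polynomial `L_n^{(a)}` for the weight is `Γ(a+n+1)/n!`. -/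
def kernelN (a : ℝ) (N : ℕ) (x y : ℝ) : ℝ :=
  Real.sqrt (weight a x * weight a y) *
    ∑ n ∈ Finset.range N,
      laguerreL a n x * laguerreL a n y / (Real.Gamma (a + n + 1) / (n.factorial : ℝ))

/-- The hard edge (Bessel) kernel on `x, y > 0`; on the diagonal it is the continuous extension. -/
def kernelInf (a x y : ℝ) : ℝ :=
  if x = y then
    (besselJ a (√x) ^ 2 - besselJ (a + 1) (√x) * besselJ (a - 1) (√x)) / 4
  else
    (√y * besselJ a (√x) * besselJ' a (√y) - √x * besselJ' a (√x) * besselJ a (√y)) /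
      (2 * (x - y))

/-- The correction kernel. -/
def kernelL2 (a x y : ℝ) : ℝ :=
  -(1 / 192) *
    ((a ^ 2 + x + y) * besselJ a (√x) * besselJ a (√y)
      + √(x * y) * besselJ' a (√x) * besselJ' a (√y)
      + 2 * √y * besselJ a (√x) * besselJ' a (√y)
      + 2 * √x * besselJ' a (√x) * besselJ a (√y))

/-- Lebesgue measure on the interval `(0, s)`. -/
def mu (s : ℝ) : Measure ℝ := volume.restrict (Set.Ioo 0 s)

/-! ### Fredholm determinants -/

/-- The integrand `det [k(x_i, x_j)]_{i,j=1,…,n}` of the Fredholm series. -/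
def fredholmMinor (k : ℝ → ℝ → ℝ) (n : ℕ) (x : Fin n → ℝ) : ℝ :=
  (Matrix.of fun i j : Fin n => k (x i) (x j)).det

/-- The `n`-th term `(-1)^n / n! ∫ det [k(x_i, x_j)] dμ(x_1) ⋯ dμ(x_n)` of the Fredholm series. -/
def fredholmTerm (μ : Measure ℝ) (k : ℝ → ℝ → ℝ) (n : ℕ) : ℝ :=
  (-1 : ℝ) ^ n / (n.factorial : ℝ) *
    ∫ x : Fin n → ℝ, fredholmMinor k n x ∂(Measure.pi fun _ => μ)

/-- All the integrals of the Fredholm series exist and the series converges absolutely. -/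
def FredholmConverges (μ : Measure ℝ) (k : ℝ → ℝ → ℝ) : Prop :=
  (∀ n : ℕ, Integrable (fredholmMinor k n) (Measure.pi fun _ => μ)) ∧
    Summable (fredholmTerm μ k)

/-- The Fredholm determinant `det(I - K)` of the integral operator with kernel `k` on `L²(μ)`. -/
def fredholmDet (μ : Measure ℝ) (k : ℝ → ℝ → ℝ) : ℝ := ∑' n : ℕ, fredholmTerm μ k n

/-! ### Integral operators on `L²` -/

/-- `T` is the integral operator with kernel `k`: `(T f)(x) = ∫ k(x, y) f(y) dμ(y)` for almost
every `x`, with an integral that converges absolutely. -/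
def IsIntegralOperator (μ : Measure ℝ) (k : ℝ → ℝ → ℝ)
    (T : Lp ℝ 2 μ →L[ℝ] Lp ℝ 2 μ) : Prop :=
  ∀ f : Lp ℝ 2 μ, (∀ᵐ x ∂μ, Integrable (fun y => k x y * f y) μ) ∧
    T f =ᵐ[μ] fun x => ∫ y, k x y * f y ∂μ

theorem IsIntegralOperator.unique {μ : Measure ℝ} {k : ℝ → ℝ → ℝ}
    {S T : Lp ℝ 2 μ →L[ℝ] Lp ℝ 2 μ} (hS : IsIntegralOperator μ k S)
    (hT : IsIntegralOperator μ k T) : S = T := by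
  ext1 f
  exact Lp.ext ((hS f).2.trans (hT f).2.symm)

open Classical in
/-- The bounded integral operator on `L²(μ)` with kernel `k`, if there is one (it is then unique);
the value is `0` otherwise. -/
def integralOperator (μ : Measure ℝ) (k : ℝ → ℝ → ℝ) : Lp ℝ 2 μ →L[ℝ] Lp ℝ 2 μ :=
  if h : ∃ T, IsIntegralOperator μ k T then h.choose else 0

/-! ### Trace -/

section Trace

variable {H : Type*} [NormedAddCommGroup H] [InnerProductSpace ℝ H] [CompleteSpace H]

/-- Trace class (equivalently, nuclear) operators on a Hilbert space: `A = ∑ n, ⟪u n, ·⟫ v n` with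
`∑ n, ‖u n‖ ‖v n‖ < ∞`. -/
def IsTraceClass (A : H →L[ℝ] H) : Prop :=
  ∃ u v : ℕ → H, Summable (fun n => ‖u n‖ * ‖v n‖) ∧
    ∀ x, HasSum (fun n => inner ℝ (u n) x • v n) (A x)

variable (H) in
/-- Some orthonormal basis of `H`. -/
def someBasis : HilbertBasis (exists_hilbertBasis ℝ H).choose ℝ H :=
  (exists_hilbertBasis ℝ H).choose_spec.choose

/-- The trace `∑ i, ⟪e_i, A e_i⟫` of an operator; for trace class operators it does not depend on
the orthonormal basis, see `hasSum_opTrace`. -/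
def opTrace (A : H →L[ℝ] H) : ℝ := ∑' i, inner ℝ (someBasis H i) (A (someBasis H i))

theorem hasSum_inner_basis {ι : Type*} (b : HilbertBasis ι ℝ H) {A : H →L[ℝ] H} {u v : ℕ → H}
    (huv : Summable (fun n => ‖u n‖ * ‖v n‖))
    (hA : ∀ x, HasSum (fun n => inner ℝ (u n) x • v n) (A x)) :
    HasSum (fun i => inner ℝ (b i) (A (b i))) (∑' n, inner ℝ (u n) (v n)) := by
  have hsq : ∀ x : H, HasSum (fun i => |inner ℝ x (b i)| ^ (2 : ℝ)) (‖x‖ ^ (2 : ℝ)) := by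
    intro x
    have h := b.hasSum_inner_mul_inner x x
    rw [real_inner_self_eq_norm_sq] at h
    simp only [Real.rpow_two, sq_abs]
    refine h.congr_fun ?_
    intro i
    rw [real_inner_comm x (b i), sq]
  have hbound : ∀ x y : H, ∃ C : ℝ, 0 ≤ C ∧ C ≤ ‖x‖ * ‖y‖ ∧
      HasSum (fun i => |inner ℝ x (b i)| * |inner ℝ y (b i)|) C := fun x y =>
    Real.inner_le_Lp_mul_Lq_hasSum_of_nonneg Real.HolderConjugate.two_two (norm_nonneg x)
      (norm_nonneg y) (fun i => abs_nonneg _) (fun i => abs_nonneg _) (hsq x) (hsq y)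
  have habs : Summable fun p : ℕ × ι =>
      |inner ℝ (u p.1) (b p.2)| * |inner ℝ (v p.1) (b p.2)| := by
    rw [summable_prod_of_nonneg (fun p => mul_nonneg (abs_nonneg _) (abs_nonneg _))]
    refine ⟨fun n => ?_, ?_⟩
    · obtain ⟨C, -, -, hC⟩ := hbound (u n) (v n)
      exact hC.summable
    · refine Summable.of_nonneg_of_le
        (fun n => tsum_nonneg fun i => mul_nonneg (abs_nonneg _) (abs_nonneg _))
        (fun n => ?_) huv
      obtain ⟨C, -, hle, hC⟩ := hbound (u n) (v n)
      exact hC.tsum_eq.trans_le hle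
  have hF : Summable fun p : ℕ × ι => inner ℝ (u p.1) (b p.2) * inner ℝ (b p.2) (v p.1) := by
    refine Summable.of_norm (habs.congr fun p => ?_)
    rw [norm_mul, Real.norm_eq_abs, Real.norm_eq_abs, real_inner_comm (v p.1) (b p.2)]
  have hrow : ∀ n, HasSum (fun i => inner ℝ (u n) (b i) * inner ℝ (b i) (v n))
      (inner ℝ (u n) (v n)) := fun n => b.hasSum_inner_mul_inner (u n) (v n)
  have htot := (hF.hasSum.prod_fiberwise hrow).tsum_eq
  have hcol : ∀ i, HasSum (fun n => inner ℝ (u n) (b i) * inner ℝ (b i) (v n))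
      (inner ℝ (b i) (A (b i))) := by
    intro i
    have h := (hA (b i)).mapL (innerSL ℝ (b i))
    simpa [inner_smul_right] using h
  rw [htot]
  exact ((Equiv.prodComm ι ℕ).hasSum_iff.mpr hF.hasSum).prod_fiberwise hcol

/-- The trace of a trace class operator may be computed in any orthonormal basis. -/
theorem hasSum_opTrace {ι : Type*} (b : HilbertBasis ι ℝ H) {A : H →L[ℝ] H}
    (hA : IsTraceClass A) : HasSum (fun i => inner ℝ (b i) (A (b i))) (opTrace A) := by
  obtain ⟨u, v, huv, h⟩ := hA
  have h1 := hasSum_inner_basis (someBasis H) huv h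
  rw [opTrace, h1.tsum_eq]
  exact hasSum_inner_basis b huv h

end Trace

/-- `Ω(K) : L = -det(I - K) Tr((I - K)⁻¹ L)` for the integral operators `K`, `L` on `L²(μ)` with
kernels `k`, `l`. -/
def Omega (μ : Measure ℝ) (k l : ℝ → ℝ → ℝ) : ℝ :=
  -fredholmDet μ k * opTrace (Ring.inverse (1 - integralOperator μ k) * integralOperator μ l)

/-! ### The thinned Laguerre unitary ensemble -/

/-- The unnormalised eigenvalue density `∏ w(x_l) ∏_{j<k} |x_k - x_j|²`. -/
def eigDensity (a : ℝ) (N : ℕ) (x : Fin N → ℝ) : ℝ :=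
  (∏ l, weight a (x l)) * ∏ j, ∏ k ∈ Finset.Ioi j, |x k - x j| ^ 2

open Classical in
/-- The probability that, after each of the `N` eigenvalues has been deleted independently with
probability `1 - ξ`, no eigenvalue is left in `J`: the expectation of `∏_l (1 - ξ χ_J(x_l))`. -/
def gapProb (a : ℝ) (N : ℕ) (ξ : ℝ) (J : Set ℝ) : ℝ :=
  (∫ x : Fin N → ℝ, (∏ l, (1 - ξ * if x l ∈ J then 1 else 0)) * eigDensity a N x) /
    ∫ x : Fin N → ℝ, eigDensity a N x

end HardEdge

end

/-!
The expansion rests on an exact formula for the kernels. Each of them has the form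
`k x y = x ^ (a / 2) * h x y * y ^ (a / 2)`, and the Euler operator `x ∂_x + y ∂_y + a + 1` maps the
factor `h` to a function `g` of rank at most two in the case of the Bessel kernel and the rescaled
Laguerre kernel (for the latter this is the Christoffel-Darboux formula along rays). Inverting the
Euler operator, `h x y = ∫ t in 0..1, t ^ a * g (t x) (t y)`: see `kernelInf_eq`, `kernelN_eq` and
`kernelL2_eq`. The functions `U`, `w` from which `g` is built solve the system
`U' = (1 - ε x) w`, `x w' + (a + 1) w = -U / 4`, with `ε = 0` for the Bessel kernel and
`ε = 1 / (4 N + 2 a) ^ 2` for the Laguerre kernel. The scaling by `4 N + 2 a` is what removes a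
term of order `1 / N`. A Gronwall argument (`exists_system_expansion`) expands the solution in
`ε`, the normalizing constant is a ratio of Gamma functions that is expanded by telescoping its
logarithm (`isBigO_kappa_sub`), and together they show that
the rescaled Laguerre kernel is `K_∞ + N⁻² L_2 + O(N⁻³)`, uniformly in the factors `h`
(`exists_radialAvg_expansion`).

Fredholm determinants of kernels with an integrable weight are Lipschitz in the supremum norm of
`h`, by Hadamard's inequality (`WeightedKernel.abs_fredholmDet_sub_le`). So it remains to expand
`det (1 - ξ (K_∞ + ε L_2))` in `ε`. The kernel `L_2` has rank three, and a perturbation of finite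
rank multiplies the determinant by `det (1 - ε W)`, where `W` is a matrix of size three formed with
the resolvent and has trace `Tr ((1 - ξ K_∞)⁻¹ ξ L_2)` (`fredholmDet_add_finiteRank`). For
degenerate kernels that is block elimination; for `K_∞` it follows by approximation with the
rescaled Laguerre kernels.

The resolvent exists because `K_∞` on `(0, s)` is a compact operator with `K_∞² ≤ K_∞`, as the
limit of compressions of orthogonal projections, and does not have the eigenvalue one. Indeed, an
eigenfunction for the eigenvalue one on `(0, s)`, extended by zero, is one on `(0, 2 s)`; but
functions in the range are entire up to the factor `x ^ (a / 2)`, hence it vanishes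
(`eq_zero_of_bessel_apply_eq`).

Finally, by orthonormality of the Laguerre functions and Andréief's identity, the gap probability
and the Fredholm determinant of the Laguerre kernel are the same determinant of size `N`
(`gapProb_eq`, `fredholmDet_kernelN_eq`).
-/

noncomputable section

namespace HardEdge

/-! ### Determinants -/

section Determinants

/-- **Hadamard's inequality**, from the corresponding bound for the volume form. -/
theorem abs_det_le_prod_norm {n : ℕ} (A : Matrix (Fin n) (Fin n) ℝ) :
    |A.det| ≤ ∏ i, ‖WithLp.toLp 2 (A i)‖ := by
  let b := EuclideanSpace.basisFun (Fin n) ℝ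
  have : Fact (Module.finrank ℝ (EuclideanSpace ℝ (Fin n)) = n) := ⟨by simp⟩
  have h := b.toBasis.orientation.abs_volumeForm_apply_le (fun i => WithLp.toLp 2 (A i))
  rw [Orientation.volumeForm_robust' _ b] at h
  convert h using 2
  rw [Module.Basis.det_apply, ← Matrix.det_transpose]
  congr 1

theorem norm_toLp_le {n : ℕ} {v : Fin n → ℝ} {M : ℝ} (hv : ∀ i, |v i| ≤ M) (hM : 0 ≤ M) :
    ‖WithLp.toLp 2 v‖ ≤ √n * M := by
  rw [EuclideanSpace.norm_eq]
  have h : ∑ i, ‖v i‖ ^ 2 ≤ n * M ^ 2 := by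
    calc ∑ i, ‖v i‖ ^ 2 ≤ ∑ _i : Fin n, M ^ 2 :=
          Finset.sum_le_sum fun i _ => pow_le_pow_left₀ (norm_nonneg _) (hv i) 2
      _ = n * M ^ 2 := by simp
  calc √(∑ i, ‖v i‖ ^ 2) ≤ √(n * M ^ 2) := Real.sqrt_le_sqrt h
    _ = √n * M := by rw [Real.sqrt_mul (by positivity), Real.sqrt_sq hM]

theorem abs_det_le_of_entries {n : ℕ} {A : Matrix (Fin n) (Fin n) ℝ} {M : ℝ} (hM : 0 ≤ M)
    (hA : ∀ i j, |A i j| ≤ M) : |A.det| ≤ (√n * M) ^ n := by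
  refine (abs_det_le_prod_norm A).trans ?_
  calc ∏ i, ‖WithLp.toLp 2 (A i)‖ ≤ ∏ _i : Fin n, (√n * M) :=
        Finset.prod_le_prod (fun _ _ => norm_nonneg _) fun i _ => norm_toLp_le (hA i) hM
    _ = (√n * M) ^ n := by simp

/-- The determinant is Lipschitz in the entries; this is Hadamard's inequality combined with
multilinearity in the rows. -/
theorem abs_det_sub_det_le {n : ℕ} {A B : Matrix (Fin n) (Fin n) ℝ} {M δ : ℝ} (hM : 0 ≤ M)
    (hδ : 0 ≤ δ) (hA : ∀ i j, |A i j| ≤ M) (hB : ∀ i j, |B i j| ≤ M)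
    (hAB : ∀ i j, |A i j - B i j| ≤ δ) :
    |A.det - B.det| ≤ n * (√n * M) ^ (n - 1) * (√n * δ) := by
  let e : EuclideanSpace ℝ (Fin n) →ₗ[ℝ] (Fin n → ℝ) := (WithLp.linearEquiv 2 ℝ (Fin n → ℝ)).toLinearMap
  let f : MultilinearMap ℝ (fun _ : Fin n => EuclideanSpace ℝ (Fin n)) ℝ :=
    (Matrix.detRowAlternating (n := Fin n) (R := ℝ)).toMultilinearMap.compLinearMap fun _ => e
  have hf : ∀ m, ‖f m‖ ≤ 1 * ∏ i, ‖m i‖ := by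
    intro m
    rw [one_mul]
    exact abs_det_le_prod_norm (Matrix.of fun i => (m i).ofLp)
  have h := f.norm_image_sub_le_of_bound zero_le_one hf (fun i => WithLp.toLp 2 (A i))
    (fun i => WithLp.toLp 2 (B i))
  rw [one_mul, Fintype.card_fin] at h
  refine le_trans h ?_
  have h1 : ‖fun i => WithLp.toLp 2 (A i)‖ ≤ √n * M :=
    (pi_norm_le_iff_of_nonneg (by positivity)).2 fun i => norm_toLp_le (hA i) hM
  have h2 : ‖fun i => WithLp.toLp 2 (B i)‖ ≤ √n * M :=
    (pi_norm_le_iff_of_nonneg (by positivity)).2 fun i => norm_toLp_le (hB i) hM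
  have h3 : ‖(fun i => WithLp.toLp 2 (A i)) - fun i => WithLp.toLp 2 (B i)‖ ≤ √n * δ :=
    (pi_norm_le_iff_of_nonneg (by positivity)).2 fun i => by
      rw [Pi.sub_apply, ← WithLp.toLp_sub]
      exact norm_toLp_le (fun j => hAB i j) hδ
  gcongr
  exact max_le h1 h2

/-- The sum over all maps `p` of `det G(p, p)` counts every principal minor of size `k` exactly
`k!` times. -/
theorem sum_det_submatrix_eq {ι : Type*} [Fintype ι] [DecidableEq ι] (G : Matrix ι ι ℝ) (k : ℕ) :
    ∑ p : Fin k → ι, (G.submatrix p p).det =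
      k.factorial * ∑ s ∈ Finset.univ.powersetCard k,
        (G.submatrix (Subtype.val : s → ι) (Subtype.val : s → ι)).det := by
  have hzero : ∑ p : Fin k → ι, (G.submatrix p p).det =
      ∑ p : Fin k → ι with Function.Injective p, (G.submatrix p p).det := by
    refine (Finset.sum_subset (Finset.filter_subset _ _) ?_).symm
    intro p _ hp
    have hp' : ¬ Function.Injective p := by simpa using hp
    rw [Function.not_injective_iff] at hp'
    obtain ⟨i, j, hij, hne⟩ := hp'
    exact Matrix.det_zero_of_row_eq hne (by ext l; simp [hij])
  rw [hzero, ← Finset.sum_fiberwise_of_maps_to (g := fun p => Finset.univ.image p)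
    (t := Finset.univ.powersetCard k), Finset.mul_sum]
  · refine Finset.sum_congr rfl fun s hs => ?_
    have hcard : s.card = k := (Finset.mem_powersetCard.1 hs).2
    have hc : Fintype.card (Fin k ≃ s) = k.factorial := by
      rw [Fintype.card_equiv (Fintype.equivOfCardEq (by simp [hcard])), Fintype.card_fin]
    have : ∑ _e : Fin k ≃ s,
        (G.submatrix (Subtype.val : s → ι) (Subtype.val : s → ι)).det =
        ∑ p ∈ (Finset.univ.filter fun p : Fin k → ι => Function.Injective p) with
          Finset.univ.image p = s, (G.submatrix p p).det := by
      refine Finset.sum_bij (fun e _ => Subtype.val ∘ e) ?_ ?_ ?_ ?_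
      · intro e _
        simp only [Finset.mem_filter, Finset.mem_univ, true_and]
        refine ⟨Subtype.val_injective.comp e.injective, ?_⟩
        ext i
        simp only [Finset.mem_image, Finset.mem_univ, true_and, Function.comp_apply]
        constructor
        · rintro ⟨a, rfl⟩; exact (e a).2
        · intro hi; exact ⟨e.symm ⟨i, hi⟩, by simp⟩
      · intro e _ e' _ h
        ext i
        exact congrFun h i
      · intro p hp
        simp only [Finset.mem_filter, Finset.mem_univ, true_and] at hp
        obtain ⟨hinj, him⟩ := hp
        have hmem : ∀ i, p i ∈ s := fun i => him ▸ Finset.mem_image_of_mem p (Finset.mem_univ i)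
        refine ⟨Equiv.ofBijective (fun i => ⟨p i, hmem i⟩) ⟨?_, ?_⟩, Finset.mem_univ _, ?_⟩
        · intro i j hij
          exact hinj (congrArg Subtype.val hij)
        · rintro ⟨y, hy⟩
          rw [← him] at hy
          obtain ⟨i, -, hi⟩ := Finset.mem_image.1 hy
          exact ⟨i, Subtype.ext hi⟩
        · rfl
      · intro e _
        rw [← Matrix.det_submatrix_equiv_self e]
        rfl
    rw [← this, Finset.sum_const, Finset.card_univ, hc, nsmul_eq_mul]
  · intro p hp
    simp only [Finset.mem_filter, Finset.mem_univ, true_and] at hp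
    rw [Finset.mem_powersetCard]
    exact ⟨Finset.subset_univ _, by rw [Finset.card_image_of_injective _ hp]; simp⟩

/-- The expansion of `det (1 - G)` into principal minors, in the shape of a Fredholm series. -/
theorem hasSum_det_one_sub {ι : Type*} [Fintype ι] [DecidableEq ι] (G : Matrix ι ι ℝ) :
    HasSum (fun k : ℕ => (-1 : ℝ) ^ k / k.factorial * ∑ p : Fin k → ι, (G.submatrix p p).det)
      (1 - G).det := by
  open Polynomial in
  set P : ℝ[X] := (1 + (X : ℝ[X]) • G.map C).det with hP
  have hcoeff : ∀ k : ℕ, (-1 : ℝ) ^ k / k.factorial * ∑ p : Fin k → ι, (G.submatrix p p).det =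
      P.coeff k * (-1) ^ k := by
    intro k
    rw [sum_det_submatrix_eq, hP, Matrix.coeff_det_one_add_X_smul_eq_sum_minors]
    have := Nat.factorial_ne_zero k
    field_simp
  have heval : (1 - G).det = P.eval (-1) := by
    rw [hP, ← Polynomial.coe_evalRingHom, RingHom.map_det]
    congr 1
    ext i j
    by_cases hij : i = j <;>
      simp [hij, Matrix.sub_apply, sub_eq_add_neg]
  simp_rw [hcoeff]
  rw [heval, Polynomial.eval_eq_sum_range]
  refine hasSum_sum_of_ne_finset_zero fun k hk => ?_
  rw [Finset.mem_range, not_lt] at hk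
  rw [Polynomial.coeff_eq_zero_of_natDegree_lt (by omega), zero_mul]

variable {μ : Measure ℝ} [SigmaFinite μ]

theorem integrable_det_columns {n : ℕ} (F : Fin n → Fin n → ℝ → ℝ)
    (hF : ∀ i j, Integrable (F i j) μ) :
    Integrable (fun x : Fin n → ℝ => (Matrix.of fun i j => F i j (x j)).det)
      (Measure.pi fun _ => μ) := by
  simp_rw [Matrix.det_apply, Matrix.of_apply]
  refine integrable_finsetSum _ fun σ _ => Integrable.smul _ ?_
  exact Integrable.fintype_prod (f := fun j => F (σ j) j) fun j => hF _ _

theorem integral_det_columns {n : ℕ} (F : Fin n → Fin n → ℝ → ℝ)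
    (hF : ∀ i j, Integrable (F i j) μ) :
    ∫ x : Fin n → ℝ, (Matrix.of fun i j => F i j (x j)).det ∂(Measure.pi fun _ => μ) =
      (Matrix.of fun i j => ∫ t, F i j t ∂μ).det := by
  simp_rw [Matrix.det_apply, Matrix.of_apply]
  rw [integral_finsetSum]
  · refine Finset.sum_congr rfl fun σ _ => ?_
    simp only [Units.smul_def, zsmul_eq_mul]
    rw [integral_const_mul]
    congr 1
    exact integral_fintype_prod_eq_prod (𝕜 := ℝ) (fun j => F (σ j) j)
  · exact fun σ _ => Integrable.smul _
      (Integrable.fintype_prod (f := fun j => F (σ j) j) fun j => hF _ _)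

/-- **Andréief's identity**. -/
theorem integral_det_mul_det {n : ℕ} (f g : Fin n → ℝ → ℝ)
    (h : ∀ i j, Integrable (fun t => f i t * g j t) μ) :
    ∫ x : Fin n → ℝ, (Matrix.of fun i j => f i (x j)).det * (Matrix.of fun i j => g i (x j)).det
        ∂(Measure.pi fun _ => μ) =
      n.factorial * (Matrix.of fun i j => ∫ t, f i t * g j t ∂μ).det := by
  have hterm : ∀ (x : Fin n → ℝ),
      (Matrix.of fun i j => f i (x j)).det * (Matrix.of fun i j => g i (x j)).det =
      ∑ σ : Equiv.Perm (Fin n), (Equiv.Perm.sign σ : ℝ) *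
        (Matrix.of fun i j => f i (x j) * g (σ j) (x j)).det := by
    intro x
    rw [mul_comm, Matrix.det_apply' (Matrix.of fun i j => g i (x j)), Finset.sum_mul]
    refine Finset.sum_congr rfl fun σ _ => ?_
    have := Matrix.det_mul_row (fun j => g (σ j) (x j)) (Matrix.of fun i j => f i (x j))
    simp only [Matrix.of_apply] at this ⊢
    rw [mul_assoc, ← this]
    simp_rw [mul_comm]
  simp_rw [hterm]
  rw [integral_finsetSum]
  · have : ∀ σ : Equiv.Perm (Fin n), ∫ x : Fin n → ℝ, (Equiv.Perm.sign σ : ℝ) *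
        (Matrix.of fun i j => f i (x j) * g (σ j) (x j)).det ∂(Measure.pi fun _ => μ) =
        (Matrix.of fun i j => ∫ t, f i t * g j t ∂μ).det := by
      intro σ
      rw [integral_const_mul, integral_det_columns (fun i j t => f i t * g (σ j) t)
        (fun i j => h i (σ j))]
      have h2 := Matrix.det_permute' σ (Matrix.of fun i j => ∫ t, f i t * g j t ∂μ)
      have h3 : (Matrix.of fun i j => ∫ t, f i t * g j t ∂μ).submatrix id σ =
          Matrix.of fun i j => ∫ t, f i t * g (σ j) t ∂μ := rfl
      rw [← h3, h2, ← mul_assoc]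
      have : ((Equiv.Perm.sign σ : ℤ) : ℝ) * ((Equiv.Perm.sign σ : ℤ) : ℝ) = 1 := by
        rw [← Int.cast_mul, Int.units_coe_mul_self, Int.cast_one]
      rw [this, one_mul]
    simp_rw [this]
    simp [Fintype.card_perm]
  · exact fun σ _ => (integrable_det_columns (fun i j t => f i t * g (σ j) t)
        (fun i j => h i (σ j))).const_mul _

/-- The `n`-th minor of a degenerate kernel `∑ m, u m x * v m y`, expanded over its rank one
pieces. -/
theorem fredholmMinor_sum {ι : Type*} [Fintype ι] [DecidableEq ι] (u v : ι → ℝ → ℝ) (n : ℕ)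
    (x : Fin n → ℝ) :
    fredholmMinor (fun x y => ∑ m, u m x * v m y) n x =
      ∑ p : Fin n → ι, (Matrix.of fun i j => v (p i) (x j) * u (p j) (x j)).det := by
  have h := (Matrix.detRowAlternating (n := Fin n) (R := ℝ)).toMultilinearMap.map_sum
    (fun (i : Fin n) (m : ι) => u m (x i) • fun j => v m (x j))
  have h1 : fredholmMinor (fun x y => ∑ m, u m x * v m y) n x =
      Matrix.detRowAlternating (n := Fin n) (R := ℝ)
        (fun i => ∑ m, u m (x i) • fun j => v m (x j)) := by
    rw [fredholmMinor, Matrix.detRowAlternating]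
    change Matrix.det _ = Matrix.det _
    congr 1
    ext i j
    simp
  rw [h1]
  refine h.trans (Finset.sum_congr rfl fun p _ => ?_)
  refine ((Matrix.detRowAlternating (n := Fin n) (R := ℝ)).map_smul_univ
    (fun i => u (p i) (x i)) (fun i j => v (p i) (x j))).trans ?_
  have := Matrix.det_mul_row (fun j => u (p j) (x j)) (Matrix.of fun i j => v (p i) (x j))
  simp only [Matrix.of_apply] at this
  rw [smul_eq_mul]
  refine this.symm.trans ?_
  simp_rw [mul_comm]

/-- The Fredholm determinant of a degenerate kernel is a finite determinant. -/
theorem fredholmDet_sum {ι : Type*} [Fintype ι] [DecidableEq ι] (u v : ι → ℝ → ℝ)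
    (h : ∀ i j, Integrable (fun t => v i t * u j t) μ) :
    fredholmDet μ (fun x y => ∑ m, u m x * v m y) =
      (1 - Matrix.of fun i j => ∫ t, v i t * u j t ∂μ).det := by
  rw [← (hasSum_det_one_sub _).tsum_eq, fredholmDet]
  refine tsum_congr fun n => ?_
  rw [fredholmTerm]
  congr 1
  simp_rw [fredholmMinor_sum]
  rw [integral_finsetSum]
  · refine Finset.sum_congr rfl fun p _ => ?_
    rw [integral_det_columns (fun i j t => v (p i) t * u (p j) t) fun i j => h _ _]
    rfl
  · exact fun p _ => integrable_det_columns (fun i j t => v (p i) t * u (p j) t) fun i j => h _ _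

end Determinants

/-! ### Fredholm determinants of weighted bounded kernels -/

section FredholmBounds

/-- The majorant, up to a factor, of the `n`-th Fredholm term given by Hadamard's inequality. -/
def hadamardTerm (r : ℝ) (n : ℕ) : ℝ := n * (√n * r) ^ n / n.factorial

theorem hadamardTerm_nonneg {r : ℝ} (hr : 0 ≤ r) (n : ℕ) : 0 ≤ hadamardTerm r n := by
  unfold hadamardTerm; positivity

theorem summable_hadamardTerm {r : ℝ} (hr : 0 ≤ r) : Summable (hadamardTerm r) := by
  set D : ℝ := √(Real.exp 1) * r with hD
  have hD0 : 0 ≤ D := by positivity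
  -- `n ^ n ≤ e ^ n n!` bounds the term by `(4 D) ^ n / √n! * (1 / 2) ^ n`; then AM-GM
  have hbound : ∀ n : ℕ, hadamardTerm r n ≤ ((16 * D ^ 2) ^ n / n.factorial + (1 / 4) ^ n) / 2 := by
    intro n
    have hf : (0 : ℝ) < n.factorial := by exact_mod_cast n.factorial_pos
    set q : ℝ := √(n.factorial : ℝ) with hq
    have hq0 : 0 < q := Real.sqrt_pos.2 hf
    have hqq : q * q = n.factorial := Real.mul_self_sqrt hf.le
    have h1 : (√(n : ℝ)) ^ n ≤ √(Real.exp 1) ^ n * q := by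
      have h2 : (n : ℝ) ^ n ≤ Real.exp 1 ^ n * n.factorial := by
        have := Real.pow_div_factorial_le_exp (n : ℝ) (Nat.cast_nonneg n) n
        rw [div_le_iff₀ hf] at this
        rwa [← Real.exp_nat_mul, mul_one]
      have h3 : ((√(n : ℝ)) ^ n) ^ 2 ≤ (√(Real.exp 1) ^ n * q) ^ 2 := by
        rw [mul_pow, ← pow_mul, mul_comm n 2, pow_mul, Real.sq_sqrt (Nat.cast_nonneg n),
          ← pow_mul, mul_comm n 2, pow_mul, Real.sq_sqrt (Real.exp_pos 1).le, sq q, hqq]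
        exact h2
      exact (sq_le_sq₀ (by positivity) (by positivity)).1 h3
    have hn2 : (n : ℝ) ≤ 2 ^ n := by exact_mod_cast n.lt_two_pow_self.le
    have h4 : hadamardTerm r n ≤ ((4 * D) ^ n / q) * (1 / 2) ^ n := by
      unfold hadamardTerm
      rw [mul_pow, ← hqq]
      calc (n : ℝ) * (√n ^ n * r ^ n) / (q * q)
          ≤ 2 ^ n * ((√(Real.exp 1) ^ n * q) * r ^ n) / (q * q) := by gcongr
        _ = (2 ^ n * D ^ n) / q := by rw [hD, mul_pow]; field_simp
        _ = _ := by
          rw [div_mul_eq_mul_div, ← mul_pow, ← mul_pow]; congr 2; ring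
    have h5 : ((4 * D) ^ n / q) ^ 2 = (16 * D ^ 2) ^ n / n.factorial := by
      rw [div_pow, sq q, hqq, ← pow_mul, mul_comm n 2, pow_mul]; congr 2; ring
    have h6 : ((1 / 2 : ℝ) ^ n) ^ 2 = (1 / 4) ^ n := by
      rw [← pow_mul, mul_comm n 2, pow_mul]; norm_num
    nlinarith [sq_nonneg ((4 * D) ^ n / q - (1 / 2) ^ n)]
  refine Summable.of_nonneg_of_le (hadamardTerm_nonneg hr) hbound ?_
  exact ((Real.summable_pow_div_factorial _).add
    (summable_geometric_of_lt_one (by norm_num) (by norm_num))).div_const 2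

variable {μ : Measure ℝ} [SigmaFinite μ] {S : Set ℝ} {w : ℝ → ℝ}

theorem ae_pi_forall_mem (hS : ∀ᵐ x ∂μ, x ∈ S) (n : ℕ) :
    ∀ᵐ x : Fin n → ℝ ∂(Measure.pi fun _ => μ), ∀ i, x i ∈ S :=
  eventually_all.2 fun i => (Measure.tendsto_eval_ae_ae (μ := fun _ : Fin n => μ) (i := i)).eventually hS

theorem fredholmTerm_congr (hS : ∀ᵐ x ∂μ, x ∈ S) {k k' : ℝ → ℝ → ℝ}
    (h : ∀ x ∈ S, ∀ y ∈ S, k x y = k' x y) (n : ℕ) : fredholmTerm μ k n = fredholmTerm μ k' n := by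
  unfold fredholmTerm
  congr 1
  refine integral_congr_ae ?_
  filter_upwards [ae_pi_forall_mem hS n] with x hx
  unfold fredholmMinor
  congr 1
  ext i j
  exact h _ (hx i) _ (hx j)

theorem fredholmDet_congr (hS : ∀ᵐ x ∂μ, x ∈ S) {k k' : ℝ → ℝ → ℝ}
    (h : ∀ x ∈ S, ∀ y ∈ S, k x y = k' x y) : fredholmDet μ k = fredholmDet μ k' :=
  tsum_congr fun n => fredholmTerm_congr hS h n

/-- `k = w α w` on `S × S`, with a measurable factor `α` bounded by `M`. -/
structure WeightedKernel (S : Set ℝ) (w : ℝ → ℝ) (M : ℝ) (α k : ℝ → ℝ → ℝ) : Prop where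
  measurable : Measurable (Function.uncurry α)
  eq_mul : ∀ x ∈ S, ∀ y ∈ S, k x y = w x * α x y * w y
  abs_le : ∀ x ∈ S, ∀ y ∈ S, |α x y| ≤ M

theorem WeightedKernel.mono {M M' : ℝ} {α k : ℝ → ℝ → ℝ} (h : WeightedKernel S w M α k)
    (hM : M ≤ M') : WeightedKernel S w M' α k :=
  ⟨h.measurable, h.eq_mul, fun x hx y hy => (h.abs_le x hx y hy).trans hM⟩

theorem WeightedKernel.add {M M' : ℝ} {α k α' k' : ℝ → ℝ → ℝ} (h : WeightedKernel S w M α k)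
    (h' : WeightedKernel S w M' α' k') :
    WeightedKernel S w (M + M') (fun x y => α x y + α' x y) (fun x y => k x y + k' x y) where
  measurable := h.measurable.add h'.measurable
  eq_mul x hx y hy := by rw [h.eq_mul x hx y hy, h'.eq_mul x hx y hy]; ring
  abs_le x hx y hy := (abs_add_le _ _).trans (add_le_add (h.abs_le x hx y hy) (h'.abs_le x hx y hy))

theorem WeightedKernel.const_mul {M : ℝ} {α k : ℝ → ℝ → ℝ} (h : WeightedKernel S w M α k)
    (c : ℝ) : WeightedKernel S w (|c| * M) (fun x y => c * α x y) (fun x y => c * k x y) where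
  measurable := h.measurable.const_mul c
  eq_mul x hx y hy := by rw [h.eq_mul x hx y hy]; ring
  abs_le x hx y hy := by
    rw [abs_mul]; exact mul_le_mul_of_nonneg_left (h.abs_le x hx y hy) (abs_nonneg c)

theorem WeightedKernel.fredholmMinor_eq {M : ℝ} {α k : ℝ → ℝ → ℝ} (h : WeightedKernel S w M α k)
    {n : ℕ} {x : Fin n → ℝ} (hx : ∀ i, x i ∈ S) :
    fredholmMinor k n x = (∏ i, w (x i) ^ 2) * (Matrix.of fun i j => α (x i) (x j)).det := by
  have h1 := Matrix.det_mul_column (fun i => w (x i)) (Matrix.of fun i j => α (x i) (x j))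
  have h2 := Matrix.det_mul_row (fun i => w (x i))
    (Matrix.of fun i j => w (x i) * α (x i) (x j))
  have h3 : fredholmMinor k n x =
      (Matrix.of fun i j => w (x j) * (w (x i) * α (x i) (x j))).det := by
    unfold fredholmMinor
    congr 1
    ext i j
    simp only [Matrix.of_apply]
    rw [h.eq_mul _ (hx i) _ (hx j)]; ring
  simp only [Matrix.of_apply] at h1 h2
  rw [h3, h2, h1, ← mul_assoc, ← Finset.prod_mul_distrib]
  simp_rw [sq]

theorem WeightedKernel.aestronglyMeasurable {M : ℝ} {α k : ℝ → ℝ → ℝ}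
    (h : WeightedKernel S w M α k) (hS : ∀ᵐ x ∂μ, x ∈ S) (hw : Measurable w) (n : ℕ) :
    AEStronglyMeasurable (fredholmMinor k n) (Measure.pi fun _ => μ) := by
  have hm : Measurable fun x : Fin n → ℝ =>
      (∏ i, w (x i) ^ 2) * (Matrix.of fun i j => α (x i) (x j)).det := by
    refine Measurable.mul ?_ ?_
    · exact Finset.measurable_prod _ fun i _ => (hw.comp (measurable_pi_apply i)).pow_const 2
    · simp_rw [Matrix.det_apply', Matrix.of_apply]
      refine Finset.measurable_sum _ fun σ _ => Measurable.const_mul ?_ _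
      refine Finset.measurable_prod _ fun i _ => ?_
      exact h.measurable.comp (f := fun x : Fin n → ℝ => (x (σ i), x i)) (by fun_prop)
  refine (hm.aestronglyMeasurable).congr ?_
  filter_upwards [ae_pi_forall_mem hS n] with x hx
  exact (h.fredholmMinor_eq hx).symm

theorem integrable_prod_sq (hw2 : Integrable (fun x => w x ^ 2) μ) (n : ℕ) :
    Integrable (fun x : Fin n → ℝ => ∏ i, w (x i) ^ 2) (Measure.pi fun _ => μ) :=
  Integrable.fintype_prod (f := fun _ t => w t ^ 2) fun _ => hw2

theorem integral_prod_sq (n : ℕ) :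
    ∫ x : Fin n → ℝ, ∏ i, w (x i) ^ 2 ∂(Measure.pi fun _ => μ) = (∫ t, w t ^ 2 ∂μ) ^ n := by
  rw [integral_fintype_prod_eq_prod (𝕜 := ℝ) (fun _ t => w t ^ 2)]
  simp

theorem WeightedKernel.integrable_fredholmMinor {M : ℝ} {α k : ℝ → ℝ → ℝ}
    (h : WeightedKernel S w M α k) (hM : 0 ≤ M) (hS : ∀ᵐ x ∂μ, x ∈ S) (hw : Measurable w)
    (hw2 : Integrable (fun x => w x ^ 2) μ) (n : ℕ) :
    Integrable (fredholmMinor k n) (Measure.pi fun _ => μ) := by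
  refine Integrable.mono' ((integrable_prod_sq hw2 n).mul_const ((√n * M) ^ n))
    (h.aestronglyMeasurable hS hw n) ?_
  filter_upwards [ae_pi_forall_mem hS n] with x hx
  rw [h.fredholmMinor_eq hx, norm_mul, Real.norm_of_nonneg
    (Finset.prod_nonneg fun i _ => sq_nonneg _)]
  exact mul_le_mul_of_nonneg_left
    (abs_det_le_of_entries hM fun i j => h.abs_le _ (hx i) _ (hx j))
    (Finset.prod_nonneg fun i _ => sq_nonneg _)

theorem WeightedKernel.abs_fredholmTerm_le {M : ℝ} {α k : ℝ → ℝ → ℝ}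
    (h : WeightedKernel S w M α k) (hM : 0 ≤ M) (hS : ∀ᵐ x ∂μ, x ∈ S)
    (hw2 : Integrable (fun x => w x ^ 2) μ) (n : ℕ) :
    |fredholmTerm μ k n| ≤ (√n * (M * ∫ t, w t ^ 2 ∂μ)) ^ n / n.factorial := by
  unfold fredholmTerm
  have hle : |∫ x : Fin n → ℝ, fredholmMinor k n x ∂(Measure.pi fun _ => μ)| ≤
      (√n * (M * ∫ t, w t ^ 2 ∂μ)) ^ n := by
    rw [← Real.norm_eq_abs]
    refine (norm_integral_le_of_norm_le
      ((integrable_prod_sq hw2 n).mul_const ((√n * M) ^ n)) ?_).trans ?_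
    · filter_upwards [ae_pi_forall_mem hS n] with x hx
      rw [h.fredholmMinor_eq hx, norm_mul, Real.norm_of_nonneg
        (Finset.prod_nonneg fun i _ => sq_nonneg _)]
      exact mul_le_mul_of_nonneg_left
        (abs_det_le_of_entries hM fun i j => h.abs_le _ (hx i) _ (hx j))
        (Finset.prod_nonneg fun i _ => sq_nonneg _)
    · rw [integral_mul_const, integral_prod_sq, ← mul_pow]
      exact le_of_eq (by ring)
  rw [abs_mul, abs_div, abs_pow, abs_neg, abs_one, one_pow, Nat.abs_cast, one_div_mul_eq_div]
  gcongr

theorem WeightedKernel.summable_fredholmTerm {M : ℝ} {α k : ℝ → ℝ → ℝ}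
    (h : WeightedKernel S w M α k) (hM : 0 ≤ M) (hS : ∀ᵐ x ∂μ, x ∈ S)
    (hw2 : Integrable (fun x => w x ^ 2) μ) : Summable (fredholmTerm μ k) := by
  have hW : 0 ≤ ∫ t, w t ^ 2 ∂μ := integral_nonneg fun t => sq_nonneg _
  refine Summable.of_norm_bounded_eventually_nat
    (summable_hadamardTerm (mul_nonneg hM hW)) ?_
  filter_upwards [eventually_ge_atTop 1] with n hn
  refine (h.abs_fredholmTerm_le hM hS hw2 n).trans ?_
  unfold hadamardTerm
  have : (1 : ℝ) ≤ n := by exact_mod_cast hn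
  gcongr
  exact le_mul_of_one_le_left (by positivity) this

theorem WeightedKernel.fredholmConverges {M : ℝ} {α k : ℝ → ℝ → ℝ}
    (h : WeightedKernel S w M α k) (hM : 0 ≤ M) (hS : ∀ᵐ x ∂μ, x ∈ S) (hw : Measurable w)
    (hw2 : Integrable (fun x => w x ^ 2) μ) : FredholmConverges μ k :=
  ⟨h.integrable_fredholmMinor hM hS hw hw2, h.summable_fredholmTerm hM hS hw2⟩

/-- The Fredholm determinant is Lipschitz with respect to the weighted supremum norm, on bounded
sets of kernels. -/
theorem WeightedKernel.abs_fredholmDet_sub_le {M δ : ℝ} {α k β l : ℝ → ℝ → ℝ}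
    (hk : WeightedKernel S w M α k) (hl : WeightedKernel S w M β l) (hM : 1 ≤ M) (hδ : 0 ≤ δ)
    (hS : ∀ᵐ x ∂μ, x ∈ S) (hw : Measurable w) (hw2 : Integrable (fun x => w x ^ 2) μ)
    (hαβ : ∀ x ∈ S, ∀ y ∈ S, |α x y - β x y| ≤ δ) :
    |fredholmDet μ k - fredholmDet μ l| ≤
      δ * ∑' n, hadamardTerm (M * ∫ t, w t ^ 2 ∂μ) n := by
  have hM0 : 0 ≤ M := zero_le_one.trans hM
  have hW : 0 ≤ ∫ t, w t ^ 2 ∂μ := integral_nonneg fun t => sq_nonneg _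
  have hsum := (summable_hadamardTerm (mul_nonneg hM0 hW)).mul_left δ
  have hterm : ∀ n, ‖fredholmTerm μ k n - fredholmTerm μ l n‖ ≤
      δ * hadamardTerm (M * ∫ t, w t ^ 2 ∂μ) n := by
    intro n
    unfold fredholmTerm
    rw [← mul_sub, ← integral_sub (hk.integrable_fredholmMinor hM0 hS hw hw2 n)
      (hl.integrable_fredholmMinor hM0 hS hw hw2 n)]
    have hle : |∫ x : Fin n → ℝ, (fredholmMinor k n x - fredholmMinor l n x)
        ∂(Measure.pi fun _ => μ)| ≤ δ * (n * (√n * (M * ∫ t, w t ^ 2 ∂μ)) ^ n) := by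
      rw [← Real.norm_eq_abs]
      refine (norm_integral_le_of_norm_le
        ((integrable_prod_sq hw2 n).mul_const (δ * (n * (√n * M) ^ n))) ?_).trans ?_
      · filter_upwards [ae_pi_forall_mem hS n] with x hx
        rw [hk.fredholmMinor_eq hx, hl.fredholmMinor_eq hx, ← mul_sub, norm_mul,
          Real.norm_of_nonneg (Finset.prod_nonneg fun i _ => sq_nonneg _)]
        refine mul_le_mul_of_nonneg_left ?_ (Finset.prod_nonneg fun i _ => sq_nonneg _)
        refine (abs_det_sub_det_le hM0 hδ (fun i j => hk.abs_le _ (hx i) _ (hx j))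
          (fun i j => hl.abs_le _ (hx i) _ (hx j))
          (fun i j => hαβ _ (hx i) _ (hx j))).trans ?_
        rcases n with - | n
        · simp
        · rw [Nat.add_sub_cancel, pow_succ]
          have : √((n + 1 : ℕ) : ℝ) * δ ≤ √((n + 1 : ℕ) : ℝ) * (δ * M) := by
            gcongr
            exact le_mul_of_one_le_right hδ hM
          calc _ ≤ ((n + 1 : ℕ) : ℝ) * (√((n + 1 : ℕ) : ℝ) * M) ^ n *
                (√((n + 1 : ℕ) : ℝ) * (δ * M)) := by gcongr
            _ = _ := by ring
      · rw [integral_mul_const, integral_prod_sq]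
        refine le_of_eq ?_
        rw [mul_pow, mul_pow, mul_pow]; ring
    rw [norm_mul, norm_div, norm_pow, norm_neg, norm_one, one_pow, Real.norm_eq_abs,
      Real.norm_eq_abs, Nat.abs_cast, one_div_mul_eq_div]
    unfold hadamardTerm
    rw [← mul_div_assoc]
    gcongr
  unfold fredholmDet
  rw [← (hk.summable_fredholmTerm hM0 hS hw2).tsum_sub (hl.summable_fredholmTerm hM0 hS hw2),
    ← tsum_mul_left]
  exact tsum_of_norm_bounded hsum.hasSum hterm

end FredholmBounds

/-! ### Integral operators and their Fredholm determinants -/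

section Operators

variable {μ : Measure ℝ} {S : Set ℝ} {w : ℝ → ℝ}

theorem IsIntegralOperator.integralOperator_eq {k : ℝ → ℝ → ℝ}
    {T : Lp ℝ 2 μ →L[ℝ] Lp ℝ 2 μ} (hT : IsIntegralOperator μ k T) : integralOperator μ k = T := by
  unfold integralOperator
  have h : ∃ T, IsIntegralOperator μ k T := ⟨T, hT⟩
  rw [dif_pos h]
  exact h.choose_spec.unique hT

theorem IsIntegralOperator.add {k k' : ℝ → ℝ → ℝ} {T T' : Lp ℝ 2 μ →L[ℝ] Lp ℝ 2 μ}
    (hT : IsIntegralOperator μ k T) (hT' : IsIntegralOperator μ k' T') :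
    IsIntegralOperator μ (fun x y => k x y + k' x y) (T + T') := by
  intro f
  refine ⟨?_, ?_⟩
  · filter_upwards [(hT f).1, (hT' f).1] with x h1 h2
    exact (h1.add h2).congr (Eventually.of_forall fun y => (add_mul _ _ _).symm)
  · rw [add_apply]
    filter_upwards [Lp.coeFn_add (T f) (T' f), (hT f).1, (hT' f).1, (hT f).2, (hT' f).2]
      with x h0 h1 h2 h3 h4
    rw [h0, Pi.add_apply, h3, h4, ← integral_add h1 h2]
    simp only [add_mul]

theorem IsIntegralOperator.const_mul {k : ℝ → ℝ → ℝ} {T : Lp ℝ 2 μ →L[ℝ] Lp ℝ 2 μ}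
    (hT : IsIntegralOperator μ k T) (c : ℝ) :
    IsIntegralOperator μ (fun x y => c * k x y) (c • T) := by
  intro f
  refine ⟨?_, ?_⟩
  · filter_upwards [(hT f).1] with x h1
    simpa only [mul_assoc] using h1.const_mul c
  · rw [smul_apply]
    filter_upwards [Lp.coeFn_smul c (T f), (hT f).2] with x h0 h3
    rw [h0, Pi.smul_apply, h3, smul_eq_mul, ← integral_const_mul]
    simp only [mul_assoc]

theorem isIntegralOperator_zero : IsIntegralOperator μ (fun _ _ => 0) 0 := by
  intro f
  refine ⟨by simp, ?_⟩
  filter_upwards [Lp.coeFn_zero ℝ 2 μ] with x h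
  simpa using h

theorem IsIntegralOperator.sum {ι : Type*} (s : Finset ι) {k : ι → ℝ → ℝ → ℝ}
    {T : ι → Lp ℝ 2 μ →L[ℝ] Lp ℝ 2 μ} (hT : ∀ i ∈ s, IsIntegralOperator μ (k i) (T i)) :
    IsIntegralOperator μ (fun x y => ∑ i ∈ s, k i x y) (∑ i ∈ s, T i) := by
  classical
  induction s using Finset.induction_on with
  | empty => simpa using isIntegralOperator_zero
  | insert a s ha ih =>
    simp_rw [Finset.sum_insert ha]
    exact (hT a (Finset.mem_insert_self _ _)).add
      (ih fun i hi => hT i (Finset.mem_insert_of_mem hi))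

theorem IsIntegralOperator.congr (hS : ∀ᵐ x ∂μ, x ∈ S) {k k' : ℝ → ℝ → ℝ}
    {T : Lp ℝ 2 μ →L[ℝ] Lp ℝ 2 μ} (hT : IsIntegralOperator μ k T)
    (h : ∀ x ∈ S, ∀ y ∈ S, k x y = k' x y) : IsIntegralOperator μ k' T := by
  intro f
  have key : ∀ x ∈ S, (fun y => k x y * f y) =ᵐ[μ] fun y => k' x y * f y := fun x hx => by
    filter_upwards [hS] with y hy
    rw [h x hx y hy]
  refine ⟨?_, ?_⟩
  · filter_upwards [(hT f).1, hS] with x h1 hx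
    exact h1.congr (key x hx)
  · filter_upwards [(hT f).2, hS] with x h1 hx
    rw [h1]
    exact integral_congr_ae (key x hx)

/-- The rank one operator `f ↦ ⟪v, f⟫ u`. -/
def rankOneOp {H : Type*} [NormedAddCommGroup H] [InnerProductSpace ℝ H] (u v : H) : H →L[ℝ] H :=
  (innerSL ℝ v).smulRight u

@[simp] theorem rankOneOp_apply {H : Type*} [NormedAddCommGroup H] [InnerProductSpace ℝ H]
    (u v f : H) : rankOneOp u v f = inner ℝ v f • u := rfl

theorem inner_toLp {u : ℝ → ℝ} (hu : MemLp u 2 μ) (f : Lp ℝ 2 μ) :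
    inner ℝ (hu.toLp u) f = ∫ y, u y * f y ∂μ := by
  rw [L2.inner_def]
  refine integral_congr_ae ?_
  filter_upwards [hu.coeFn_toLp] with y hy
  rw [hy]; simp [mul_comm]

theorem inner_toLp_toLp {u v : ℝ → ℝ} (hu : MemLp u 2 μ) (hv : MemLp v 2 μ) :
    inner ℝ (hu.toLp u) (hv.toLp v) = ∫ y, u y * v y ∂μ := by
  rw [inner_toLp]
  refine integral_congr_ae ?_
  filter_upwards [hv.coeFn_toLp] with y hy
  rw [hy]

theorem isIntegralOperator_rankOneOp {u v : ℝ → ℝ} (hu : MemLp u 2 μ) (hv : MemLp v 2 μ) :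
    IsIntegralOperator μ (fun x y => u x * v y) (rankOneOp (hu.toLp u) (hv.toLp v)) := by
  intro f
  refine ⟨Eventually.of_forall fun x => ?_, ?_⟩
  · exact ((hv.integrable_mul (Lp.memLp f)).const_mul (u x)).congr
      (Eventually.of_forall fun y => (mul_assoc _ _ _).symm)
  · rw [rankOneOp_apply, inner_toLp]
    filter_upwards [Lp.coeFn_smul (∫ y, v y * f y ∂μ) (hu.toLp u), hu.coeFn_toLp] with x h1 h2
    rw [h1, Pi.smul_apply, h2, smul_eq_mul, mul_comm, ← integral_const_mul]
    simp only [mul_assoc]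

theorem isIntegralOperator_finiteRank {ι : Type*} [Fintype ι] {u v : ι → ℝ → ℝ}
    (hu : ∀ i, MemLp (u i) 2 μ) (hv : ∀ i, MemLp (v i) 2 μ) :
    IsIntegralOperator μ (fun x y => ∑ i, u i x * v i y)
      (∑ i, rankOneOp ((hu i).toLp (u i)) ((hv i).toLp (v i))) :=
  IsIntegralOperator.sum _ fun i _ => isIntegralOperator_rankOneOp (hu i) (hv i)

theorem norm_toLp_sq (hw : MemLp w 2 μ) : ‖hw.toLp w‖ ^ 2 = ∫ t, w t ^ 2 ∂μ := by
  rw [← real_inner_self_eq_norm_sq, inner_toLp_toLp]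
  simp_rw [sq]

variable [SigmaFinite μ]

/-- A weighted bounded kernel defines a bounded operator, of norm at most `M ∫ w²`. -/
theorem WeightedKernel.exists_isIntegralOperator {M : ℝ} {α k : ℝ → ℝ → ℝ}
    (h : WeightedKernel S w M α k) (hM : 0 ≤ M) (hS : ∀ᵐ x ∂μ, x ∈ S) (hw : Measurable w)
    (hw2 : MemLp w 2 μ) :
    ∃ T : Lp ℝ 2 μ →L[ℝ] Lp ℝ 2 μ, IsIntegralOperator μ k T ∧ ‖T‖ ≤ M * ∫ t, w t ^ 2 ∂μ := by
  have hint : ∀ f : Lp ℝ 2 μ, ∀ x ∈ S, Integrable (fun y => α x y * (w y * f y)) μ := by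
    intro f x hx
    refine Integrable.mono' ((hw2.integrable_mul (Lp.memLp f)).norm.const_mul M) ?_ ?_
    · refine AEStronglyMeasurable.mul ?_ (hw.aestronglyMeasurable.mul
        (Lp.aestronglyMeasurable f))
      exact (h.measurable.comp (f := fun y : ℝ => (x, y)) (by fun_prop)).aestronglyMeasurable
    · filter_upwards [hS] with y hy
      rw [norm_mul]
      exact mul_le_mul_of_nonneg_right (h.abs_le x hx y hy) (norm_nonneg _)
  -- the operator without the outer weight has bounded values on `S`
  let G : Lp ℝ 2 μ → ℝ → ℝ := fun f x => ∫ y, α x y * (w y * f y) ∂μ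
  have hGm : ∀ f, StronglyMeasurable (G f) := by
    intro f
    refine StronglyMeasurable.integral_prod_right (f := fun x y => α x y * (w y * f y)) ?_
    have : Measurable fun p : ℝ × ℝ => α p.1 p.2 * (w p.2 * f p.2) := by
      refine Measurable.mul h.measurable ?_
      exact (hw.comp measurable_snd).mul ((Lp.stronglyMeasurable f).measurable.comp measurable_snd)
    exact this.stronglyMeasurable
  have hGle : ∀ f : Lp ℝ 2 μ, ∀ x ∈ S, ‖G f x‖ ≤ M * (‖hw2.toLp w‖ * ‖f‖) := by
    intro f x hx
    have h1 : ‖G f x‖ ≤ ∫ y, M * (|w y| * |f y|) ∂μ := by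
      refine norm_integral_le_of_norm_le ?_ ?_
      · have := (hw2.integrable_mul (Lp.memLp f)).norm.const_mul M
        simpa [abs_mul] using this
      · filter_upwards [hS] with y hy
        rw [norm_mul, norm_mul]
        exact mul_le_mul_of_nonneg_right (h.abs_le x hx y hy) (by positivity)
    refine h1.trans ?_
    rw [integral_const_mul]
    refine mul_le_mul_of_nonneg_left ?_ hM
    have h2 : ∫ y, |w y| * |f y| ∂μ = inner ℝ (hw2.abs.toLp _) ((Lp.memLp f).abs.toLp _) := by
      rw [inner_toLp_toLp]; rfl
    rw [h2]
    refine (real_inner_le_norm _ _).trans (le_of_eq ?_)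
    rw [Lp.norm_toLp, Lp.norm_toLp, Lp.norm_toLp, Lp.norm_def]
    congr 2
    · exact eLpNorm_norm w
    · exact eLpNorm_norm f
  have hbd : ∀ f : Lp ℝ 2 μ, ∀ᵐ x ∂μ, ‖w x * G f x‖ ≤ (M * (‖hw2.toLp w‖ * ‖f‖)) * ‖w x‖ := by
    intro f
    filter_upwards [hS] with x hx
    rw [norm_mul, mul_comm]
    exact mul_le_mul_of_nonneg_right (hGle f x hx) (norm_nonneg _)
  have hmem : ∀ f, MemLp (fun x => w x * G f x) 2 μ := fun f =>
    MemLp.of_le_mul hw2 (hw.aestronglyMeasurable.mul (hGm f).aestronglyMeasurable) (hbd f)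
  let T₀ : Lp ℝ 2 μ →ₗ[ℝ] Lp ℝ 2 μ :=
    { toFun := fun f => (hmem f).toLp _
      map_add' := by
        intro f g
        refine Lp.ext ?_
        filter_upwards [(hmem (f + g)).coeFn_toLp, (hmem f).coeFn_toLp, (hmem g).coeFn_toLp,
          Lp.coeFn_add ((hmem f).toLp _) ((hmem g).toLp _), hS] with x h1 h2 h3 h4 hx
        rw [h1, h4, Pi.add_apply, h2, h3, ← mul_add]
        congr 1
        rw [← integral_add (hint f x hx) (hint g x hx)]
        refine integral_congr_ae ?_
        filter_upwards [Lp.coeFn_add f g] with y hy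
        rw [hy, Pi.add_apply]; ring
      map_smul' := by
        intro c f
        refine Lp.ext ?_
        filter_upwards [(hmem (c • f)).coeFn_toLp, (hmem f).coeFn_toLp,
          Lp.coeFn_smul c ((hmem f).toLp _)] with x h1 h2 h4
        rw [RingHom.id_apply, h1, h4, Pi.smul_apply, h2, smul_eq_mul, mul_left_comm]
        congr 1
        rw [← integral_const_mul]
        refine integral_congr_ae ?_
        filter_upwards [Lp.coeFn_smul c f] with y hy
        rw [hy, Pi.smul_apply, smul_eq_mul]; ring }
  have hT₀ : ∀ f, ‖T₀ f‖ ≤ (M * ∫ t, w t ^ 2 ∂μ) * ‖f‖ := by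
    intro f
    rw [← norm_toLp_sq hw2]
    refine (Lp.norm_le_mul_norm_of_ae_le_mul (g := hw2.toLp w)
      (c := M * (‖hw2.toLp w‖ * ‖f‖)) ?_).trans (le_of_eq (by ring))
    filter_upwards [(hmem f).coeFn_toLp, hw2.coeFn_toLp, hbd f] with x h1 h2 h3
    change ‖((hmem f).toLp _ : ℝ → ℝ) x‖ ≤ _
    rw [h1, h2]
    exact h3
  refine ⟨T₀.mkContinuous _ hT₀, ?_, T₀.mkContinuous_norm_le
    (mul_nonneg hM (integral_nonneg fun t => sq_nonneg _)) hT₀⟩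
  intro f
  have hk : ∀ x ∈ S, (fun y => k x y * f y) =ᵐ[μ] fun y => w x * (α x y * (w y * f y)) := by
    intro x hx
    filter_upwards [hS] with y hy
    rw [h.eq_mul x hx y hy]; ring
  refine ⟨?_, ?_⟩
  · filter_upwards [hS] with x hx
    exact ((hint f x hx).const_mul (w x)).congr (hk x hx).symm
  · change ((hmem f).toLp _ : ℝ → ℝ) =ᵐ[μ] _
    filter_upwards [(hmem f).coeFn_toLp, hS] with x h1 hx
    rw [h1, integral_congr_ae (hk x hx), integral_const_mul]

/-- The operator norm is controlled by the weighted supremum norm of the kernel. -/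
theorem WeightedKernel.norm_sub_le {δ M M' : ℝ} {α k β l : ℝ → ℝ → ℝ}
    (hk : WeightedKernel S w M α k) (hl : WeightedKernel S w M' β l) (hδ : 0 ≤ δ)
    (hS : ∀ᵐ x ∂μ, x ∈ S) (hw : Measurable w) (hw2 : MemLp w 2 μ)
    (hαβ : ∀ x ∈ S, ∀ y ∈ S, |α x y - β x y| ≤ δ) {T T' : Lp ℝ 2 μ →L[ℝ] Lp ℝ 2 μ}
    (hT : IsIntegralOperator μ k T) (hT' : IsIntegralOperator μ l T') :
    ‖T - T'‖ ≤ δ * ∫ t, w t ^ 2 ∂μ := by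
  have hd : WeightedKernel S w δ (fun x y => α x y + (-1) * β x y)
      (fun x y => k x y + (-1) * l x y) :=
    { measurable := hk.measurable.add (hl.measurable.const_mul _)
      eq_mul := fun x hx y hy => by rw [hk.eq_mul x hx y hy, hl.eq_mul x hx y hy]; ring
      abs_le := fun x hx y hy => by
        rw [neg_one_mul, ← sub_eq_add_neg]; exact hαβ x hx y hy }
  obtain ⟨D, hD, hDle⟩ := hd.exists_isIntegralOperator hδ hS hw hw2
  have : D = T - T' := by
    rw [hD.unique (hT.add (hT'.const_mul (-1)))]
    simp [sub_eq_add_neg]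
  exact this ▸ hDle

/-! ### Perturbations of finite rank -/

/-- A perturbation of finite rank multiplies the Fredholm determinant by a finite determinant
formed with the resolvent; here for a degenerate kernel, where both sides are finite determinants
and the identity is block elimination. -/
theorem fredholmDet_degenerate_add {ι κ : Type*} [Fintype ι] [DecidableEq ι] [Fintype κ]
    [DecidableEq κ] {u v : ι → ℝ → ℝ} {φ ψ : κ → ℝ → ℝ} (hu : ∀ i, MemLp (u i) 2 μ)
    (hv : ∀ i, MemLp (v i) 2 μ) (hφ : ∀ i, MemLp (φ i) 2 μ) (hψ : ∀ i, MemLp (ψ i) 2 μ)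
    {T : Lp ℝ 2 μ →L[ℝ] Lp ℝ 2 μ}
    (hT : IsIntegralOperator μ (fun x y => ∑ i, u i x * v i y) T) (hunit : IsUnit (1 - T))
    (ε : ℝ) :
    fredholmDet μ (fun x y => (∑ i, u i x * v i y) + ε * ∑ i, φ i x * ψ i y) =
      fredholmDet μ (fun x y => ∑ i, u i x * v i y) *
        (1 - ε • Matrix.of fun i j =>
          inner ℝ ((hψ i).toLp (ψ i)) (Ring.inverse (1 - T) ((hφ j).toLp (φ j)))).det := by
  set R := Ring.inverse (1 - T) with hR
  let U : ι → Lp ℝ 2 μ := fun i => (hu i).toLp (u i)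
  let V : ι → Lp ℝ 2 μ := fun i => (hv i).toLp (v i)
  let Φ : κ → Lp ℝ 2 μ := fun i => (hφ i).toLp (φ i)
  let Ψ : κ → Lp ℝ 2 μ := fun i => (hψ i).toLp (ψ i)
  have hTeq : T = ∑ i, rankOneOp (U i) (V i) := hT.unique (isIntegralOperator_finiteRank hu hv)
  have hRes : ∀ j, R (Φ j) = Φ j + ∑ i, inner ℝ (V i) (R (Φ j)) • U i := by
    intro j
    have h1 : (1 - T) * R = 1 := Ring.mul_inverse_cancel _ hunit
    have h2 : R (Φ j) - T (R (Φ j)) = Φ j := by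
      have := congrArg (fun A : Lp ℝ 2 μ →L[ℝ] Lp ℝ 2 μ => A (Φ j)) h1
      simpa using this
    have h3 : T (R (Φ j)) = ∑ i, inner ℝ (V i) (R (Φ j)) • U i := by
      rw [hTeq, sum_apply]; rfl
    rw [← h3, ← sub_eq_iff_eq_add, h2]
  let u' : ι ⊕ κ → ℝ → ℝ := Sum.elim u fun i x => ε * φ i x
  let v' : ι ⊕ κ → ℝ → ℝ := Sum.elim v ψ
  have hk : (fun x y => (∑ i, u i x * v i y) + ε * ∑ i, φ i x * ψ i y) =
      fun x y => ∑ m, u' m x * v' m y := by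
    ext x y
    rw [Fintype.sum_sum_type, Finset.mul_sum]
    simp [u', v', mul_assoc]
  have hu' : ∀ m, MemLp (u' m) 2 μ := by
    rintro (i | i)
    · exact hu i
    · exact (hφ i).const_mul ε
  have hv' : ∀ m, MemLp (v' m) 2 μ := by
    rintro (i | i)
    · exact hv i
    · exact hψ i
  rw [hk, fredholmDet_sum u' v' fun i j => (hv' i).integrable_mul (hu' j),
    fredholmDet_sum u v fun i j => (hv i).integrable_mul (hu j)]
  -- block elimination with the coefficients of the resolvent equation
  let G : Matrix ι ι ℝ := Matrix.of fun i j => inner ℝ (V i) (U j)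
  let B : Matrix ι κ ℝ := Matrix.of fun i j => inner ℝ (V i) (Φ j)
  let E : Matrix κ ι ℝ := Matrix.of fun i j => inner ℝ (Ψ i) (U j)
  let F : Matrix κ κ ℝ := Matrix.of fun i j => inner ℝ (Ψ i) (Φ j)
  let X : Matrix ι κ ℝ := Matrix.of fun i j => inner ℝ (V i) (R (Φ j))
  let W : Matrix κ κ ℝ := Matrix.of fun i j => inner ℝ (Ψ i) (R (Φ j))
  have hX : X = B + G * X := by
    ext i j
    simp only [X, B, G, Matrix.add_apply, Matrix.mul_apply, Matrix.of_apply]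
    conv_lhs => rw [hRes j, inner_add_right, inner_sum]
    simp_rw [inner_smul_right, mul_comm]
  have hW : W = F + E * X := by
    ext i j
    simp only [W, X, F, E, Matrix.add_apply, Matrix.mul_apply, Matrix.of_apply]
    conv_lhs => rw [hRes j, inner_add_right, inner_sum]
    simp_rw [inner_smul_right, mul_comm]
  have hM : (1 - Matrix.of fun i j => ∫ t, v' i t * u' j t ∂μ) =
      Matrix.fromBlocks (1 - G) (-(ε • B)) (-E) (1 - ε • F) := by
    ext (i | i) (j | j)
    · simp [u', v', G, U, V, inner_toLp_toLp, Matrix.one_apply]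
    · simp only [Matrix.sub_apply, Matrix.of_apply, Matrix.fromBlocks_apply₁₂, Matrix.neg_apply,
        Matrix.smul_apply, u', v', B, V, Φ, inner_toLp_toLp, Sum.elim_inl, Sum.elim_inr]
      rw [Matrix.one_apply_ne (by simp), zero_sub, smul_eq_mul, ← integral_const_mul]
      congr 2; ext t; ring
    · simp only [Matrix.sub_apply, Matrix.of_apply, Matrix.fromBlocks_apply₂₁, Matrix.neg_apply,
        u', v', E, U, Ψ, inner_toLp_toLp, Sum.elim_inl, Sum.elim_inr]
      rw [Matrix.one_apply_ne (by simp), zero_sub]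
    · simp only [Matrix.sub_apply, Matrix.of_apply, Matrix.fromBlocks_apply₂₂,
        Matrix.smul_apply, u', v', F, Ψ, Φ, inner_toLp_toLp, Sum.elim_inr]
      rw [smul_eq_mul, ← integral_const_mul]
      congr 1
      · simp [Matrix.one_apply]
      · congr 1; ext t; ring
  have hG : (Matrix.of fun i j => ∫ t, v i t * u j t ∂μ) = G := by
    ext i j
    simp [G, U, V, inner_toLp_toLp]
  have hmul : Matrix.fromBlocks (1 - G) (-(ε • B)) (-E) (1 - ε • F) *
      Matrix.fromBlocks 1 (ε • X) 0 1 = Matrix.fromBlocks (1 - G) 0 (-E) (1 - ε • W) := by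
    rw [Matrix.fromBlocks_multiply]
    congr 1
    · simp
    · rw [Matrix.mul_smul, Matrix.sub_mul, Matrix.one_mul, Matrix.mul_one, ← sub_eq_add_neg,
        ← smul_sub, sub_sub, add_comm (G * X), ← hX, sub_self, smul_zero]
    · simp
    · rw [Matrix.mul_smul, Matrix.neg_mul, Matrix.mul_one, hW, smul_add, smul_neg]
      abel
  have hdet := congrArg Matrix.det hmul
  rw [Matrix.det_mul, Matrix.det_fromBlocks_zero₂₁, Matrix.det_fromBlocks_zero₁₂, Matrix.det_one,
    Matrix.det_one, mul_one, mul_one] at hdet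
  rw [hM, hdet, hG]

/-- The factorization of `fredholmDet_degenerate_add` for a weighted bounded kernel that is the
limit of degenerate ones. -/
theorem fredholmDet_add_finiteRank {κ : Type*} [Fintype κ] [DecidableEq κ]
    {M : ℝ} {α k lam l : ℝ → ℝ → ℝ} {αn kn : ℕ → ℝ → ℝ → ℝ} {δ : ℕ → ℝ}
    (hS : ∀ᵐ x ∂μ, x ∈ S) (hw : Measurable w) (hw2 : MemLp w 2 μ)
    (hk : WeightedKernel S w M α k) (hl : WeightedKernel S w M lam l)
    (hkn : ∀ᶠ n in atTop, WeightedKernel S w M (αn n) (kn n))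
    (hδ : Tendsto δ atTop (𝓝 0))
    (hclose : ∀ᶠ n in atTop, ∀ x ∈ S, ∀ y ∈ S, |αn n x y - α x y| ≤ δ n)
    {ι : ℕ → Type*} [∀ n, Fintype (ι n)] [∀ n, DecidableEq (ι n)]
    {u v : (n : ℕ) → ι n → ℝ → ℝ} (hu : ∀ n i, MemLp (u n i) 2 μ)
    (hv : ∀ n i, MemLp (v n i) 2 μ)
    (hdeg : ∀ᶠ n in atTop, ∀ x ∈ S, ∀ y ∈ S, kn n x y = ∑ i, u n i x * v n i y)
    {φ ψ : κ → ℝ → ℝ} (hφ : ∀ i, MemLp (φ i) 2 μ) (hψ : ∀ i, MemLp (ψ i) 2 μ)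
    (hldeg : ∀ x ∈ S, ∀ y ∈ S, l x y = ∑ i, φ i x * ψ i y)
    {T : Lp ℝ 2 μ →L[ℝ] Lp ℝ 2 μ} (hT : IsIntegralOperator μ k T) (hunit : IsUnit (1 - T))
    (ε : ℝ) :
    fredholmDet μ (fun x y => k x y + ε * l x y) =
      fredholmDet μ k * (1 - ε • Matrix.of fun i j =>
        inner ℝ ((hψ i).toLp (ψ i)) (Ring.inverse (1 - T) ((hφ j).toLp (φ j)))).det := by
  have hw2' : Integrable (fun x => w x ^ 2) μ := hw2.integrable_sq
  let Tn : ℕ → Lp ℝ 2 μ →L[ℝ] Lp ℝ 2 μ := fun n =>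
    ∑ i, rankOneOp ((hu n i).toLp (u n i)) ((hv n i).toLp (v n i))
  have hTn : ∀ n, IsIntegralOperator μ (fun x y => ∑ i, u n i x * v n i y) (Tn n) := fun n =>
    isIntegralOperator_finiteRank (hu n) (hv n)
  have hTlim : Tendsto Tn atTop (𝓝 T) := by
    rw [tendsto_iff_norm_sub_tendsto_zero]
    have h0 : Tendsto (fun n => |δ n| * ∫ t, w t ^ 2 ∂μ) atTop (𝓝 0) := by
      simpa using hδ.abs.mul_const (∫ t, w t ^ 2 ∂μ)
    refine squeeze_zero' (Eventually.of_forall fun n => norm_nonneg _) ?_ h0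
    filter_upwards [hkn, hclose, hdeg] with n h1 h2 h3
    exact h1.norm_sub_le hk (abs_nonneg _) hS hw hw2
      (fun x hx y hy => (h2 x hx y hy).trans (le_abs_self _))
      ((hTn n).congr hS fun x hx y hy => (h3 x hx y hy).symm) hT
  have hdetlim : ∀ η : ℝ, Tendsto (fun n => fredholmDet μ (fun x y => kn n x y + η * l x y)) atTop
      (𝓝 (fredholmDet μ (fun x y => k x y + η * l x y))) := by
    intro η
    rw [tendsto_iff_norm_sub_tendsto_zero]
    set M' := max 1 (M + |η| * M) with hM'
    have h0 : Tendsto (fun n => |δ n| * ∑' m, hadamardTerm (M' * ∫ t, w t ^ 2 ∂μ) m)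
        atTop (𝓝 0) := by
      simpa using hδ.abs.mul_const (∑' m, hadamardTerm (M' * ∫ t, w t ^ 2 ∂μ) m)
    refine squeeze_zero' (Eventually.of_forall fun n => norm_nonneg _) ?_ h0
    filter_upwards [hkn, hclose] with n h1 h2
    refine WeightedKernel.abs_fredholmDet_sub_le ((h1.add (hl.const_mul η)).mono (le_max_right _ _))
      ((hk.add (hl.const_mul η)).mono (le_max_right _ _)) (le_max_left _ _) (abs_nonneg _) hS hw
      hw2' ?_
    intro x hx y hy
    rw [add_sub_add_right_eq_sub]
    exact (h2 x hx y hy).trans (le_abs_self _)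
  have hunitn : ∀ᶠ n in atTop, IsUnit (1 - Tn n) :=
    (tendsto_const_nhds.sub hTlim).eventually (hunit.unit.nhds)
  have hinv : Tendsto (fun n => Ring.inverse (1 - Tn n)) atTop (𝓝 (Ring.inverse (1 - T))) := by
    have h1 := NormedRing.inverse_continuousAt hunit.unit
    rw [IsUnit.unit_spec] at h1
    exact h1.tendsto.comp (tendsto_const_nhds.sub hTlim)
  have hWlim : Tendsto (fun n => (1 - ε • Matrix.of fun i j =>
      inner ℝ ((hψ i).toLp (ψ i)) (Ring.inverse (1 - Tn n) ((hφ j).toLp (φ j)))).det) atTop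
      (𝓝 (1 - ε • Matrix.of fun i j =>
        inner ℝ ((hψ i).toLp (ψ i)) (Ring.inverse (1 - T) ((hφ j).toLp (φ j)))).det) := by
    have hdet : Continuous fun A : Matrix κ κ ℝ => A.det := continuous_id.matrix_det
    refine (hdet.tendsto _).comp (f := fun n => 1 - ε • Matrix.of fun i j =>
      inner ℝ ((hψ i).toLp (ψ i)) (Ring.inverse (1 - Tn n) ((hφ j).toLp (φ j)))) ?_
    refine tendsto_const_nhds.sub (Tendsto.const_smul ?_ ε)
    refine tendsto_pi_nhds.2 fun i => tendsto_pi_nhds.2 fun j => ?_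
    have happ : Tendsto (fun n => Ring.inverse (1 - Tn n) ((hφ j).toLp (φ j))) atTop
        (𝓝 (Ring.inverse (1 - T) ((hφ j).toLp (φ j)))) :=
      ((ContinuousLinearMap.apply ℝ (Lp ℝ 2 μ) ((hφ j).toLp (φ j))).continuous.tendsto _).comp
        hinv
    exact tendsto_const_nhds.inner happ
  have hzero := hdetlim 0
  simp only [zero_mul, add_zero] at hzero
  refine tendsto_nhds_unique (hdetlim ε) ((hzero.mul hWlim).congr' ?_)
  filter_upwards [hunitn, hdeg] with n h1 h2
  rw [fredholmDet_congr hS h2, ← fredholmDet_degenerate_add (hu n) (hv n) hφ hψ (hTn n) h1 ε]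
  exact fredholmDet_congr hS fun x hx y hy => by rw [h2 x hx y hy, hldeg x hx y hy]

/-! ### Traces of operators of finite rank -/

section FiniteRank

variable {H : Type*} [NormedAddCommGroup H] [InnerProductSpace ℝ H]

/-- An operator of finite rank in the form required by `IsTraceClass`, padded by zeros. -/
theorem hasSum_finiteRank {m : ℕ} (u v : Fin m → H) :
    ∃ u' v' : ℕ → H, Summable (fun n => ‖u' n‖ * ‖v' n‖) ∧
      (∀ x, HasSum (fun n => inner ℝ (u' n) x • v' n) ((∑ i, rankOneOp (u i) (v i)) x)) ∧
      ∑' n, inner ℝ (u' n) (v' n) = ∑ i, inner ℝ (v i) (u i) := by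
  let u' : ℕ → H := fun n => if h : n < m then v ⟨n, h⟩ else 0
  let v' : ℕ → H := fun n => if h : n < m then u ⟨n, h⟩ else 0
  have hu' : ∀ i : Fin m, u' i = v i := fun i => by simp [u']
  have hv' : ∀ i : Fin m, v' i = u i := fun i => by simp [v']
  have hz : ∀ n, n ∉ Finset.range m → u' n = 0 := fun n hn => by
    simp only [Finset.mem_range, not_lt] at hn
    simp [u', Nat.not_lt.2 hn]
  refine ⟨u', v', ?_, ?_, ?_⟩
  · exact summable_of_ne_finset_zero (s := Finset.range m) fun n hn => by rw [hz n hn]; simp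
  · intro x
    have h : HasSum (fun n => inner ℝ (u' n) x • v' n)
        (∑ n ∈ Finset.range m, inner ℝ (u' n) x • v' n) :=
      hasSum_sum_of_ne_finset_zero fun n hn => by rw [hz n hn]; simp
    convert h using 1
    rw [← Fin.sum_univ_eq_sum_range (fun n => inner ℝ (u' n) x • v' n),
      sum_apply]
    exact Finset.sum_congr rfl fun i _ => by rw [hu', hv', rankOneOp_apply]
  · rw [tsum_eq_sum (s := Finset.range m) fun n hn => by rw [hz n hn]; simp,
      ← Fin.sum_univ_eq_sum_range (fun n => inner ℝ (u' n) (v' n))]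
    exact Finset.sum_congr rfl fun i _ => by rw [hu', hv']

theorem mul_sum_rankOneOp {m : ℕ} (A : H →L[ℝ] H) (u v : Fin m → H) :
    A * ∑ i, rankOneOp (u i) (v i) = ∑ i, rankOneOp (A (u i)) (v i) := by
  ext x
  simp [map_sum]

theorem isTraceClass_finiteRank {m : ℕ} (u v : Fin m → H) :
    IsTraceClass (∑ i, rankOneOp (u i) (v i)) := by
  obtain ⟨u', v', h1, h2, -⟩ := hasSum_finiteRank u v
  exact ⟨u', v', h1, h2⟩

variable [CompleteSpace H]

theorem opTrace_finiteRank {m : ℕ} (u v : Fin m → H) :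
    opTrace (∑ i, rankOneOp (u i) (v i)) = ∑ i, inner ℝ (v i) (u i) := by
  obtain ⟨u', v', h1, h2, h3⟩ := hasSum_finiteRank u v
  rw [opTrace, (hasSum_inner_basis (someBasis H) h1 h2).tsum_eq, h3]

end FiniteRank

/-- A determinant of the form `det (1 - ε W)` is affine in `ε` up to `O(ε²)`, being a polynomial in
`ε`. -/
theorem isBigO_det_one_sub_smul {m : ℕ} (W : Matrix (Fin m) (Fin m) ℝ) {ε : ℕ → ℝ}
    (hε : Tendsto ε atTop (𝓝 0)) :
    (fun n => (1 - ε n • W).det - (1 - ε n * W.trace)) =O[atTop] fun n => ε n ^ 2 := by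
  have h : ∀ n, (1 - ε n • W).det - (1 - ε n * W.trace) =
      (Polynomial.eval (-ε n)
        (Matrix.det (1 + (Polynomial.X : Polynomial ℝ) • W.map Polynomial.C)).divX.divX) *
        ε n ^ 2 := by
    intro n
    have := Matrix.det_one_add_smul (-ε n) W
    rw [neg_smul, ← sub_eq_add_neg] at this
    rw [this]
    ring
  simp_rw [h]
  have hb : (fun n => Polynomial.eval (-ε n)
      (Matrix.det (1 + (Polynomial.X : Polynomial ℝ) • W.map Polynomial.C)).divX.divX)
      =O[atTop] fun _ => (1 : ℝ) := by
    refine Tendsto.isBigO_one ℝ (((Polynomial.continuous _).tendsto _).comp hε.neg)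
  simpa using hb.mul (isBigO_refl (fun n => ε n ^ 2) atTop)

end Operators

/-! ### The entire part of the Bessel function -/

section Bessel

/-- Coefficients of `besselEntire`. -/
def besselCoeff (a : ℝ) (m : ℕ) : ℝ :=
  (-1 / 4) ^ m * (m.factorial : ℝ)⁻¹ * (Real.Gamma (m + a + 1))⁻¹

/-- The entire function `j_a(x) = ∑ (-x/4)^m / (m! Γ(m+a+1))`, for which
`J_a(u) = (u/2)^a j_a(u²)`. -/
def besselEntire (a x : ℝ) : ℝ := ∑' m : ℕ, besselCoeff a m * x ^ m

/-- The recursion `Γ(z+1) = z Γ(z)` for the reciprocal Gamma function, valid at the poles too. -/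
theorem inv_Gamma_eq (z : ℝ) : (Real.Gamma z)⁻¹ = z * (Real.Gamma (z + 1))⁻¹ := by
  rcases eq_or_ne z 0 with rfl | hz
  · simp [Real.Gamma_zero]
  · rw [Real.Gamma_add_one hz, mul_inv, ← mul_assoc, mul_inv_cancel₀ hz, one_mul]

theorem exists_abs_inv_Gamma_le (a : ℝ) : ∃ C : ℝ, 0 ≤ C ∧
    ∀ m : ℕ, |(Real.Gamma (m + a + 1))⁻¹| ≤ C := by
  obtain ⟨M, hM⟩ := exists_nat_ge (|a|)
  have hmono : ∀ m : ℕ, M ≤ m → |(Real.Gamma (m + a + 1))⁻¹| ≤ |(Real.Gamma (M + a + 1))⁻¹| := by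
    intro m hm
    induction m, hm using Nat.le_induction with
    | base => exact le_rfl
    | succ m hm ih =>
      refine le_trans ?_ ih
      have h1 : (1 : ℝ) ≤ m + a + 1 := by
        have h2 : (M : ℝ) ≤ m := by exact_mod_cast hm
        have := neg_abs_le a
        linarith
      rw [inv_Gamma_eq (m + a + 1), abs_mul, abs_of_pos (by linarith : (0 : ℝ) < m + a + 1)]
      have h3 : ((m + 1 : ℕ) : ℝ) + a + 1 = m + a + 1 + 1 := by push_cast; ring
      rw [h3]
      exact le_mul_of_one_le_left (abs_nonneg _) h1
  refine ⟨∑ m ∈ Finset.range (M + 1), |(Real.Gamma (m + a + 1))⁻¹|,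
    Finset.sum_nonneg fun _ _ => abs_nonneg _, fun m => ?_⟩
  have hle : ∀ i ∈ Finset.range (M + 1), |(Real.Gamma ((i : ℕ) + a + 1))⁻¹| ≤
      ∑ m ∈ Finset.range (M + 1), |(Real.Gamma (m + a + 1))⁻¹| := fun i hi =>
    Finset.single_le_sum (f := fun m : ℕ => |(Real.Gamma (m + a + 1))⁻¹|)
      (fun _ _ => abs_nonneg _) hi
  rcases le_total m M with h | h
  · exact hle m (Finset.mem_range.2 (by omega))
  · exact (hmono m h).trans (hle M (Finset.mem_range.2 (by omega)))

theorem summable_norm_besselCoeff (a x : ℝ) : Summable fun m => ‖besselCoeff a m * x ^ m‖ := by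
  obtain ⟨C, hC0, hC⟩ := exists_abs_inv_Gamma_le a
  refine Summable.of_nonneg_of_le (fun _ => norm_nonneg _) (fun m => ?_)
    ((Real.summable_pow_div_factorial (|x|)).mul_left C)
  unfold besselCoeff
  have h1 : |(-1 / 4 : ℝ) ^ m| ≤ 1 := by
    rw [abs_pow]; exact pow_le_one₀ (abs_nonneg _) (by norm_num [abs_div])
  rw [Real.norm_eq_abs, abs_mul, abs_mul, abs_mul, abs_pow x m, abs_inv, Nat.abs_cast]
  calc |(-1 / 4 : ℝ) ^ m| * (m.factorial : ℝ)⁻¹ * |(Real.Gamma (m + a + 1))⁻¹| * |x| ^ m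
      ≤ 1 * (m.factorial : ℝ)⁻¹ * C * |x| ^ m := by gcongr; exact hC m
    _ = C * (|x| ^ m / m.factorial) := by ring

theorem summable_besselCoeff (a x : ℝ) : Summable fun m => besselCoeff a m * x ^ m :=
  (summable_norm_besselCoeff a x).of_norm

theorem succ_mul_besselCoeff_succ (a : ℝ) (m : ℕ) :
    (m + 1) * besselCoeff a (m + 1) = -1 / 4 * besselCoeff (a + 1) m := by
  unfold besselCoeff
  have h : ((m + 1 : ℕ) : ℝ) + a + 1 = m + (a + 1) + 1 := by push_cast; ring
  have hf : (m.factorial : ℝ) ≠ 0 := by exact_mod_cast m.factorial_ne_zero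
  have hm : (m + 1 : ℝ) ≠ 0 := by positivity
  rw [h, Nat.factorial_succ, Nat.cast_mul, pow_succ]
  push_cast
  field_simp

theorem hasDerivAt_besselEntire (a x : ℝ) :
    HasDerivAt (besselEntire a) (-1 / 4 * besselEntire (a + 1) x) x := by
  obtain ⟨R, hR⟩ := exists_gt |x|
  have hR0 : 0 < R := (abs_nonneg x).trans_lt hR
  have hsum : Summable fun m : ℕ => ‖besselCoeff a m * (m * R ^ (m - 1))‖ := by
    rw [← summable_nat_add_iff 1]
    refine ((summable_norm_besselCoeff (a + 1) R).mul_left (1 / 4)).congr fun m => ?_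
    have h1 : besselCoeff a (m + 1) * (((m + 1 : ℕ) : ℝ) * R ^ (m + 1 - 1)) =
        -1 / 4 * (besselCoeff (a + 1) m * R ^ m) := by
      rw [← mul_assoc (-1 / 4 : ℝ), ← succ_mul_besselCoeff_succ]
      push_cast [Nat.add_sub_cancel]
      ring
    rw [h1, norm_mul (-1 / 4 : ℝ)]
    norm_num
  have hd := hasDerivAt_tsum_of_isPreconnected (t := Metric.ball (0 : ℝ) R)
    (g := fun m x => besselCoeff a m * x ^ m) (g' := fun m x => besselCoeff a m * (m * x ^ (m - 1)))
    (y₀ := 0) (y := x) hsum Metric.isOpen_ball (convex_ball 0 R).isPreconnected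
    (fun m y _ => (hasDerivAt_pow m y).const_mul _)
    (fun m y hy => by
      have hy' : |y| ≤ R := by
        rw [mem_ball_zero_iff, Real.norm_eq_abs] at hy; exact hy.le
      rw [norm_mul, norm_mul, norm_mul, norm_mul, norm_pow, norm_pow, Real.norm_eq_abs y,
        Real.norm_of_nonneg hR0.le]
      gcongr)
    (by simpa using hR0) (summable_besselCoeff a 0)
    (by rwa [mem_ball_zero_iff, Real.norm_eq_abs])
  have htsum : ∑' m : ℕ, besselCoeff a m * (m * x ^ (m - 1)) = -1 / 4 * besselEntire (a + 1) x := by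
    have hs : Summable fun m : ℕ => besselCoeff a m * (m * x ^ (m - 1)) := by
      refine Summable.of_norm_bounded hsum fun m => ?_
      rw [norm_mul, norm_mul, norm_mul, norm_mul, norm_pow, norm_pow, Real.norm_eq_abs x,
        Real.norm_of_nonneg hR0.le]
      gcongr
    rw [hs.tsum_eq_zero_add, besselEntire, ← tsum_mul_left]
    simp only [Nat.cast_zero, zero_mul, mul_zero, zero_add]
    refine tsum_congr fun m => ?_
    rw [← mul_assoc (-1 / 4 : ℝ), ← succ_mul_besselCoeff_succ]
    push_cast [Nat.add_sub_cancel]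
    ring
  rw [htsum] at hd
  exact hd

theorem continuous_besselEntire (a : ℝ) : Continuous (besselEntire a) :=
  continuous_iff_continuousAt.2 fun x => (hasDerivAt_besselEntire a x).continuousAt

/-- Bessel's equation for the entire part, as a recursion in the order. -/
theorem besselEntire_eq (a x : ℝ) :
    besselEntire a x = (a + 1) * besselEntire (a + 1) x - x / 4 * besselEntire (a + 2) x := by
  have hs := summable_besselCoeff (a + 1) x
  have h1 : ∀ m : ℕ, besselCoeff a m * x ^ m =
      (a + 1) * (besselCoeff (a + 1) m * x ^ m) + m * (besselCoeff (a + 1) m * x ^ m) := by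
    intro m
    unfold besselCoeff
    have h : (m : ℝ) + (a + 1) + 1 = m + a + 1 + 1 := by ring
    rw [inv_Gamma_eq (m + a + 1), h]; ring
  have h2 : ∀ m : ℕ, ((m + 1 : ℕ) : ℝ) * (besselCoeff (a + 1) (m + 1) * x ^ (m + 1)) =
      -(x / 4) * (besselCoeff (a + 2) m * x ^ m) := by
    intro m
    have := succ_mul_besselCoeff_succ (a + 1) m
    rw [show a + 1 + 1 = a + 2 by ring] at this
    rw [← mul_assoc]
    push_cast
    rw [this, pow_succ]; ring
  have hs2 : Summable fun m : ℕ => (m : ℝ) * (besselCoeff (a + 1) m * x ^ m) := by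
    rw [← summable_nat_add_iff 1]
    exact ((summable_besselCoeff (a + 2) x).mul_left (-(x / 4))).congr fun m => (h2 m).symm
  unfold besselEntire
  rw [tsum_congr h1, (hs.mul_left (a + 1)).tsum_add hs2, tsum_mul_left, hs2.tsum_eq_zero_add]
  simp_rw [h2, tsum_mul_left]
  simp [sub_eq_add_neg]

theorem besselEntire_zero (a : ℝ) : besselEntire a 0 = (Real.Gamma (a + 1))⁻¹ := by
  unfold besselEntire
  rw [tsum_eq_single 0 fun m hm => by simp [hm]]
  simp [besselCoeff]

theorem besselJ_eq (a : ℝ) {u : ℝ} (hu : 0 < u) :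
    besselJ a u = (u / 2) ^ a * besselEntire a (u ^ 2) := by
  unfold besselJ besselEntire
  rw [← tsum_mul_left]
  refine tsum_congr fun m => ?_
  have h2 : 0 < u / 2 := by positivity
  rw [Real.rpow_add h2, Real.rpow_mul h2.le, Real.rpow_two, Real.rpow_natCast, besselCoeff,
    Real.Gamma_nat_eq_factorial]
  have : ((u / 2) ^ 2) ^ m * (-1 : ℝ) ^ m = (-1 / 4) ^ m * (u ^ 2) ^ m := by
    rw [← mul_pow, ← mul_pow]; congr 1; ring
  linear_combination (m.factorial : ℝ)⁻¹ * (Real.Gamma (m + a + 1))⁻¹ * (u / 2) ^ a * this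

theorem mul_besselJ'_eq (a : ℝ) {u : ℝ} (hu : 0 < u) :
    u * besselJ' a u =
      (u / 2) ^ a * (a * besselEntire a (u ^ 2) - u ^ 2 / 2 * besselEntire (a + 1) (u ^ 2)) := by
  have h2 : 0 < u / 2 := by positivity
  have hd : HasDerivAt (fun v : ℝ => (v / 2) ^ a * besselEntire a (v ^ 2))
      ((1 / 2 * a * (u / 2) ^ (a - 1)) * besselEntire a (u ^ 2) +
        (u / 2) ^ a * ((-1 / 4 * besselEntire (a + 1) (u ^ 2)) * (2 * u))) u := by
    have e1 : HasDerivAt (fun v : ℝ => (v / 2) ^ a) (1 / 2 * a * (u / 2) ^ (a - 1)) u :=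
      ((hasDerivAt_id u).div_const 2).rpow_const (Or.inl h2.ne')
    have e2 : HasDerivAt (fun v : ℝ => besselEntire a (v ^ 2))
        ((-1 / 4 * besselEntire (a + 1) (u ^ 2)) * (2 * u)) u := by
      have := (hasDerivAt_besselEntire a (u ^ 2)).comp u (hasDerivAt_pow 2 u)
      simpa [Function.comp_def] using this
    exact e1.mul e2
  have heq : besselJ a =ᶠ[𝓝 u] fun v : ℝ => (v / 2) ^ a * besselEntire a (v ^ 2) := by
    filter_upwards [lt_mem_nhds hu] with v hv using besselJ_eq a hv
  have h3 : (u / 2) ^ (a - 1) * (u / 2) = (u / 2) ^ a := by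
    rw [Real.rpow_sub_one h2.ne', div_mul_cancel₀ _ h2.ne']
  rw [besselJ', heq.deriv_eq, hd.deriv]
  linear_combination a * besselEntire a (u ^ 2) * h3

theorem sqrt_half_rpow (a : ℝ) {x : ℝ} (hx : 0 < x) :
    (√x / 2) ^ a = 2 ^ (-a) * x ^ (a / 2) := by
  rw [Real.div_rpow (Real.sqrt_nonneg _) (by norm_num), Real.sqrt_eq_rpow, ← Real.rpow_mul hx.le,
    Real.rpow_neg (by norm_num), div_eq_mul_inv, mul_comm]
  congr 2; ring

theorem besselJ_sqrt (a : ℝ) {x : ℝ} (hx : 0 < x) :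
    besselJ a (√x) = 2 ^ (-a) * x ^ (a / 2) * besselEntire a x := by
  rw [besselJ_eq a (Real.sqrt_pos.2 hx), Real.sq_sqrt hx.le, sqrt_half_rpow a hx]

theorem sqrt_mul_besselJ'_sqrt (a : ℝ) {x : ℝ} (hx : 0 < x) :
    √x * besselJ' a (√x) = 2 ^ (-a) * x ^ (a / 2) *
      (a * besselEntire a x + 2 * (x * (-1 / 4 * besselEntire (a + 1) x))) := by
  rw [mul_besselJ'_eq a (Real.sqrt_pos.2 hx), Real.sq_sqrt hx.le, sqrt_half_rpow a hx]
  ring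

end Bessel

/-! ### Laguerre polynomials -/

section Laguerre

/-- The Laguerre polynomial divided by `Γ(n+a+1) / n!`:
`∑ (-1)^k n(n-1)⋯(n-k+1) x^k / (k! Γ(k+a+1))`. -/
def laguerreNorm (a : ℝ) (n : ℕ) (x : ℝ) : ℝ :=
  ∑ k ∈ Finset.range (n + 1),
    (-1 : ℝ) ^ k * (n.descFactorial k : ℝ) * (k.factorial : ℝ)⁻¹ * (Real.Gamma (k + a + 1))⁻¹ * x ^ k

theorem laguerreL_eq (a : ℝ) (n : ℕ) (x : ℝ) :
    laguerreL a n x = Real.Gamma (a + n + 1) / n.factorial * laguerreNorm a n x := by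
  unfold laguerreL laguerreNorm
  rw [Finset.mul_sum]
  refine Finset.sum_congr rfl fun k hk => ?_
  have hk' : k ≤ n := Nat.lt_succ_iff.1 (Finset.mem_range.1 hk)
  have h1 : ((n - k).factorial : ℝ) * (n.descFactorial k : ℝ) = n.factorial := by
    exact_mod_cast Nat.factorial_mul_descFactorial hk'
  have h2 : ((n - k).factorial : ℝ) ≠ 0 := by exact_mod_cast (n - k).factorial_ne_zero
  have h4 : (n.factorial : ℝ) ≠ 0 := by exact_mod_cast n.factorial_ne_zero
  have h5 : (n.descFactorial k : ℝ) / n.factorial = ((n - k).factorial : ℝ)⁻¹ := by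
    rw [← h1] at h4 ⊢
    field_simp
    exact div_self (right_ne_zero_of_mul h4)
  rw [show (n : ℝ) + a + 1 = a + n + 1 by ring, div_eq_mul_inv (Real.Gamma (a + n + 1)) (_ * _ * _),
    mul_inv, mul_inv, ← h5]
  ring

/-- The sum defining `laguerreNorm` may be taken over any longer range. -/
theorem laguerreNorm_eq_sum (a : ℝ) {n m : ℕ} (h : n < m) (x : ℝ) :
    laguerreNorm a n x = ∑ k ∈ Finset.range m,
      (-1 : ℝ) ^ k * (n.descFactorial k : ℝ) * (k.factorial : ℝ)⁻¹ * (Real.Gamma (k + a + 1))⁻¹ *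
        x ^ k := by
  unfold laguerreNorm
  refine Finset.sum_subset (Finset.range_subset_range.2 h) fun k _ hk => ?_
  rw [Finset.mem_range, not_lt] at hk
  rw [Nat.descFactorial_of_lt (by omega)]
  simp

theorem laguerreNorm_succ (a : ℝ) (n : ℕ) (x : ℝ) :
    laguerreNorm a (n + 1) x = laguerreNorm a n x - x * laguerreNorm (a + 1) n x := by
  rw [laguerreNorm_eq_sum a (Nat.lt_succ_self (n + 1)),
    laguerreNorm_eq_sum a (show n < n + 1 + 1 by omega), Finset.sum_range_succ' _ (n + 1),
    Finset.sum_range_succ' _ (n + 1), laguerreNorm, Finset.mul_sum, add_sub_right_comm,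
    ← Finset.sum_sub_distrib]
  simp only [Nat.descFactorial_zero]
  congr 1
  refine Finset.sum_congr rfl fun k hk => ?_
  have hk' : k ≤ n := Nat.lt_succ_iff.1 (Finset.mem_range.1 hk)
  have h : ((k + 1 : ℕ) : ℝ) + a + 1 = k + (a + 1) + 1 := by push_cast; ring
  have hf : (k.factorial : ℝ) ≠ 0 := by exact_mod_cast k.factorial_ne_zero
  rw [h, Nat.succ_descFactorial_succ, Nat.descFactorial_succ, Nat.factorial_succ]
  push_cast [Nat.cast_sub hk']
  field_simp
  ring

theorem hasDerivAt_laguerreNorm_sum (a : ℝ) (n : ℕ) (x : ℝ) :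
    HasDerivAt (laguerreNorm a n) (∑ k ∈ Finset.range (n + 1),
      (-1 : ℝ) ^ k * (n.descFactorial k : ℝ) * (k.factorial : ℝ)⁻¹ * (Real.Gamma (k + a + 1))⁻¹ *
        (k * x ^ (k - 1))) x := by
  unfold laguerreNorm
  exact HasDerivAt.fun_sum fun k _ => (hasDerivAt_pow k x).const_mul _

theorem mul_deriv_laguerreNorm (a : ℝ) (n : ℕ) (x : ℝ) :
    x * deriv (laguerreNorm (a + 1) n) x + (a + 1) * laguerreNorm (a + 1) n x =
      laguerreNorm a n x := by
  rw [(hasDerivAt_laguerreNorm_sum (a + 1) n x).deriv]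
  unfold laguerreNorm
  rw [Finset.mul_sum, Finset.mul_sum, ← Finset.sum_add_distrib]
  refine Finset.sum_congr rfl fun k _ => ?_
  have h : (k : ℝ) + (a + 1) + 1 = k + a + 1 + 1 := by ring
  have h2 : x * (k * x ^ (k - 1)) = k * x ^ k := by
    rcases k with - | k
    · simp
    · rw [Nat.add_sub_cancel, pow_succ]; ring
  rw [inv_Gamma_eq (k + a + 1), h]
  linear_combination (-1 : ℝ) ^ k * (n.descFactorial k : ℝ) * (k.factorial : ℝ)⁻¹ *
    (Real.Gamma (k + a + 1 + 1))⁻¹ * h2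

theorem deriv_laguerreNorm_succ (a : ℝ) (n : ℕ) (x : ℝ) :
    deriv (laguerreNorm a (n + 1)) x = -(n + 1) * laguerreNorm (a + 1) n x := by
  rw [(hasDerivAt_laguerreNorm_sum a (n + 1) x).deriv, Finset.sum_range_succ', laguerreNorm,
    Finset.mul_sum]
  simp only [Nat.cast_zero, zero_mul, mul_zero, add_zero]
  refine Finset.sum_congr rfl fun k hk => ?_
  have h : ((k + 1 : ℕ) : ℝ) + a + 1 = k + (a + 1) + 1 := by push_cast; ring
  have hf : (k.factorial : ℝ) ≠ 0 := by exact_mod_cast k.factorial_ne_zero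
  rw [h, Nat.succ_descFactorial_succ, Nat.factorial_succ, Nat.add_sub_cancel]
  push_cast
  field_simp
  ring

theorem differentiable_laguerreNorm (a : ℝ) (n : ℕ) : Differentiable ℝ (laguerreNorm a n) :=
  fun x => (hasDerivAt_laguerreNorm_sum a n x).differentiableAt

theorem continuous_laguerreNorm (a : ℝ) (n : ℕ) : Continuous (laguerreNorm a n) :=
  (differentiable_laguerreNorm a n).continuous

theorem laguerreNorm_zero_right (a : ℝ) (n : ℕ) : laguerreNorm a n 0 = (Real.Gamma (a + 1))⁻¹ := by
  unfold laguerreNorm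
  rw [Finset.sum_range_succ']
  simp

/-- Differentiation expressed through the raised order. -/
theorem deriv_laguerreNorm (a : ℝ) (n : ℕ) (x : ℝ) :
    deriv (laguerreNorm a n) x = laguerreNorm a n x - (n + 1 + a) * laguerreNorm (a + 1) n x := by
  have h1 : laguerreNorm a (n + 1) = fun x => laguerreNorm a n x - x * laguerreNorm (a + 1) n x :=
    funext fun x => laguerreNorm_succ a n x
  have h2 := deriv_laguerreNorm_succ a n x
  have h3 := ((differentiable_laguerreNorm a n x).hasDerivAt.sub ((hasDerivAt_id x).mul
    (differentiable_laguerreNorm (a + 1) n x).hasDerivAt)).deriv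
  have h4 := mul_deriv_laguerreNorm a n x
  have h5 : deriv (laguerreNorm a (n + 1)) x = deriv (laguerreNorm a n) x -
      (1 * laguerreNorm (a + 1) n x + x * deriv (laguerreNorm (a + 1) n) x) := by
    rw [h1]; exact h3
  linear_combination h2 - h5 + h4

end Laguerre

/-! ### The first order system behind both kernels -/

section System

/-- Solutions, regular at `0`, of `U' = (1 - εx) w`, `x w' + (a+1) w = -U/4`. The entire part of
the Bessel function solves the system with `ε = 0`; the Laguerre polynomials of degrees `N - 1` and
`N`, rescaled by `c = 4N + 2a`, give the solution with `ε = c⁻²`. -/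
structure IsSystemSolution (a ε : ℝ) (U w : ℝ → ℝ) : Prop where
  hasDerivAt_left : ∀ x, HasDerivAt U ((1 - ε * x) * w x) x
  differentiable_right : Differentiable ℝ w
  mul_deriv_right : ∀ x, x * deriv w x + (a + 1) * w x = -U x / 4
  left_zero : U 0 = (Real.Gamma (a + 1))⁻¹

variable {a : ℝ}

theorem IsSystemSolution.continuous_left {ε : ℝ} {U w : ℝ → ℝ} (h : IsSystemSolution a ε U w) :
    Continuous U := continuous_iff_continuousAt.2 fun x => (h.hasDerivAt_left x).continuousAt

theorem IsSystemSolution.continuous_right {ε : ℝ} {U w : ℝ → ℝ} (h : IsSystemSolution a ε U w) :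
    Continuous w := h.differentiable_right.continuous

/-- The derivative `j_a' = -j_{a+1}/4`. -/
def besselEntire' (a x : ℝ) : ℝ := -1 / 4 * besselEntire (a + 1) x

theorem isSystemSolution_bessel (a : ℝ) :
    IsSystemSolution a 0 (besselEntire a) (besselEntire' a) where
  hasDerivAt_left x := by
    rw [zero_mul, sub_zero, one_mul]; exact hasDerivAt_besselEntire a x
  differentiable_right x :=
    ((hasDerivAt_besselEntire (a + 1) x).const_mul (-1 / 4)).differentiableAt
  mul_deriv_right x := by
    unfold besselEntire'
    rw [((hasDerivAt_besselEntire (a + 1) x).const_mul (-1 / 4)).deriv, besselEntire_eq a x,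
      show a + 1 + 1 = a + 2 by ring]
    ring
  left_zero := besselEntire_zero a

/-- The scaling factor `c = 4N + 2a` with `N = n + 1`. -/
def scale (a : ℝ) (n : ℕ) : ℝ := 4 * (n + 1) + 2 * a

theorem scale_pos (ha : -1 < a) (n : ℕ) : 0 < scale a n := by
  unfold scale
  have : (0 : ℝ) ≤ n := n.cast_nonneg
  linarith

/-- The mean of the two rescaled Laguerre functions of degrees `n` and `n + 1`. -/
def laguerreMean (a : ℝ) (n : ℕ) (x : ℝ) : ℝ :=
  Real.exp (-(x / scale a n) / 2) * (laguerreNorm a n (x / scale a n) -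
    x / scale a n / 2 * laguerreNorm (a + 1) n (x / scale a n))

/-- The difference of the two rescaled Laguerre functions of degrees `n` and `n + 1`, divided by
`4x / c`. -/
def laguerreDiff (a : ℝ) (n : ℕ) (x : ℝ) : ℝ :=
  -1 / 4 * (Real.exp (-(x / scale a n) / 2) * laguerreNorm (a + 1) n (x / scale a n))

theorem isSystemSolution_laguerre (ha : -1 < a) (n : ℕ) :
    IsSystemSolution a (1 / scale a n ^ 2) (laguerreMean a n) (laguerreDiff a n) := by
  set c := scale a n with hc
  have hc0 : c ≠ 0 := (scale_pos ha n).ne'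
  have hz : ∀ x : ℝ, HasDerivAt (fun x => x / c) (1 / c) x := fun x => (hasDerivAt_id x).div_const c
  have hE : ∀ x : ℝ, HasDerivAt (fun x => Real.exp (-(x / c) / 2))
      (Real.exp (-(x / c) / 2) * (-(1 / c) / 2)) x := fun x => ((hz x).neg.div_const 2).exp
  have hL : ∀ (b x : ℝ), HasDerivAt (fun x => laguerreNorm b n (x / c))
      (deriv (laguerreNorm b n) (x / c) * (1 / c)) x := fun b x =>
    HasDerivAt.comp (h₂ := laguerreNorm b n) x (differentiable_laguerreNorm b n (x / c)).hasDerivAt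
      (hz x)
  have hR : ∀ x, HasDerivAt (laguerreDiff a n) (-1 / 4 *
      (Real.exp (-(x / c) / 2) * (-(1 / c) / 2) * laguerreNorm (a + 1) n (x / c) +
        Real.exp (-(x / c) / 2) * (deriv (laguerreNorm (a + 1) n) (x / c) * (1 / c)))) x := fun x =>
    ((hE x).mul (hL (a + 1) x)).const_mul _
  refine ⟨fun x => ?_, fun x => (hR x).differentiableAt, fun x => ?_, ?_⟩
  · have h := (hE x).mul ((hL a x).sub (((hz x).div_const 2).mul (hL (a + 1) x)))
    have h1 := deriv_laguerreNorm a n (x / c)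
    have h2 := mul_deriv_laguerreNorm a n (x / c)
    have hca : (n + 1 + a : ℝ) = c / 4 + a / 2 := by rw [hc, scale]; ring
    refine (h.congr_deriv ?_ : HasDerivAt (laguerreMean a n) _ x)
    unfold laguerreDiff
    rw [h1, hca, ← hc]
    have h3 : x / c * deriv (laguerreNorm (a + 1) n) (x / c) =
        laguerreNorm a n (x / c) - (a + 1) * laguerreNorm (a + 1) n (x / c) := by linarith
    have h4 : (1 - 1 / c ^ 2 * x) = (1 / c) * (c - x / c) := by field_simp
    rw [h4]
    simp only [Pi.mul_apply, Pi.sub_apply]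
    linear_combination (-(1 / 2) * (1 / c) * Real.exp (-(x / c) / 2)) * h3
  · rw [(hR x).deriv]
    have h2 := mul_deriv_laguerreNorm a n (x / c)
    have h5 : x * (1 / c) = x / c := by ring
    unfold laguerreDiff laguerreMean
    rw [← hc]
    linear_combination (-1 / 4 * Real.exp (-(x / c) / 2)) * h2
  · unfold laguerreMean
    simp [laguerreNorm_zero_right]

/-! ### Kernels as radial averages -/

/-- The operator inverse to `x ∂_x + y ∂_y + a + 1`. -/
def radialAvg (a : ℝ) (g : ℝ → ℝ → ℝ) (x y : ℝ) : ℝ :=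
  ∫ t in (0 : ℝ)..1, t ^ a * g (t * x) (t * y)

theorem integral_rpow_mul_eq (ha : -1 < a) {h h' g : ℝ → ℝ} (hd : ∀ t, HasDerivAt h (h' t) t)
    (hg : Continuous g) (heq : ∀ t, t * h' t + (a + 1) * h t = g t) :
    ∫ t in (0 : ℝ)..1, t ^ a * g t = h 1 := by
  have hc : Continuous h := continuous_iff_continuousAt.2 fun x => (hd x).continuousAt
  have h1 : ContinuousOn (fun t : ℝ => t ^ (a + 1) * h t) (Set.Icc 0 1) :=
    ((Real.continuous_rpow_const (by linarith)).mul hc).continuousOn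
  have h2 : ∀ t ∈ Set.Ioo (0 : ℝ) 1, HasDerivAt (fun t : ℝ => t ^ (a + 1) * h t) (t ^ a * g t) t := by
    intro t ht
    have h3 := (Real.hasDerivAt_rpow_const (p := a + 1) (Or.inl ht.1.ne')).mul (hd t)
    refine h3.congr_deriv ?_
    rw [← heq t, add_sub_cancel_right, Real.rpow_add_one ht.1.ne']; ring
  have h4 : IntervalIntegrable (fun t : ℝ => t ^ a * g t) volume 0 1 :=
    (intervalIntegral.intervalIntegrable_rpow' ha).mul_continuousOn hg.continuousOn
  rw [intervalIntegral.integral_eq_sub_of_hasDerivAt_of_le zero_le_one h1 h2 h4,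
    Real.zero_rpow (by linarith)]
  simp

theorem IsSystemSolution.hasDerivAt_left_mul {ε : ℝ} {U w : ℝ → ℝ} (h : IsSystemSolution a ε U w)
    (x t : ℝ) : HasDerivAt (fun t => U (t * x)) ((1 - ε * (t * x)) * w (t * x) * x) t := by
  have := (h.hasDerivAt_left (t * x)).comp t ((hasDerivAt_id t).mul_const x)
  simpa [Function.comp_def] using this

theorem IsSystemSolution.hasDerivAt_right_mul {ε : ℝ} {U w : ℝ → ℝ} (h : IsSystemSolution a ε U w)
    (x t : ℝ) : HasDerivAt (fun t => w (t * x)) (deriv w (t * x) * x) t := by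
  have := (h.differentiable_right (t * x)).hasDerivAt.comp t ((hasDerivAt_id t).mul_const x)
  simpa [Function.comp_def] using this

/-- `(x ∂_x + y ∂_y + a + 1)` applied to the factor of the Bessel kernel. -/
def genInf (a x y : ℝ) : ℝ := 4 ^ (-a) / 4 * (besselEntire a x * besselEntire a y)

theorem continuous_genInf_radial (x y : ℝ) :
    Continuous fun t : ℝ => genInf a (t * x) (t * y) := by
  have := continuous_besselEntire a
  unfold genInf
  fun_prop

theorem two_rpow_mul_two_rpow (a : ℝ) : (2 : ℝ) ^ (-a) * 2 ^ (-a) = 4 ^ (-a) := by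
  rw [← Real.mul_rpow (by norm_num) (by norm_num)]; norm_num

theorem kernelInf_eq (ha : -1 < a) {x y : ℝ} (hx : 0 < x) (hy : 0 < y) :
    kernelInf a x y = x ^ (a / 2) * radialAvg a (genInf a) x y * y ^ (a / 2) := by
  have hs := isSystemSolution_bessel a
  have h4 := two_rpow_mul_two_rpow a
  set j := besselEntire a with hj
  set w := besselEntire' a with hw
  have hode : ∀ z, z * deriv w z = -j z / 4 - (a + 1) * w z := fun z => by
    linarith [hs.mul_deriv_right z]
  have hdj : ∀ z t, HasDerivAt (fun t => j (t * z)) (w (t * z) * z) t := fun z t => by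
    simpa using hs.hasDerivAt_left_mul z t
  have hdw := hs.hasDerivAt_right_mul
  by_cases hxy : x = y
  · subst hxy
    have hint : radialAvg a (genInf a) x x =
        4 ^ (-a) / 4 * (j x ^ 2 + 4 * a * (j x * w x) + 4 * (x * (w x) ^ 2)) := by
      have := integral_rpow_mul_eq ha (h := fun t => 4 ^ (-a) / 4 * (j (t * x) ^ 2 +
        4 * a * (j (t * x) * w (t * x)) + 4 * (t * x * w (t * x) ^ 2)))
        (fun t => (((hdj x t).pow 2).add (((hdj x t).mul (hdw x t)).const_mul (4 * a)) |>.add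
          ((((hasDerivAt_id t).mul_const x).mul ((hdw x t).pow 2)).const_mul 4)).const_mul
            (4 ^ (-a) / 4)) (continuous_genInf_radial x x) (fun t => by
          simp only [genInf, id, Pi.pow_apply, Nat.cast_ofNat, Nat.add_one_sub_one, pow_one, one_mul]
          have h := hode (t * x)
          linear_combination (4 ^ (-a) / 4) * (4 * a * j (t * x) + 8 * (t * x) * w (t * x)) * h)
      unfold radialAvg
      rw [this]
      simp only [one_mul]
    rw [hint, kernelInf, if_pos rfl, besselJ_sqrt a hx, besselJ_sqrt (a + 1) hx,
      besselJ_sqrt (a - 1) hx, besselEntire_eq (a - 1) x, show a - 1 + 1 = a by ring,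
      show a - 1 + 2 = a + 1 by ring, ← hj]
    have e1 : besselEntire (a + 1) x = -4 * w x := by rw [hw, besselEntire']; ring
    have e2 : (2 : ℝ) ^ (-(a + 1)) * 2 ^ (-(a - 1)) = 4 ^ (-a) := by
      rw [← h4, ← Real.rpow_add (by norm_num), ← Real.rpow_add (by norm_num)]; congr 1; ring
    have e3 : x ^ ((a + 1) / 2) * x ^ ((a - 1) / 2) = x ^ (a / 2) * x ^ (a / 2) := by
      rw [← Real.rpow_add hx, ← Real.rpow_add hx]; congr 1; ring
    rw [e1]
    have e4 : (2 : ℝ) ^ (-(a + 1)) * x ^ ((a + 1) / 2) * (-4 * w x) *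
        (2 ^ (-(a - 1)) * x ^ ((a - 1) / 2) * (a * j x - x / 4 * (-4 * w x))) =
        4 ^ (-a) * (x ^ (a / 2) * x ^ (a / 2)) * (-4 * w x) * (a * j x - x / 4 * (-4 * w x)) := by
      rw [← e2, ← e3]; ring
    rw [e4]
    linear_combination (1 / 4 * (x ^ (a / 2)) ^ 2 * j x ^ 2) * h4
  · have hne : x - y ≠ 0 := sub_ne_zero.2 hxy
    have hint : radialAvg a (genInf a) x y =
        4 ^ (-a) * (j x * (y * w y) - x * w x * j y) / (x - y) := by
      have := integral_rpow_mul_eq ha (h := fun t => 4 ^ (-a) / (x - y) *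
        (j (t * x) * (y * w (t * y)) - x * w (t * x) * j (t * y)))
        (fun t => (((hdj x t).mul ((hdw y t).const_mul y)).sub
          (((hdw x t).const_mul x).mul (hdj y t))).const_mul (4 ^ (-a) / (x - y)))
        (continuous_genInf_radial x y) (fun t => by
          simp only [genInf]
          have h1 := hode (t * x)
          have h2 := hode (t * y)
          field_simp
          linear_combination (4 * y * j (t * x)) * h2 - (4 * x * j (t * y)) * h1)
      unfold radialAvg
      rw [this]
      simp only [one_mul]
      ring
    have ex := sqrt_mul_besselJ'_sqrt a hx
    have ey := sqrt_mul_besselJ'_sqrt a hy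
    rw [hint, kernelInf, if_neg hxy, mul_right_comm, ex, ey, besselJ_sqrt a hx, besselJ_sqrt a hy,
      ← h4]
    change (2 ^ (-a) * y ^ (a / 2) * (a * j y + 2 * (y * w y)) * _ -
      2 ^ (-a) * x ^ (a / 2) * (a * j x + 2 * (x * w x)) * _) / _ = _
    rw [← hj]
    field_simp
    ring

/-- The first order coefficient in `ε` of the solution of the system. -/
def corrLeft (a x : ℝ) : ℝ := -(1 / 3) * (x * (a + 2) / 2 * besselEntire a x +
  (2 * (a + 1) * (a + 2) + x) * (x * besselEntire' a x))

/-- The first order coefficient in `ε` of the second component of the solution. -/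
def corrRight (a x : ℝ) : ℝ := -(1 / 3) * ((-(a * (a + 2)) / 2 - x / 4) * besselEntire a x +
  (-(x * (a + 2)) / 2 - 2 * a * (a + 1) * (a + 2)) * besselEntire' a x)

theorem continuous_besselEntire' (a : ℝ) : Continuous (besselEntire' a) :=
  (isSystemSolution_bessel a).continuous_right

theorem continuous_corrLeft (a : ℝ) : Continuous (corrLeft a) := by
  have h1 := continuous_besselEntire a
  have h2 := continuous_besselEntire' a
  unfold corrLeft
  fun_prop

theorem continuous_corrRight (a : ℝ) : Continuous (corrRight a) := by
  have h1 := continuous_besselEntire a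
  have h2 := continuous_besselEntire' a
  unfold corrRight
  fun_prop

/-- `(x ∂_x + y ∂_y + a + 1)` applied to the factor of the correction kernel. -/
def genL2 (a x y : ℝ) : ℝ := 4 ^ (-a) / 64 *
  (-(2 / 3 * a * (a + 1) * (a + 2)) * (besselEntire a x * besselEntire a y) +
    (corrLeft a x * besselEntire a y + besselEntire a x * corrLeft a y) -
    4 * (x * besselEntire' a x * (y * besselEntire' a y)))

theorem continuous_genL2_radial (x y : ℝ) :
    Continuous fun t : ℝ => genL2 a (t * x) (t * y) := by
  have h1 := continuous_besselEntire a
  have h2 := continuous_besselEntire' a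
  have h3 := continuous_corrLeft a
  unfold genL2
  fun_prop

theorem kernelL2_eq (ha : -1 < a) {x y : ℝ} (hx : 0 < x) (hy : 0 < y) :
    kernelL2 a x y = x ^ (a / 2) * radialAvg a (genL2 a) x y * y ^ (a / 2) := by
  have hs := isSystemSolution_bessel a
  have h4 := two_rpow_mul_two_rpow a
  set j := besselEntire a with hj
  set w := besselEntire' a with hw
  have hode : ∀ z, z * deriv w z = -j z / 4 - (a + 1) * w z := fun z => by
    linarith [hs.mul_deriv_right z]
  have hdj : ∀ z t, HasDerivAt (fun t => j (t * z)) (w (t * z) * z) t := fun z t => by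
    simpa using hs.hasDerivAt_left_mul z t
  have hdw := hs.hasDerivAt_right_mul
  have hdl : ∀ z t : ℝ, HasDerivAt (fun t => t * z) z t := fun z t => by
    simpa using (hasDerivAt_id t).mul_const z
  have hint : radialAvg a (genL2 a) x y = -(4 ^ (-a) / 192) *
      ((2 * a ^ 2 + 4 * a + (x + y)) * (j x * j y) +
        (2 * a + 4) * (j x * (y * w y) + x * w x * j y) + 4 * (x * w x * (y * w y))) := by
    have := integral_rpow_mul_eq ha (h := fun t => -(4 ^ (-a) / 192) *
      ((2 * a ^ 2 + 4 * a + (t * x + t * y)) * (j (t * x) * j (t * y)) +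
        (2 * a + 4) * (j (t * x) * (t * y * w (t * y)) + t * x * w (t * x) * j (t * y)) +
        4 * (t * x * w (t * x) * (t * y * w (t * y)))))
      (fun t => ((((((hdl x t).add (hdl y t)).const_add (2 * a ^ 2 + 4 * a)).mul
        ((hdj x t).mul (hdj y t))).add
        ((((hdj x t).mul ((hdl y t).mul (hdw y t))).add
          (((hdl x t).mul (hdw x t)).mul (hdj y t))).const_mul (2 * a + 4))).add
        ((((hdl x t).mul (hdw x t)).mul ((hdl y t).mul (hdw y t))).const_mul 4)).const_mul
          (-(4 ^ (-a) / 192)))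
      (continuous_genL2_radial x y) (fun t => by
        simp only [genL2, corrLeft, Pi.mul_apply, Pi.add_apply]
        have h1 := hode (t * x)
        have h2 := hode (t * y)
        linear_combination (-(4 ^ (-a) / 192) *
          ((2 * a + 4) * j (t * x) * (t * y) + 4 * (t * x) * w (t * x) * (t * y))) * h2 +
          (-(4 ^ (-a) / 192) *
          ((2 * a + 4) * j (t * y) * (t * x) + 4 * (t * y) * w (t * y) * (t * x))) * h1)
    unfold radialAvg
    rw [this]
    simp only [one_mul]
  have ex := sqrt_mul_besselJ'_sqrt a hx
  have ey := sqrt_mul_besselJ'_sqrt a hy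
  have e0 : kernelL2 a x y = -(1 / 192) *
      ((a ^ 2 + x + y) * besselJ a (√x) * besselJ a (√y)
      + (√x * besselJ' a (√x)) * (√y * besselJ' a (√y))
      + 2 * besselJ a (√x) * (√y * besselJ' a (√y))
      + 2 * (√x * besselJ' a (√x)) * besselJ a (√y)) := by
    rw [kernelL2, Real.sqrt_mul hx.le]; ring
  rw [hint, e0, ex, ey, besselJ_sqrt a hx, besselJ_sqrt a hy, ← h4]
  change -(1 / 192) * (_ + 2 ^ (-a) * x ^ (a / 2) * (a * j x + 2 * (x * w x)) *
    (2 ^ (-a) * y ^ (a / 2) * (a * j y + 2 * (y * w y))) +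
      2 * _ * (2 ^ (-a) * y ^ (a / 2) * (a * j y + 2 * (y * w y))) +
      2 * (2 ^ (-a) * x ^ (a / 2) * (a * j x + 2 * (x * w x))) * _) = _
  rw [← hj]
  ring

end System

section LaguerreKernel

variable {a : ℝ}

/-- The operator `x ∂_x - x/2 + (a+1)/2` maps a Laguerre polynomial to its two neighbours. -/
theorem laguerreNorm_ladder (a : ℝ) (m : ℕ) (x : ℝ) :
    x * deriv (laguerreNorm a m) x - x / 2 * laguerreNorm a m x +
      (a + 1) / 2 * laguerreNorm a m x =
    1 / 2 * ((m + a + 1) * laguerreNorm a (m + 1) x - m * laguerreNorm a (m - 1) x) := by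
  have h1 := deriv_laguerreNorm a m x
  have h2 := laguerreNorm_succ a m x
  have h3 : x * deriv (laguerreNorm a m) x =
      m * (laguerreNorm a m x - laguerreNorm a (m - 1) x) := by
    rcases m with - | m
    · rw [(hasDerivAt_laguerreNorm_sum a 0 x).deriv]; simp
    · rw [deriv_laguerreNorm_succ, Nat.add_sub_cancel, laguerreNorm_succ a m x]
      push_cast; ring
  linear_combination 1 / 2 * h3 + x / 2 * h1 - (m + a + 1) / 2 * h2

/-- The summand of the Laguerre kernel, without the weights. -/
def laguerreTerm (a : ℝ) (m : ℕ) (x y : ℝ) : ℝ :=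
  Real.Gamma (a + m + 1) / m.factorial * (laguerreNorm a m x * laguerreNorm a m y)

theorem kernelN_eq_sum (ha : -1 < a) (N : ℕ) {x y : ℝ} (hx : 0 < x) (hy : 0 < y) :
    kernelN a N x y = x ^ (a / 2) * y ^ (a / 2) * Real.exp (-(x + y) / 2) *
      ∑ m ∈ Finset.range N, laguerreTerm a m x y := by
  unfold kernelN
  have hw : √(weight a x * weight a y) =
      x ^ (a / 2) * y ^ (a / 2) * Real.exp (-(x + y) / 2) := by
    rw [weight, weight, if_pos hx, if_pos hy]
    have h1 : x ^ a * Real.exp (-x) * (y ^ a * Real.exp (-y)) =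
        (x ^ (a / 2) * y ^ (a / 2) * Real.exp (-(x + y) / 2)) ^ 2 := by
      have e1 : ∀ z : ℝ, 0 < z → z ^ a = z ^ (a / 2) * z ^ (a / 2) := fun z hz => by
        rw [← Real.rpow_add hz, add_halves]
      have e2 : Real.exp (-(x + y) / 2) * Real.exp (-(x + y) / 2) =
          Real.exp (-x) * Real.exp (-y) := by
        rw [← Real.exp_add, ← Real.exp_add]; congr 1; ring
      rw [e1 x hx, e1 y hy]
      linear_combination (-(x ^ (a / 2) * x ^ (a / 2) * (y ^ (a / 2) * y ^ (a / 2)))) * e2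
    rw [h1, Real.sqrt_sq (by positivity)]
  rw [hw]
  congr 1
  refine Finset.sum_congr rfl fun m _ => ?_
  have hG : Real.Gamma (a + m + 1) ≠ 0 := by
    have : (0 : ℝ) ≤ m := m.cast_nonneg
    exact (Real.Gamma_pos_of_pos (by linarith)).ne'
  have hf : (m.factorial : ℝ) ≠ 0 := by exact_mod_cast m.factorial_ne_zero
  rw [laguerreL_eq, laguerreL_eq, laguerreTerm]
  field_simp

/-- Summing the ladder relation: along rays the Laguerre kernel satisfies a first order equation
with an inhomogeneity of rank two. -/
theorem sum_laguerreTerm_ladder (ha : -1 < a) (N : ℕ) (x y : ℝ) :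
    ∑ m ∈ Finset.range N, Real.Gamma (a + m + 1) / m.factorial *
      ((x * deriv (laguerreNorm a m) x * laguerreNorm a m y +
        laguerreNorm a m x * (y * deriv (laguerreNorm a m) y)) +
        (a + 1 - (x + y) / 2) * (laguerreNorm a m x * laguerreNorm a m y)) =
    1 / 2 * (Real.Gamma (a + N + 1) * N / N.factorial) *
      (laguerreNorm a N x * laguerreNorm a (N - 1) y +
        laguerreNorm a (N - 1) x * laguerreNorm a N y) := by
  induction N with
  | zero => simp
  | succ N ih =>
    rw [Finset.sum_range_succ, ih]
    have h1 := laguerreNorm_ladder a N x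
    have h2 := laguerreNorm_ladder a N y
    have hf : (N.factorial : ℝ) ≠ 0 := by exact_mod_cast N.factorial_ne_zero
    have hN : (N + 1 : ℝ) ≠ 0 := by positivity
    have hG : Real.Gamma (a + ((N + 1 : ℕ) : ℝ) + 1) = (a + N + 1) * Real.Gamma (a + N + 1) := by
      have : (0 : ℝ) ≤ N := N.cast_nonneg
      rw [← Real.Gamma_add_one (by linarith : a + N + 1 ≠ 0)]
      congr 1; push_cast; ring
    rw [hG, Nat.factorial_succ, Nat.add_sub_cancel]
    push_cast
    field_simp
    linear_combination (2 * Real.Gamma (a + N + 1) * laguerreNorm a N y) * h1 +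
      (2 * Real.Gamma (a + N + 1) * laguerreNorm a N x) * h2

/-- The normalizing constant `Γ(N+a+1) / ((N-1)! c^{a+1})` with `N = n + 1`. -/
def kappa (a : ℝ) (n : ℕ) : ℝ :=
  Real.Gamma (n + a + 2) / (n.factorial * scale a n ^ (a + 1))

/-- `(x ∂_x + y ∂_y + a + 1)` applied to the factor of the rescaled Laguerre kernel. -/
def genN (a : ℝ) (n : ℕ) (x y : ℝ) : ℝ := kappa a n *
  (laguerreMean a n x * laguerreMean a n y -
    4 * (1 / scale a n ^ 2) * (x * laguerreDiff a n x * (y * laguerreDiff a n y)))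

theorem continuous_genN_radial (ha : -1 < a) (n : ℕ) (x y : ℝ) :
    Continuous fun t : ℝ => genN a n (t * x) (t * y) := by
  have h1 := (isSystemSolution_laguerre ha n).continuous_left
  have h2 := (isSystemSolution_laguerre ha n).continuous_right
  unfold genN
  fun_prop

theorem kernelN_eq (ha : -1 < a) (n : ℕ) {x y : ℝ} (hx : 0 < x) (hy : 0 < y) :
    (scale a n)⁻¹ * kernelN a (n + 1) (x / scale a n) (y / scale a n) =
      x ^ (a / 2) * radialAvg a (genN a n) x y * y ^ (a / 2) := by
  set c := scale a n with hc
  have hc0 : 0 < c := scale_pos ha n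
  set X := x / c with hX
  set Y := y / c with hY
  have hdl : ∀ (m : ℕ) (z t : ℝ), HasDerivAt (fun t => laguerreNorm a m (t * z))
      (deriv (laguerreNorm a m) (t * z) * z) t := fun m z t => by
    have := (differentiable_laguerreNorm a m (t * z)).hasDerivAt.comp t
      ((hasDerivAt_id t).mul_const z)
    simpa [Function.comp_def] using this
  have hE : ∀ t : ℝ, HasDerivAt (fun t => Real.exp (-(t * (X + Y)) / 2))
      (Real.exp (-(t * (X + Y)) / 2) * (-(X + Y) / 2)) t := fun t => by
    have := (((hasDerivAt_id t).mul_const (X + Y)).neg.div_const 2).exp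
    simpa using this
  have hint : radialAvg a (genN a n) x y = (c ^ (a + 1))⁻¹ *
      (Real.exp (-(X + Y) / 2) * ∑ m ∈ Finset.range (n + 1), laguerreTerm a m X Y) := by
    have := integral_rpow_mul_eq ha (h := fun t => (c ^ (a + 1))⁻¹ *
      (Real.exp (-(t * (X + Y)) / 2) * ∑ m ∈ Finset.range (n + 1),
        Real.Gamma (a + m + 1) / m.factorial *
          (laguerreNorm a m (t * X) * laguerreNorm a m (t * Y))))
      (fun t => ((hE t).mul (HasDerivAt.fun_sum fun m _ => (((hdl m X t).mul (hdl m Y t)).const_mul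
        (Real.Gamma (a + m + 1) / m.factorial)))).const_mul _)
      (continuous_genN_radial ha n x y) (fun t => by
        have h := sum_laguerreTerm_ladder ha (n + 1) (t * X) (t * Y)
        have hs : t * (∑ m ∈ Finset.range (n + 1), Real.Gamma (a + m + 1) / m.factorial *
            (deriv (laguerreNorm a m) (t * X) * X * laguerreNorm a m (t * Y) +
              laguerreNorm a m (t * X) * (deriv (laguerreNorm a m) (t * Y) * Y))) +
            (a + 1 - t * (X + Y) / 2) * ∑ m ∈ Finset.range (n + 1),
              Real.Gamma (a + m + 1) / m.factorial *
                (laguerreNorm a m (t * X) * laguerreNorm a m (t * Y)) =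
            1 / 2 * (Real.Gamma (a + (n + 1 : ℕ) + 1) * (n + 1 : ℕ) / (n + 1).factorial) *
              (laguerreNorm a (n + 1) (t * X) * laguerreNorm a n (t * Y) +
                laguerreNorm a n (t * X) * laguerreNorm a (n + 1) (t * Y)) := by
          rw [Nat.add_sub_cancel] at h
          rw [← h, Finset.mul_sum, Finset.mul_sum, ← Finset.sum_add_distrib]
          refine Finset.sum_congr rfl fun m _ => ?_
          ring
        have htx : t * x / c = t * X := by rw [hX]; ring
        have hty : t * y / c = t * Y := by rw [hY]; ring
        have hx' : t * x = c * (t * X) := by rw [hX]; field_simp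
        have hy' : t * y = c * (t * Y) := by rw [hY]; field_simp
        have hexp : Real.exp (-(t * (X + Y)) / 2) =
            Real.exp (-(t * X) / 2) * Real.exp (-(t * Y) / 2) := by
          rw [← Real.exp_add]; congr 1; ring
        have hf : (n.factorial : ℝ) ≠ 0 := by exact_mod_cast n.factorial_ne_zero
        have hn : (n + 1 : ℝ) ≠ 0 := by positivity
        have hk : (c ^ (a + 1))⁻¹ * (Real.Gamma (a + (n + 1 : ℕ) + 1) * (n + 1 : ℕ) /
            (n + 1).factorial) = kappa a n := by
          unfold kappa
          rw [← hc, show a + ((n + 1 : ℕ) : ℝ) + 1 = n + a + 2 by push_cast; ring,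
            Nat.factorial_succ]
          have : c ^ (a + 1) ≠ 0 := (Real.rpow_pos_of_pos hc0 _).ne'
          push_cast
          field_simp
        have hU : ∀ z, laguerreNorm a (n + 1) z =
            laguerreNorm a n z - z * laguerreNorm (a + 1) n z := laguerreNorm_succ a n
        rw [hU, hU] at hs
        unfold genN laguerreMean laguerreDiff
        rw [← hc, htx, hty, ← hk, hx', hy']
        simp only [Pi.mul_apply]
        have hcc : 4 * (1 / c ^ 2) * (c * (t * X) * (-1 / 4 * (Real.exp (-(t * X) / 2) *
            laguerreNorm (a + 1) n (t * X))) * (c * (t * Y) * (-1 / 4 * (Real.exp (-(t * Y) / 2) *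
            laguerreNorm (a + 1) n (t * Y))))) = 1 / 4 * ((t * X) * (Real.exp (-(t * X) / 2) *
            laguerreNorm (a + 1) n (t * X)) * ((t * Y) * (Real.exp (-(t * Y) / 2) *
            laguerreNorm (a + 1) n (t * Y)))) := by
          field_simp
        rw [hcc, hexp]
        linear_combination ((c ^ (a + 1))⁻¹ * Real.exp (-(t * X) / 2) * Real.exp (-(t * Y) / 2)) *
          hs)
    unfold radialAvg
    rw [this]
    simp only [one_mul, laguerreTerm]
  rw [hint, kernelN_eq_sum ha _ (div_pos hx hc0) (div_pos hy hc0),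
    mul_assoc (_ * _) (Real.exp _), ← hX, ← hY]
  generalize Real.exp (-(X + Y) / 2) * ∑ m ∈ Finset.range (n + 1), laguerreTerm a m X Y = E
  rw [hX, hY, Real.div_rpow hx.le hc0.le,
    Real.div_rpow hy.le hc0.le]
  have h1 : c ^ (a + 1) = c ^ (a / 2) * c ^ (a / 2) * c := by
    rw [← Real.rpow_add hc0, ← Real.rpow_add_one hc0.ne']; congr 1; ring
  rw [h1]
  have h2 : c ^ (a / 2) ≠ 0 := (Real.rpow_pos_of_pos hc0 _).ne'
  field_simp

end LaguerreKernel

/-! ### Stability of the system -/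

section Stability

variable {a : ℝ}

theorem intervalIntegrable_rpow_mul (ha : -1 < a) {g : ℝ → ℝ} (hg : Continuous g) :
    IntervalIntegrable (fun t : ℝ => t ^ a * g t) volume 0 1 :=
  (intervalIntegral.intervalIntegrable_rpow' ha).mul_continuousOn hg.continuousOn

theorem abs_integral_rpow_mul_le (ha : -1 < a) {g : ℝ → ℝ} {K : ℝ}
    (hK : ∀ t ∈ Set.Ioc (0 : ℝ) 1, |g t| ≤ K) :
    |∫ t in (0 : ℝ)..1, t ^ a * g t| ≤ K / (a + 1) := by
  have h1 : ∫ t in (0 : ℝ)..1, t ^ a * K = K / (a + 1) := by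
    rw [intervalIntegral.integral_mul_const, integral_rpow (Or.inl ha), Real.one_rpow,
      Real.zero_rpow (by linarith)]
    ring
  rw [← h1, ← Real.norm_eq_abs]
  refine intervalIntegral.norm_integral_le_of_norm_le zero_le_one ?_
    (intervalIntegrable_rpow_mul ha continuous_const)
  refine Eventually.of_forall fun t ht => ?_
  rw [norm_mul, Real.norm_of_nonneg (Real.rpow_nonneg ht.1.le _)]
  exact mul_le_mul_of_nonneg_left (hK t ht) (Real.rpow_nonneg ht.1.le _)

/-- A Gronwall estimate for the linear system, through the exponentially weighted maximum of the
first component. -/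
theorem system_stability (ha : -1 < a) {s : ℝ} (hs : 0 < s) :
    ∃ C : ℝ, 0 ≤ C ∧ ∀ (ε ρ : ℝ) (D d r : ℝ → ℝ), 0 ≤ ε → ε ≤ 1 → 0 ≤ ρ → D 0 = 0 →
      (∀ x, HasDerivAt D ((1 - ε * x) * d x + r x) x) → Differentiable ℝ d →
      (∀ x, x * deriv d x + (a + 1) * d x = -D x / 4) →
      (∀ x ∈ Set.Icc 0 s, |r x| ≤ ρ) →
      ∀ x ∈ Set.Icc 0 s, |D x| ≤ C * ρ ∧ |d x| ≤ C * ρ := by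
  have ha1 : 0 < a + 1 := by linarith
  -- this weight makes the map from the first component to itself a contraction by `1 / 2`
  set β : ℝ := (1 + s) / (2 * (a + 1)) with hβ
  have hβ0 : 0 < β := by positivity
  set C₁ : ℝ := 2 * s * Real.exp (β * s) with hC₁
  have hC₁0 : 0 ≤ C₁ := by positivity
  refine ⟨max C₁ (C₁ / 4 / (a + 1)), le_max_of_le_left hC₁0, ?_⟩
  intro ε ρ D d r hε0 hε1 hρ hD0 hD hd hode hr
  have hDc : Continuous D := continuous_iff_continuousAt.2 fun x => (hD x).continuousAt
  -- the point where `exp (-β x) |D x|` is largest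
  obtain ⟨x₀, hx₀, hmax⟩ := (isCompact_Icc (a := (0 : ℝ)) (b := s)).exists_isMaxOn
    ⟨0, by simp [hs.le]⟩ (f := fun x => Real.exp (-(β * x)) * |D x|)
    (by fun_prop)
  set P : ℝ := Real.exp (-(β * x₀)) * |D x₀| with hP
  have hP0 : 0 ≤ P := by positivity
  have hDle : ∀ x ∈ Set.Icc 0 s, |D x| ≤ P * Real.exp (β * x) := by
    intro x hx
    have h1 : Real.exp (-(β * x)) * |D x| ≤ P := hmax hx
    rw [Real.exp_neg, inv_mul_le_iff₀ (Real.exp_pos _)] at h1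
    linarith
  have hdint : ∀ x, d x = ∫ t in (0 : ℝ)..1, t ^ a * (-D (t * x) / 4) := by
    intro x
    have := integral_rpow_mul_eq ha (h := fun t => d (t * x)) (h' := fun t => deriv d (t * x) * x)
      (g := fun t => -D (t * x) / 4) (fun t => by
        have := (hd (t * x)).hasDerivAt.comp t ((hasDerivAt_id t).mul_const x)
        simpa [Function.comp_def] using this) (by fun_prop)
      (fun t => by rw [← hode (t * x)]; ring)
    rw [this, one_mul]
  have hdle : ∀ x ∈ Set.Icc 0 s, |d x| ≤ P * Real.exp (β * x) / 4 / (a + 1) := by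
    intro x hx
    rw [hdint x]
    refine abs_integral_rpow_mul_le ha fun t ht => ?_
    have h1 : t * x ≤ x := mul_le_of_le_one_left hx.1 ht.2
    rw [abs_div, abs_neg, abs_of_pos (by norm_num : (0 : ℝ) < 4)]
    refine div_le_div_of_nonneg_right ?_ (by norm_num)
    refine (hDle (t * x) ⟨mul_nonneg ht.1.le hx.1, h1.trans hx.2⟩).trans ?_
    gcongr
  have hbound : ∀ x ∈ Set.Ico 0 s, ‖(1 - ε * x) * d x + r x‖ ≤
      P / 2 * (Real.exp (β * x) * β) + ρ := by
    intro x hx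
    have hx' : x ∈ Set.Icc 0 s := ⟨hx.1, hx.2.le⟩
    have h1 : |1 - ε * x| ≤ 1 + s := by
      have h2 : ε * x ≤ s := (mul_le_of_le_one_left hx.1 hε1).trans hx.2.le
      have h3 : 0 ≤ ε * x := mul_nonneg hε0 hx.1
      rw [abs_le]; constructor <;> linarith
    refine (abs_add_le _ _).trans (add_le_add ?_ (hr x hx'))
    rw [abs_mul]
    calc |1 - ε * x| * |d x| ≤ (1 + s) * (P * Real.exp (β * x) / 4 / (a + 1)) := by
          gcongr; exact hdle x hx'
      _ = P / 2 * (Real.exp (β * x) * β) := by rw [hβ]; field_simp; ring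
  have hDbd : ∀ x ∈ Set.Icc 0 s, ‖D x‖ ≤ P / 2 * Real.exp (β * x) + ρ * x := by
    intro x hx
    refine image_norm_le_of_norm_deriv_right_le_deriv_boundary (f := D) hDc.continuousOn
      (fun x _ => (hD x).hasDerivWithinAt) (B := fun x => P / 2 * Real.exp (β * x) + ρ * x)
      (B' := fun x => P / 2 * (Real.exp (β * x) * β) + ρ) ?_ ?_ hbound hx
    · rw [hD0]; simp; positivity
    · intro x
      have e1 : HasDerivAt (fun x => β * x) β x := by simpa using (hasDerivAt_id x).const_mul β
      have e2 : HasDerivAt (fun x => ρ * x) ρ x := by simpa using (hasDerivAt_id x).const_mul ρ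
      exact (e1.exp.const_mul (P / 2)).add e2
  have hPle : P ≤ 2 * (ρ * s) := by
    have h1 := hDbd x₀ hx₀
    have h2 : P ≤ Real.exp (-(β * x₀)) * (P / 2 * Real.exp (β * x₀) + ρ * x₀) :=
      mul_le_mul_of_nonneg_left h1 (Real.exp_pos _).le
    have h3 : Real.exp (-(β * x₀)) * Real.exp (β * x₀) = 1 := by rw [← Real.exp_add]; simp
    have h4 : Real.exp (-(β * x₀)) ≤ 1 :=
      Real.exp_le_one_iff.2 (neg_nonpos.2 (mul_nonneg hβ0.le hx₀.1))
    have h5 : Real.exp (-(β * x₀)) * (ρ * x₀) ≤ 1 * (ρ * s) :=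
      mul_le_mul h4 (mul_le_mul_of_nonneg_left hx₀.2 hρ) (mul_nonneg hρ hx₀.1) zero_le_one
    have h6 : Real.exp (-(β * x₀)) * (P / 2 * Real.exp (β * x₀) + ρ * x₀) =
        P / 2 * (Real.exp (-(β * x₀)) * Real.exp (β * x₀)) +
          Real.exp (-(β * x₀)) * (ρ * x₀) := by ring
    rw [h6, h3] at h2
    linarith
  intro x hx
  have hfin : P * Real.exp (β * x) ≤ C₁ * ρ := by
    have : Real.exp (β * x) ≤ Real.exp (β * s) :=
      Real.exp_le_exp.2 (mul_le_mul_of_nonneg_left hx.2 hβ0.le)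
    calc P * Real.exp (β * x) ≤ 2 * (ρ * s) * Real.exp (β * s) := by gcongr
      _ = C₁ * ρ := by rw [hC₁]; ring
  constructor
  · exact ((hDle x hx).trans hfin).trans (mul_le_mul_of_nonneg_right (le_max_left _ _) hρ)
  · refine (hdle x hx).trans (le_trans ?_ (mul_le_mul_of_nonneg_right (le_max_right _ _) hρ))
    calc P * Real.exp (β * x) / 4 / (a + 1) ≤ C₁ * ρ / 4 / (a + 1) := by gcongr
      _ = _ := by ring

theorem hasDerivAt_corrLeft (a x : ℝ) :
    HasDerivAt (corrLeft a) (corrRight a x - x * besselEntire' a x) x := by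
  have hs := isSystemSolution_bessel a
  have h1 : HasDerivAt (besselEntire a) (besselEntire' a x) x := by
    simpa using hs.hasDerivAt_left x
  have h2 := (hs.differentiable_right x).hasDerivAt
  have h3 := hs.mul_deriv_right x
  have hid := hasDerivAt_id x
  have h := ((((hid.mul_const (a + 2)).div_const 2).mul h1).add
    ((hid.const_add (2 * (a + 1) * (a + 2))).mul (hid.mul h2))).const_mul (-(1 / 3))
  refine (h.congr_deriv ?_ : HasDerivAt (corrLeft a) _ x)
  simp only [id, Pi.mul_apply, corrRight]
  linear_combination (-(1 / 3) * (2 * (a + 1) * (a + 2) + x)) * h3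

theorem differentiable_corrRight (a : ℝ) : Differentiable ℝ (corrRight a) := by
  have h1 : Differentiable ℝ (besselEntire a) := fun x =>
    (hasDerivAt_besselEntire a x).differentiableAt
  have h2 := (isSystemSolution_bessel a).differentiable_right
  unfold corrRight
  fun_prop

theorem mul_deriv_corrRight (a x : ℝ) :
    x * deriv (corrRight a) x + (a + 1) * corrRight a x = -corrLeft a x / 4 := by
  have hs := isSystemSolution_bessel a
  have h1 : HasDerivAt (besselEntire a) (besselEntire' a x) x := by
    simpa using hs.hasDerivAt_left x
  have h2 := (hs.differentiable_right x).hasDerivAt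
  have h3 := hs.mul_deriv_right x
  have hid := hasDerivAt_id x
  have h : HasDerivAt (corrRight a) _ x :=
    (((((hid.div_const 4).const_sub (-(a * (a + 2)) / 2)).mul h1).add
    ((((hid.mul_const (a + 2)).neg.div_const 2).sub_const (2 * a * (a + 1) * (a + 2))).mul
      h2)).const_mul (-(1 / 3)))
  rw [h.deriv]
  simp only [id, Pi.neg_apply, corrRight, corrLeft]
  linear_combination (-(1 / 3) * (-(x * (a + 2)) / 2 - 2 * a * (a + 1) * (a + 2))) * h3

/-- Expansion of the solutions of the system to first order in `ε`, uniformly on `[0, s]`. -/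
theorem exists_system_expansion (ha : -1 < a) {s : ℝ} (hs : 0 < s) :
    ∃ C : ℝ, ∀ (ε : ℝ) (U w : ℝ → ℝ), 0 ≤ ε → ε ≤ 1 → IsSystemSolution a ε U w →
      ∀ x ∈ Set.Icc 0 s, |U x - besselEntire a x - ε * corrLeft a x| ≤ C * ε ^ 2 ∧
        |w x - besselEntire' a x| ≤ C * ε := by
  obtain ⟨C, hC0, hC⟩ := system_stability ha hs
  obtain ⟨B, hB⟩ := (isCompact_Icc (a := (0 : ℝ)) (b := s)).exists_bound_of_continuousOn
    (continuous_corrRight a).continuousOn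
  have hB0 : 0 ≤ B := (norm_nonneg _).trans (hB 0 (by simp [hs.le]))
  refine ⟨C * (s * B) + B, fun ε U w hε0 hε1 h x hx => ?_⟩
  have hb := isSystemSolution_bessel a
  have hD : ∀ x, HasDerivAt (fun x => U x - besselEntire a x - ε * corrLeft a x)
      ((1 - ε * x) * (w x - besselEntire' a x - ε * corrRight a x) +
        (-ε ^ 2 * (x * corrRight a x))) x := by
    intro x
    refine (((h.hasDerivAt_left x).sub (hb.hasDerivAt_left x)).sub
      ((hasDerivAt_corrLeft a x).const_mul ε)).congr_deriv ?_
    ring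
  have hdd : Differentiable ℝ fun x => w x - besselEntire' a x - ε * corrRight a x := by
    have h1 := h.differentiable_right
    have h2 := hb.differentiable_right
    have h3 := differentiable_corrRight a
    fun_prop
  have hode : ∀ x, x * deriv (fun x => w x - besselEntire' a x - ε * corrRight a x) x +
      (a + 1) * (w x - besselEntire' a x - ε * corrRight a x) =
      -(U x - besselEntire a x - ε * corrLeft a x) / 4 := by
    intro x
    have hd := (((h.differentiable_right x).hasDerivAt.sub (hb.differentiable_right x).hasDerivAt).sub
      ((differentiable_corrRight a x).hasDerivAt.const_mul ε)).deriv
    have hd' : deriv (fun x => w x - besselEntire' a x - ε * corrRight a x) x = _ := hd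
    rw [hd']
    linear_combination h.mul_deriv_right x - hb.mul_deriv_right x - ε * mul_deriv_corrRight a x
  have key := hC ε (ε ^ 2 * (s * B)) _ _ _ hε0 hε1 (by positivity)
    (by simp [h.left_zero, hb.left_zero, corrLeft]) hD hdd hode (fun y hy => by
      rw [abs_mul, abs_neg, abs_of_nonneg (sq_nonneg ε), abs_mul, abs_of_nonneg hy.1]
      gcongr
      · exact hy.2
      · exact hB y hy) x hx
  have hε2 : ε ^ 2 ≤ ε := by nlinarith
  constructor
  · refine key.1.trans ?_
    nlinarith [sq_nonneg ε, mul_nonneg hB0 (sq_nonneg ε)]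
  · have h1 : |w x - besselEntire' a x| ≤
        |w x - besselEntire' a x - ε * corrRight a x| + |ε * corrRight a x| := by
      have := abs_add_le (w x - besselEntire' a x - ε * corrRight a x) (ε * corrRight a x)
      rwa [sub_add_cancel] at this
    have h2 : |ε * corrRight a x| ≤ ε * B := by
      rw [abs_mul, abs_of_nonneg hε0]
      exact mul_le_mul_of_nonneg_left (hB x hx) hε0
    have h3 : C * (ε ^ 2 * (s * B)) ≤ C * (ε * (s * B)) := by gcongr
    calc _ ≤ _ := h1
      _ ≤ C * (ε * (s * B)) + ε * B := add_le_add (key.2.trans h3) h2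
      _ = _ := by ring

end Stability

/-! ### The normalizing constant -/

section Kappa

variable {a : ℝ}

/-- The reciprocal `1 / N` with `N = n + 1`. -/
def invN (n : ℕ) : ℝ := 1 / (n + 1)

theorem invN_pos (n : ℕ) : 0 < invN n := by unfold invN; positivity

theorem invN_le_one (n : ℕ) : invN n ≤ 1 := by
  unfold invN
  rw [div_le_one (by positivity)]
  linarith [(n.cast_nonneg : (0 : ℝ) ≤ n)]

theorem tendsto_invN : Tendsto invN atTop (𝓝 0) := tendsto_one_div_add_atTop_nhds_zero_nat

theorem isBigO_invN_pow {i j : ℕ} (h : i ≤ j) :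
    (fun n => invN n ^ j) =O[atTop] fun n => invN n ^ i := by
  refine IsBigO.of_bound 1 (Eventually.of_forall fun n => ?_)
  rw [one_mul, norm_pow, norm_pow, Real.norm_of_nonneg (invN_pos n).le]
  exact pow_le_pow_of_le_one (invN_pos n).le (invN_le_one n) h

theorem invN_pow_four_le (n : ℕ) : invN n ^ 4 ≤ 2 * (invN n ^ 3 - invN (n + 1) ^ 3) := by
  unfold invN
  have h : (0 : ℝ) ≤ n := n.cast_nonneg
  push_cast
  rw [div_pow, div_pow, div_pow, div_sub_div _ _ (by positivity) (by positivity), mul_div_assoc',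
    div_le_div_iff₀ (by positivity) (by positivity), ← sub_nonneg]
  have : 2 * (1 ^ 3 * ((n : ℝ) + 1 + 1) ^ 3 - (n + 1) ^ 3 * 1 ^ 3) * (n + 1) ^ 4 -
      1 ^ 4 * ((n + 1) ^ 3 * (n + 1 + 1) ^ 3) =
      (n + 1) ^ 3 * (5 * n ^ 3 + 18 * n ^ 2 + 20 * n + 6) := by ring
  rw [this]
  positivity

/-- A convergent sequence with increments `O(N⁻⁴)` converges with rate `O(N⁻³)`. -/
theorem isBigO_sub_limit {E : ℕ → ℝ} {L : ℝ} (hE : Tendsto E atTop (𝓝 L))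
    (hinc : (fun n => E (n + 1) - E n) =O[atTop] fun n => invN n ^ 4) :
    (fun n => E n - L) =O[atTop] fun n => invN n ^ 3 := by
  obtain ⟨C, hC0, hC⟩ := hinc.exists_pos
  obtain ⟨n₀, hn₀⟩ := eventually_atTop.1 hC.bound
  have hstep : ∀ n, |E (n + n₀ + 1) - E (n + n₀)| ≤
      2 * C * (invN (n + n₀) ^ 3 - invN (n + n₀ + 1) ^ 3) := fun n => by
    have h1 := hn₀ (n + n₀) (by omega)
    rw [Real.norm_eq_abs, Real.norm_of_nonneg (pow_nonneg (invN_pos _).le 4)] at h1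
    have h2 := mul_le_mul_of_nonneg_left (invN_pow_four_le (n + n₀)) hC0.le
    linarith
  have hlim : Tendsto (fun n => 2 * C * invN (n + n₀) ^ 3) atTop (𝓝 0) := by
    have := (((tendsto_add_atTop_iff_nat n₀).2 tendsto_invN).pow 3).const_mul (2 * C)
    simpa using this
  have hE' : Tendsto (fun n => E (n + n₀)) atTop (𝓝 L) := (tendsto_add_atTop_iff_nat n₀).2 hE
  have hanti : Antitone fun n => E (n + n₀) + 2 * C * invN (n + n₀) ^ 3 := by
    refine antitone_nat_of_succ_le fun n => ?_
    have h := (abs_le.1 (hstep n)).2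
    rw [show n + 1 + n₀ = n + n₀ + 1 by ring]
    linarith
  have hmono : Monotone fun n => E (n + n₀) - 2 * C * invN (n + n₀) ^ 3 := by
    refine monotone_nat_of_le_succ fun n => ?_
    have h := (abs_le.1 (hstep n)).1
    rw [show n + 1 + n₀ = n + n₀ + 1 by ring]
    linarith
  refine IsBigO.of_bound (2 * C) (eventually_atTop.2 ⟨n₀, fun n hn => ?_⟩)
  obtain ⟨m, rfl⟩ : ∃ m, n = m + n₀ := ⟨n - n₀, by omega⟩
  have h1 := hanti.le_of_tendsto (by simpa using hE'.add hlim) m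
  have h2 := hmono.ge_of_tendsto (by simpa using hE'.sub hlim) m
  rw [Real.norm_eq_abs, Real.norm_of_nonneg (pow_nonneg (invN_pos _).le 3), abs_le]
  constructor <;> linarith

theorem isBigO_log_sub_log :
    (fun x : ℝ => Real.log (1 + x) - Real.log (1 - x) - (2 * x + 2 / 3 * x ^ 3))
      =O[𝓝 0] fun x => x ^ 4 := by
  refine IsBigO.of_bound 4 ?_
  have hnear : ∀ᶠ x : ℝ in 𝓝 0, |x| < 1 / 2 := by
    have : Metric.ball (0 : ℝ) (1 / 2) ∈ 𝓝 (0 : ℝ) := Metric.ball_mem_nhds _ (by norm_num)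
    filter_upwards [this] with x hx
    simpa using hx
  filter_upwards [hnear] with x hx
  have h1 := Real.abs_log_sub_add_sum_range_le (x := x) (by linarith) 3
  have h2 := Real.abs_log_sub_add_sum_range_le (x := -x) (by rw [abs_neg]; linarith) 3
  rw [abs_neg] at h2
  have h3 : |x| ^ (3 + 1) / (1 - |x|) ≤ 2 * |x| ^ 4 := by
    rw [div_le_iff₀ (by linarith)]
    have h4 := mul_nonneg (pow_nonneg (abs_nonneg x) 4) (sub_nonneg.2 hx.le)
    norm_num
    nlinarith
  simp only [Finset.sum_range_succ, Finset.sum_range_zero, sub_neg_eq_add] at h1 h2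
  norm_num at h1 h2
  rw [Real.norm_eq_abs, norm_pow, Real.norm_eq_abs]
  have h1' := abs_le.1 (h1.trans h3)
  have h2' := abs_le.1 (h2.trans h3)
  rw [abs_le]
  constructor <;> nlinarith [h1'.1, h1'.2, h2'.1, h2'.2]

theorem isBigO_sq_div_sub :
    (fun x : ℝ => x ^ 2 / (1 + x) ^ 2 - x ^ 2 / (1 - x) ^ 2 + 4 * x ^ 3)
      =O[𝓝 0] fun x => x ^ 4 := by
  have h1 : (fun x : ℝ => x ^ 2 / (1 + x) ^ 2 - x ^ 2 / (1 - x) ^ 2 + 4 * x ^ 3) =ᶠ[𝓝 0]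
      fun x => (4 * x * (x ^ 2 - 2) / ((1 + x) ^ 2 * (1 - x) ^ 2)) * x ^ 4 := by
    have hnear : ∀ᶠ x : ℝ in 𝓝 0, x ∈ Set.Ioo (-1 : ℝ) 1 := Ioo_mem_nhds (by norm_num) (by norm_num)
    filter_upwards [hnear] with x hx
    have e1 : 1 + x ≠ 0 := by linarith [hx.1]
    have e2 : 1 - x ≠ 0 := by linarith [hx.2]
    field_simp
    ring
  refine h1.trans_isBigO ?_
  have h2 : Tendsto (fun x : ℝ => 4 * x * (x ^ 2 - 2) / ((1 + x) ^ 2 * (1 - x) ^ 2)) (𝓝 0)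
      (𝓝 (4 * 0 * (0 ^ 2 - 2) / ((1 + 0) ^ 2 * (1 - 0) ^ 2))) := by
    refine ContinuousAt.tendsto (f := fun x : ℝ => 4 * x * (x ^ 2 - 2) /
      ((1 + x) ^ 2 * (1 - x) ^ 2)) ?_
    exact ContinuousAt.div (by fun_prop) (by fun_prop) (by norm_num)
  simpa using (h2.isBigO_one ℝ).mul (isBigO_refl (fun x : ℝ => x ^ 4) (𝓝 0))

/-- The increment of `log κ + k c⁻²`, as a function of the reciprocal of `2N + 1 + a`; the cubic
terms cancel. -/
theorem isBigO_increment (b : ℝ) :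
    (fun δ : ℝ => (Real.log (1 + b * δ) - Real.log (1 - b * δ)) -
      b * (Real.log (1 + δ) - Real.log (1 - δ)) +
      (b ^ 3 - b) / 6 * (δ ^ 2 / (1 + δ) ^ 2 - δ ^ 2 / (1 - δ) ^ 2)) =O[𝓝 0] fun δ => δ ^ 4 := by
  have h1 := isBigO_log_sub_log
  have hb : Tendsto (fun δ : ℝ => b * δ) (𝓝 0) (𝓝 0) := by
    have : Continuous fun δ : ℝ => b * δ := by fun_prop
    simpa using this.tendsto 0
  have h2 : (fun δ : ℝ => Real.log (1 + b * δ) - Real.log (1 - b * δ) -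
      (2 * (b * δ) + 2 / 3 * (b * δ) ^ 3)) =O[𝓝 0] fun δ => δ ^ 4 := by
    refine (h1.comp_tendsto hb).trans ?_
    have : ((fun x : ℝ => x ^ 4) ∘ fun δ : ℝ => b * δ) = fun δ => b ^ 4 * δ ^ 4 := by
      ext δ; simp [mul_pow]
    rw [this]
    exact (isBigO_refl _ _).const_mul_left _
  refine ((h2.sub (h1.const_mul_left b)).add
    (isBigO_sq_div_sub.const_mul_left ((b ^ 3 - b) / 6))).congr_left fun δ => ?_
  ring

theorem prod_add_eq_Gamma (ha : -1 < a) (n : ℕ) :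
    ∏ j ∈ Finset.range (n + 1), (a + 1 + j) = Real.Gamma (n + a + 2) / Real.Gamma (a + 1) := by
  induction n with
  | zero =>
    have h1 : a + 1 ≠ 0 := by linarith
    have h2 : Real.Gamma (a + 1) ≠ 0 := (Real.Gamma_pos_of_pos (by linarith)).ne'
    simp only [zero_add, Finset.range_one, Finset.prod_singleton, Nat.cast_zero, add_zero]
    rw [show a + 2 = a + 1 + 1 by ring, Real.Gamma_add_one h1]
    field_simp
  | succ n ih =>
    have h1 : (n : ℝ) + a + 2 ≠ 0 := by
      have : (0 : ℝ) ≤ n := n.cast_nonneg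
      linarith
    rw [Finset.prod_range_succ, ih, show ((n + 1 : ℕ) : ℝ) + a + 2 = n + a + 2 + 1 by push_cast; ring,
      Real.Gamma_add_one h1]
    push_cast
    ring

/-- The limit of the normalizing constant, from Euler's product for the Gamma function. -/
theorem tendsto_kappa (ha : -1 < a) : Tendsto (kappa a) atTop (𝓝 (4 ^ (-a) / 4)) := by
  have hG : 0 < Real.Gamma (a + 1) := Real.Gamma_pos_of_pos (by linarith)
  have h1 := (Real.GammaSeq_tendsto_Gamma (a + 1)).inv₀ hG.ne'
  have h2 := h1.const_mul (Real.Gamma (a + 1))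
  rw [mul_inv_cancel₀ hG.ne'] at h2
  have h3 : Tendsto (fun n : ℕ => ((n : ℝ) / scale a n) ^ (a + 1)) atTop (𝓝 ((1 / 4) ^ (a + 1))) := by
    refine Tendsto.rpow_const ?_ (Or.inl (by norm_num))
    have : Tendsto (fun n : ℕ => (4 + (4 + 2 * a) / (n : ℝ))⁻¹) atTop (𝓝 ((4 + 0)⁻¹)) := by
      refine Tendsto.inv₀ (tendsto_const_nhds.add ?_) (by norm_num)
      exact tendsto_const_nhds.div_atTop tendsto_natCast_atTop_atTop
    rw [show (1 / 4 : ℝ) = (4 + 0)⁻¹ by norm_num]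
    refine this.congr' ?_
    filter_upwards [eventually_ge_atTop 1] with n hn
    have hn0 : (n : ℝ) ≠ 0 := by positivity
    rw [scale]
    have hc := (scale_pos ha n).ne'
    rw [scale] at hc
    rw [show 4 + (4 + 2 * a) / (n : ℝ) = (4 * (n + 1) + 2 * a) / n by field_simp; ring, inv_div]
  have h4 := h2.mul h3
  have h5 : (1 : ℝ) * (1 / 4) ^ (a + 1) = 4 ^ (-a) / 4 := by
    rw [one_mul, one_div, Real.inv_rpow (by norm_num), ← Real.rpow_neg (by norm_num), neg_add,
      ← sub_eq_add_neg, Real.rpow_sub_one (by norm_num)]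
  rw [h5] at h4
  refine h4.congr' ?_
  filter_upwards [eventually_ge_atTop 1] with n hn
  have hn0 : (0 : ℝ) < n := by positivity
  have hf : (n.factorial : ℝ) ≠ 0 := by exact_mod_cast n.factorial_ne_zero
  rw [Real.GammaSeq, prod_add_eq_Gamma ha, kappa, Real.div_rpow hn0.le (scale_pos ha n).le]
  have hp : (n : ℝ) ^ (a + 1) ≠ 0 := (Real.rpow_pos_of_pos hn0 _).ne'
  have hc : scale a n ^ (a + 1) ≠ 0 := (Real.rpow_pos_of_pos (scale_pos ha n) _).ne'
  field_simp

theorem kappa_pos (ha : -1 < a) (n : ℕ) : 0 < kappa a n := by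
  have : (0 : ℝ) ≤ n := n.cast_nonneg
  have h1 := Real.Gamma_pos_of_pos (by linarith : 0 < n + a + 2)
  have h2 : 0 < scale a n ^ (a + 1) := Real.rpow_pos_of_pos (scale_pos ha n) _
  have h3 : (0 : ℝ) < n.factorial := by exact_mod_cast n.factorial_pos
  unfold kappa
  positivity

theorem one_div_scale_le (ha : -1 < a) (n : ℕ) : 1 / scale a n ≤ invN n := by
  unfold invN
  have h : (0 : ℝ) ≤ n := n.cast_nonneg
  refine one_div_le_one_div_of_le (by positivity) ?_
  unfold scale
  linarith

theorem one_div_scale_pos (ha : -1 < a) (n : ℕ) : 0 < 1 / scale a n :=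
  one_div_pos.2 (scale_pos ha n)

theorem isBigO_one_div_scale_sq (ha : -1 < a) :
    (fun n => 1 / scale a n ^ 2) =O[atTop] fun n => invN n ^ 2 := by
  refine IsBigO.of_bound 1 (Eventually.of_forall fun n => ?_)
  rw [one_mul, norm_pow, Real.norm_of_nonneg (invN_pos n).le, ← one_div_pow, norm_pow,
    Real.norm_of_nonneg (one_div_scale_pos ha n).le]
  exact pow_le_pow_left₀ (one_div_scale_pos ha n).le (one_div_scale_le ha n) 2

theorem isBigO_one_div_scale_sq_sub (ha : -1 < a) :
    (fun n => 1 / scale a n ^ 2 - 1 / 16 * invN n ^ 2) =O[atTop] fun n => invN n ^ 3 := by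
  have h1 : ∀ n, 1 / scale a n ^ 2 - 1 / 16 * invN n ^ 2 =
      (-(a + a ^ 2 / 4 * invN n)) * (1 / scale a n ^ 2) * invN n := by
    intro n
    have h2 := (scale_pos ha n).ne'
    have h3 : (n + 1 : ℝ) ≠ 0 := by positivity
    unfold invN
    field_simp
    unfold scale
    ring
  simp_rw [h1]
  have h2 : (fun n => -(a + a ^ 2 / 4 * invN n)) =O[atTop] fun _ => (1 : ℝ) := by
    have : Tendsto (fun n => -(a + a ^ 2 / 4 * invN n)) atTop (𝓝 (-(a + a ^ 2 / 4 * 0))) :=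
      ((tendsto_invN.const_mul _).const_add a).neg
    exact this.isBigO_one ℝ
  refine ((h2.mul (isBigO_one_div_scale_sq ha)).mul (isBigO_refl invN atTop)).congr_right
    fun n => ?_
  ring

/-- The expansion of the ratio of Gamma functions in the normalizing constant. -/
theorem isBigO_kappa_sub (ha : -1 < a) :
    (fun n => kappa a n - 4 ^ (-a) / 4 *
      (1 - 2 / 3 * a * (a + 1) * (a + 2) * (1 / scale a n ^ 2))) =O[atTop] fun n => invN n ^ 3 := by
  set k : ℝ := 2 / 3 * a * (a + 1) * (a + 2) with hk
  set K₀ : ℝ := 4 ^ (-a) / 4 with hK₀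
  have hK₀pos : 0 < K₀ := by positivity
  -- the expansion says that `E n - log K₀` is of third order; its increments are of fourth order
  let E : ℕ → ℝ := fun n => Real.log (kappa a n) + k * (1 / scale a n ^ 2)
  have hε0 : Tendsto (fun n => 1 / scale a n ^ 2) atTop (𝓝 0) :=
    (isBigO_one_div_scale_sq ha).trans_tendsto (by simpa using tendsto_invN.pow 2)
  have hElim : Tendsto E atTop (𝓝 (Real.log K₀)) := by
    have := ((tendsto_kappa ha).log hK₀pos.ne').add (hε0.const_mul k)
    rwa [mul_zero, add_zero] at this
  -- the reciprocal of the midpoint, in which the logarithms of the increment are odd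
  let δ : ℕ → ℝ := fun n => 1 / (2 * n + 3 + a)
  have hden : ∀ n : ℕ, 0 < 2 * (n : ℝ) + 3 + a := fun n => by
    have : (0 : ℝ) ≤ n := n.cast_nonneg
    linarith
  have hδle : ∀ n, δ n ≤ invN n := fun n => by
    have : (0 : ℝ) ≤ n := n.cast_nonneg
    exact one_div_le_one_div_of_le (by positivity) (by linarith)
  have hδ0 : ∀ n, 0 < δ n := fun n => one_div_pos.2 (hden n)
  have hδlim : Tendsto δ atTop (𝓝 0) :=
    squeeze_zero (fun n => (hδ0 n).le) hδle tendsto_invN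
  have hinc : (fun n => E (n + 1) - E n) =O[atTop] fun n => invN n ^ 4 := by
    have h1 := (isBigO_increment (a + 1)).comp_tendsto hδlim
    have h2 : ((fun x : ℝ => x ^ 4) ∘ δ) =O[atTop] fun n => invN n ^ 4 := by
      refine IsBigO.of_bound 1 (Eventually.of_forall fun n => ?_)
      rw [one_mul, Function.comp_apply, norm_pow, norm_pow, Real.norm_of_nonneg (hδ0 n).le,
        Real.norm_of_nonneg (invN_pos n).le]
      exact pow_le_pow_left₀ (hδ0 n).le (hδle n) 4
    refine (h1.trans h2).congr_left fun n => ?_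
    have hn : (0 : ℝ) ≤ n := n.cast_nonneg
    have hd := hden n
    have hδd : δ n * (2 * n + 3 + a) = 1 := one_div_mul_cancel hd.ne'
    -- the quantities attached to `n` and `n + 1` in terms of `δ n`
    have e1 : (n : ℝ) + a + 2 = (1 + (a + 1) * δ n) / (2 * δ n) := by
      rw [eq_div_iff (by have := hδ0 n; positivity)]; linear_combination hδd
    have e2 : (n : ℝ) + 1 = (1 - (a + 1) * δ n) / (2 * δ n) := by
      rw [eq_div_iff (by have := hδ0 n; positivity)]; linear_combination hδd
    have e3 : scale a n = 2 * (1 - δ n) / δ n := by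
      rw [eq_div_iff (hδ0 n).ne', scale]; linear_combination 2 * hδd
    have e4 : scale a (n + 1) = 2 * (1 + δ n) / δ n := by
      rw [eq_div_iff (hδ0 n).ne', scale]; push_cast; linear_combination 2 * hδd
    have p0 := hδ0 n
    have p1 : 0 < 1 + (a + 1) * δ n := by
      have : 0 < a + 1 := by linarith
      positivity
    have p2 : 0 < 1 - (a + 1) * δ n := by
      have h3 : (0 : ℝ) < (n : ℝ) + 1 := by positivity
      rw [e2] at h3
      exact (div_pos_iff_of_pos_right (by positivity)).1 h3
    have p3 : 0 < 1 - δ n := by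
      have h3 := scale_pos ha n
      rw [e3] at h3
      have := (div_pos_iff_of_pos_right p0).1 h3
      linarith
    have p4 : 0 < 1 + δ n := by positivity
    have hlog : ∀ m : ℕ, Real.log (kappa a m) = Real.log (Real.Gamma (m + a + 2)) -
        (Real.log m.factorial + (a + 1) * Real.log (scale a m)) := by
      intro m
      have q1 : Real.Gamma (m + a + 2) ≠ 0 := by
        have : (0 : ℝ) ≤ m := m.cast_nonneg
        exact (Real.Gamma_pos_of_pos (by linarith)).ne'
      have q2 : (m.factorial : ℝ) ≠ 0 := by exact_mod_cast m.factorial_ne_zero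
      have q3 : scale a m ^ (a + 1) ≠ 0 := (Real.rpow_pos_of_pos (scale_pos ha m) _).ne'
      rw [kappa, Real.log_div q1 (mul_ne_zero q2 q3), Real.log_mul q2 q3,
        Real.log_rpow (scale_pos ha m)]
    have hg : Real.log (Real.Gamma (((n + 1 : ℕ) : ℝ) + a + 2)) =
        Real.log (n + a + 2) + Real.log (Real.Gamma (n + a + 2)) := by
      have q0 : 0 < (n : ℝ) + a + 2 := by linarith
      rw [show ((n + 1 : ℕ) : ℝ) + a + 2 = n + a + 2 + 1 by push_cast; ring,
        Real.Gamma_add_one q0.ne', Real.log_mul q0.ne' (Real.Gamma_pos_of_pos q0).ne']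
    have hfac : Real.log ((n + 1).factorial : ℝ) =
        Real.log ((n : ℝ) + 1) + Real.log (n.factorial : ℝ) := by
      have q2 : (n.factorial : ℝ) ≠ 0 := by exact_mod_cast n.factorial_ne_zero
      rw [Nat.factorial_succ]; push_cast
      rw [Real.log_mul (by positivity) q2]
    simp only [E, Function.comp_apply]
    rw [hlog n, hlog (n + 1), hg, hfac, e1, e2, e3, e4, Real.log_div p1.ne' (by positivity),
      Real.log_div p2.ne' (by positivity), Real.log_div (by positivity) p0.ne',
      Real.log_div (by positivity) p0.ne', Real.log_mul (by norm_num) p3.ne',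
      Real.log_mul (by norm_num) p4.ne', hk]
    field_simp
    ring
  have hrate := isBigO_sub_limit hElim hinc
  -- exponentiate
  set η : ℕ → ℝ := fun n => (E n - Real.log K₀) - k * (1 / scale a n ^ 2) with hη
  have hηO : η =O[atTop] fun n => invN n ^ 2 :=
    (hrate.trans (isBigO_invN_pow (by norm_num))).sub
      ((isBigO_one_div_scale_sq ha).const_mul_left k)
  have hη0 : Tendsto η atTop (𝓝 0) := hηO.trans_tendsto (by simpa using tendsto_invN.pow 2)
  have hexp : (fun n => Real.exp (η n) - 1 - η n) =O[atTop] fun n => invN n ^ 3 := by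
    have h1 : (fun n => Real.exp (η n) - 1 - η n) =O[atTop] fun n => η n ^ 2 := by
      refine IsBigO.of_bound 1 ?_
      have hnear : ∀ᶠ n in atTop, |η n| ≤ 1 := by
        have h2 := hη0.abs
        rw [abs_zero] at h2
        exact (h2.eventually (gt_mem_nhds zero_lt_one)).mono fun n h => h.le
      filter_upwards [hnear] with n hn
      rw [one_mul, Real.norm_eq_abs, Real.norm_of_nonneg (sq_nonneg _)]
      exact Real.abs_exp_sub_one_sub_id_le hn
    refine (h1.trans (hηO.pow 2)).trans ?_
    simp_rw [← pow_mul]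
    exact isBigO_invN_pow (by norm_num)
  refine ((hexp.add hrate).const_mul_left K₀).congr_left fun n => ?_
  have hkap : kappa a n = K₀ * Real.exp (η n) := by
    have h1 : η n = Real.log (kappa a n) - Real.log K₀ := by
      simp only [hη, E]; ring
    rw [h1, Real.exp_sub, Real.exp_log (kappa_pos ha n), Real.exp_log hK₀pos]
    field_simp
  rw [hkap]
  simp only [hη]
  ring

end Kappa

/-! ### Expansion of the rescaled kernel -/

section KernelExpansion

variable {a s : ℝ}

/-- Expansion of the inhomogeneity, uniformly on `[0, s]²`. -/
theorem isBigO_genN_sub (ha : -1 < a) (hs : 0 < s) :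
    (fun p : ℕ × ℝ × ℝ => genN a p.1 p.2.1 p.2.2 - genInf a p.2.1 p.2.2 -
      invN p.1 ^ 2 * genL2 a p.2.1 p.2.2) =O[atTop ×ˢ 𝓟 (Set.Icc 0 s ×ˢ Set.Icc 0 s)]
      fun p => invN p.1 ^ 3 := by
  set l : Filter (ℕ × ℝ × ℝ) := atTop ×ˢ 𝓟 (Set.Icc 0 s ×ˢ Set.Icc 0 s) with hl
  have hfst : Tendsto (fun p : ℕ × ℝ × ℝ => p.1) l atTop := tendsto_fst
  have hmem : ∀ᶠ p : ℕ × ℝ × ℝ in l, p.2.1 ∈ Set.Icc 0 s ∧ p.2.2 ∈ Set.Icc 0 s := by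
    rw [hl, eventually_prod_principal_iff]
    exact Eventually.of_forall fun n xy hxy => hxy
  let e : ℕ × ℝ × ℝ → ℝ := fun p => invN p.1
  let ε : ℕ × ℝ × ℝ → ℝ := fun p => 1 / scale a p.1 ^ 2
  obtain ⟨C, hC⟩ := exists_system_expansion ha hs
  have hpow : ∀ {i j : ℕ}, i ≤ j → (fun p => e p ^ j) =O[l] fun p => e p ^ i := fun h =>
    (isBigO_invN_pow h).comp_tendsto hfst
  have hεO : ε =O[l] fun p => e p ^ 2 := (isBigO_one_div_scale_sq ha).comp_tendsto hfst
  have hε0 : ∀ p, 0 ≤ ε p := fun p => by positivity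
  have hε1 : ∀ p, ε p ≤ 1 := fun p => by
    have h1 := one_div_scale_le ha p.1
    have h2 := (one_div_scale_pos ha p.1).le
    have h3 := invN_le_one p.1
    have : ε p = (1 / scale a p.1) ^ 2 := by simp only [ε]; rw [one_div_pow]
    rw [this]
    exact pow_le_one₀ h2 (h1.trans h3)
  -- bounded factors
  have hbd : ∀ {f : ℝ → ℝ}, Continuous f →
      (fun p : ℕ × ℝ × ℝ => f p.2.1) =O[l] (fun _ => (1 : ℝ)) ∧
      (fun p : ℕ × ℝ × ℝ => f p.2.2) =O[l] (fun _ => (1 : ℝ)) := by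
    intro f hf
    obtain ⟨B, hB⟩ := (isCompact_Icc (a := (0 : ℝ)) (b := s)).exists_bound_of_continuousOn
      hf.continuousOn
    constructor
    · refine IsBigO.of_bound B ?_
      filter_upwards [hmem] with p hp
      simpa using hB _ hp.1
    · refine IsBigO.of_bound B ?_
      filter_upwards [hmem] with p hp
      simpa using hB _ hp.2
  obtain ⟨hj1, hj2⟩ := hbd (continuous_besselEntire a)
  obtain ⟨hu1, hu2⟩ := hbd (continuous_corrLeft a)
  have hWc : Continuous fun x => x * besselEntire' a x :=
    continuous_id.mul (continuous_besselEntire' a)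
  obtain ⟨hw1, hw2⟩ := hbd hWc
  obtain ⟨hx1, hx2⟩ := hbd continuous_id
  -- remainders of the two components
  have hR : (fun p : ℕ × ℝ × ℝ => laguerreMean a p.1 p.2.1 - besselEntire a p.2.1 -
        ε p * corrLeft a p.2.1) =O[l] (fun p => e p ^ 3) ∧
      (fun p : ℕ × ℝ × ℝ => laguerreMean a p.1 p.2.2 - besselEntire a p.2.2 -
        ε p * corrLeft a p.2.2) =O[l] (fun p => e p ^ 3) ∧
      (fun p : ℕ × ℝ × ℝ => laguerreDiff a p.1 p.2.1 - besselEntire' a p.2.1)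
        =O[l] (fun p => e p ^ 1) ∧
      (fun p : ℕ × ℝ × ℝ => laguerreDiff a p.1 p.2.2 - besselEntire' a p.2.2)
        =O[l] (fun p => e p ^ 1) := by
    have hεsq : (fun p => ε p ^ 2) =O[l] fun p => e p ^ 3 := by
      refine (hεO.pow 2).trans ?_
      simp_rw [← pow_mul]
      exact hpow (by norm_num)
    have hε1' : ε =O[l] fun p => e p ^ 1 := hεO.trans (hpow (by norm_num))
    have hb := fun p : ℕ × ℝ × ℝ => hC (ε p) _ _ (hε0 p) (hε1 p)
      (isSystemSolution_laguerre ha p.1)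
    refine ⟨IsBigO.trans ?_ hεsq, IsBigO.trans ?_ hεsq, IsBigO.trans ?_ hε1',
      IsBigO.trans ?_ hε1'⟩ <;> refine IsBigO.of_bound C ?_ <;> filter_upwards [hmem] with p hp
    · rw [Real.norm_of_nonneg (sq_nonneg _)]; exact (hb p _ hp.1).1
    · rw [Real.norm_of_nonneg (sq_nonneg _)]; exact (hb p _ hp.2).1
    · rw [Real.norm_of_nonneg (hε0 p)]; exact (hb p _ hp.1).2
    · rw [Real.norm_of_nonneg (hε0 p)]; exact (hb p _ hp.2).2
  obtain ⟨hR1, hR2, hV1, hV2⟩ := hR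
  set K₀ : ℝ := 4 ^ (-a) / 4 with hK₀
  set k : ℝ := 2 / 3 * a * (a + 1) * (a + 2) with hk
  have hkap : (fun p : ℕ × ℝ × ℝ => kappa a p.1 - K₀ * (1 - k * ε p)) =O[l] fun p => e p ^ 3 :=
    (isBigO_kappa_sub ha).comp_tendsto hfst
  have hεe : (fun p => ε p - 1 / 16 * e p ^ 2) =O[l] fun p => e p ^ 3 :=
    (isBigO_one_div_scale_sq_sub ha).comp_tendsto hfst
  have hone : ∀ {i : ℕ}, (fun p => e p ^ i) =O[l] fun _ => (1 : ℝ) := fun {i} => by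
    simpa using hpow (Nat.zero_le i)
  have hkap1 : (fun p : ℕ × ℝ × ℝ => kappa a p.1) =O[l] fun _ => (1 : ℝ) :=
    ((tendsto_kappa ha).isBigO_one ℝ).comp_tendsto hfst
  have hε2 : ε =O[l] fun _ => (1 : ℝ) := hεO.trans hone
  have hS1 : (fun p : ℕ × ℝ × ℝ => besselEntire a p.2.1 + ε p * corrLeft a p.2.1)
      =O[l] fun _ => (1 : ℝ) :=
    hj1.add ((hε2.mul hu1).congr_right fun _ => one_mul 1)
  have hS2 : (fun p : ℕ × ℝ × ℝ => besselEntire a p.2.2 + ε p * corrLeft a p.2.2)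
      =O[l] fun _ => (1 : ℝ) :=
    hj2.add ((hε2.mul hu2).congr_right fun _ => one_mul 1)
  have hU2 : (fun p : ℕ × ℝ × ℝ => laguerreMean a p.1 p.2.2) =O[l] fun _ => (1 : ℝ) :=
    ((hR2.trans hone).add hS2).congr_left fun p => by ring
  have hW2 : (fun p : ℕ × ℝ × ℝ => p.2.2 * laguerreDiff a p.1 p.2.2) =O[l] fun _ => (1 : ℝ) := by
    refine (((hx2.mul (hV2.trans hone)).congr_right fun p => by ring).add hw2).congr_left
      fun p => ?_
    simp only [id]; ring
  have hW1 : (fun p : ℕ × ℝ × ℝ => p.2.1 * laguerreDiff a p.1 p.2.1) =O[l] fun _ => (1 : ℝ) := by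
    refine (((hx1.mul (hV1.trans hone)).congr_right fun p => by ring).add hw1).congr_left
      fun p => ?_
    simp only [id]; ring
  have hkap0 : (fun p : ℕ × ℝ × ℝ => kappa a p.1 - K₀) =O[l] fun p => e p ^ 1 := by
    refine ((hkap.trans (hpow (by norm_num))).sub
      ((hεO.trans (hpow (by norm_num))).const_mul_left (K₀ * k))).congr_left fun p => ?_
    ring
  -- the individual contributions to the remainder
  have t1 := (hkap1.mul hR1).mul hU2
  have t2 := (hkap1.mul hS1).mul hR2
  have t3 := (hkap.mul hS1).mul hS2
  have t4 := (hεO.pow 2).mul ((((hu1.mul hu2).const_mul_left K₀).sub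
    (((hj1.mul hu2).add (hu1.mul hj2)).const_mul_left (K₀ * k))).sub
    ((hε2.mul (hu1.mul hu2)).const_mul_left (K₀ * k) |>.congr_right fun p => by ring))
  have t5 := (hεO.mul (hkap0.mul (hW1.mul hW2))).const_mul_left (-4)
  have t6 := (hεO.mul ((hx1.mul hV1).mul hW2)).const_mul_left (-4 * K₀)
  have t7 := (hεO.mul (hw1.mul (hx2.mul hV2))).const_mul_left (-4 * K₀)
  have t8 := hεe.mul ((((hj1.mul hj2).const_mul_left (-k)).add
    ((hu1.mul hj2).add (hj1.mul hu2))).sub ((hw1.mul hw2).const_mul_left 4))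
  have t4' : _ =O[l] fun p => e p ^ 3 := t4.trans ((hpow (show 3 ≤ 4 by norm_num)).congr_left
    fun p => by ring)
  have c3 : ∀ {f g : ℕ × ℝ × ℝ → ℝ}, f =O[l] g → (∀ p, g p = e p ^ 3) → f =O[l] fun p => e p ^ 3 :=
    fun h hg => h.congr_right hg
  refine ((((((((c3 t1 fun p => by ring).add (c3 t2 fun p => by ring)).add
    (c3 t3 fun p => by ring)).add t4').add (c3 t5 fun p => by ring)).add
    (c3 t6 fun p => by ring)).add (c3 t7 fun p => by ring)).add
    ((c3 t8 fun p => by ring).const_mul_left K₀)).congr_left fun p => ?_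
  have e4 : (4 : ℝ) ^ (-a) / 64 = K₀ / 16 := by rw [hK₀]; ring
  unfold genN genInf genL2
  rw [e4, ← hK₀, ← hk]
  simp only [id, e, ε]
  ring

/-- The factors of the rescaled Laguerre kernel, of the Bessel kernel and of the correction kernel
are related by the asserted expansion, uniformly on `(0, s)²`. -/
theorem exists_radialAvg_expansion (ha : -1 < a) (hs : 0 < s) :
    ∃ C : ℝ, 0 ≤ C ∧ ∀ᶠ n in atTop, ∀ x ∈ Set.Ioo 0 s, ∀ y ∈ Set.Ioo 0 s,
      |radialAvg a (genN a n) x y - (radialAvg a (genInf a) x y +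
        invN n ^ 2 * radialAvg a (genL2 a) x y)| ≤ C * invN n ^ 3 := by
  obtain ⟨C, hC0, hC⟩ := (isBigO_genN_sub ha hs).exists_pos
  have ha1 : 0 < a + 1 := by linarith
  refine ⟨C / (a + 1), by positivity, ?_⟩
  filter_upwards [eventually_prod_principal_iff.1 hC.bound] with n hn x hx y hy
  have h1 := intervalIntegrable_rpow_mul ha (continuous_genN_radial ha n x y)
  have h2 := intervalIntegrable_rpow_mul ha (continuous_genInf_radial (a := a) x y)
  have h3 := intervalIntegrable_rpow_mul ha (continuous_genL2_radial (a := a) x y)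
  have h4 : radialAvg a (genN a n) x y - (radialAvg a (genInf a) x y +
      invN n ^ 2 * radialAvg a (genL2 a) x y) = ∫ t in (0 : ℝ)..1, t ^ a *
      (genN a n (t * x) (t * y) - genInf a (t * x) (t * y) -
        invN n ^ 2 * genL2 a (t * x) (t * y)) := by
    unfold radialAvg
    rw [← intervalIntegral.integral_const_mul, ← intervalIntegral.integral_add h2 (h3.const_mul _),
      ← intervalIntegral.integral_sub h1 (h2.add (h3.const_mul _))]
    refine intervalIntegral.integral_congr fun t _ => ?_
    ring
  rw [h4]
  refine (abs_integral_rpow_mul_le ha (K := C * invN n ^ 3) fun t ht => ?_).trans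
    (le_of_eq (by ring))
  have hmem : ∀ z ∈ Set.Ioo 0 s, t * z ∈ Set.Icc 0 s := fun z hz =>
    ⟨mul_nonneg ht.1.le hz.1.le, (mul_le_of_le_one_left hz.1.le ht.2).trans hz.2.le⟩
  have h5 := hn (t * x, t * y) ⟨hmem x hx, hmem y hy⟩
  rwa [Real.norm_eq_abs, Real.norm_of_nonneg (pow_nonneg (invN_pos n).le 3)] at h5

end KernelExpansion

/-! ### Orthogonality of the Laguerre functions -/

section LaguerreFunctions

variable {a : ℝ}

theorem Gamma_add_nat_eq {z : ℝ} (hz : 0 < z) (m : ℕ) :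
    Real.Gamma (z + m) = (ascPochhammer ℝ m).eval z * Real.Gamma z := by
  induction m with
  | zero => simp
  | succ m ih =>
    have hne : z + m ≠ 0 := by positivity
    rw [ascPochhammer_succ_eval, Nat.cast_succ, ← add_assoc, Real.Gamma_add_one hne, ih]
    ring

theorem weight_nonneg (a x : ℝ) : 0 ≤ weight a x := by
  unfold weight
  split_ifs with h
  · positivity
  · exact le_rfl

theorem measurable_weight (a : ℝ) : Measurable (weight a) := by
  unfold weight
  refine Measurable.ite measurableSet_Ioi ?_ measurable_const
  fun_prop

theorem weight_mul_pow_eq (a : ℝ) (m : ℕ) :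
    (fun x => weight a x * x ^ m) =
      Set.indicator (Set.Ioi 0) fun x : ℝ => Real.exp (-x) * x ^ (a + m + 1 - 1) := by
  funext x
  by_cases hx : 0 < x
  · rw [Set.indicator_of_mem (Set.mem_Ioi.2 hx), weight, if_pos hx, add_sub_cancel_right,
      Real.rpow_add_natCast hx.ne']
    ring
  · rw [Set.indicator_of_notMem (by simpa using hx), weight, if_neg hx, zero_mul]

theorem integrable_weight_mul_pow (ha : -1 < a) (m : ℕ) :
    Integrable fun x => weight a x * x ^ m := by
  rw [weight_mul_pow_eq, integrable_indicator_iff measurableSet_Ioi]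
  exact Real.GammaIntegral_convergent (by have : (0 : ℝ) ≤ m := m.cast_nonneg; linarith)

theorem integral_weight_mul_pow (ha : -1 < a) (m : ℕ) :
    ∫ x, weight a x * x ^ m = Real.Gamma (a + m + 1) := by
  rw [weight_mul_pow_eq, integral_indicator measurableSet_Ioi, Real.Gamma_eq_integral]
  have : (0 : ℝ) ≤ m := m.cast_nonneg
  linarith

theorem integrable_weight_mul_pow_mul_laguerreNorm (ha : -1 < a) (m n : ℕ) :
    Integrable fun x => weight a x * x ^ m * laguerreNorm a n x := by
  unfold laguerreNorm
  simp_rw [Finset.mul_sum]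
  refine integrable_finsetSum _ fun k _ => ?_
  refine ((integrable_weight_mul_pow ha (m + k)).const_mul ((-1 : ℝ) ^ k *
    (n.descFactorial k : ℝ) * (k.factorial : ℝ)⁻¹ * (Real.Gamma (k + a + 1))⁻¹)).congr ?_
  exact Eventually.of_forall fun x => by simp only [pow_add]; ring

/-- The moments of a Laguerre polynomial are finite differences of a polynomial of degree `m`. -/
theorem integral_weight_mul_pow_mul_laguerreNorm (ha : -1 < a) (m n : ℕ) :
    ∫ x, weight a x * x ^ m * laguerreNorm a n x =
      (-1) ^ n * (fwdDiff 1)^[n] (ascPochhammer ℝ m).eval (a + 1) := by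
  have h1 : ∀ k : ℕ, ∫ x, weight a x * x ^ m * ((-1 : ℝ) ^ k * (n.descFactorial k : ℝ) *
      (k.factorial : ℝ)⁻¹ * (Real.Gamma (k + a + 1))⁻¹ * x ^ k) =
      (-1 : ℝ) ^ k * (n.choose k : ℝ) * (ascPochhammer ℝ m).eval (a + 1 + k) := by
    intro k
    have hk : (0 : ℝ) ≤ k := k.cast_nonneg
    have hpos : 0 < a + 1 + k := by linarith
    have hG : Real.Gamma (a + 1 + k) ≠ 0 := (Real.Gamma_pos_of_pos hpos).ne'
    have hf : (k.factorial : ℝ) ≠ 0 := by exact_mod_cast k.factorial_ne_zero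
    have hd : (n.descFactorial k : ℝ) = k.factorial * n.choose k := by
      exact_mod_cast Nat.descFactorial_eq_factorial_mul_choose n k
    have e : (fun x : ℝ => weight a x * x ^ m * ((-1 : ℝ) ^ k * (n.descFactorial k : ℝ) *
        (k.factorial : ℝ)⁻¹ * (Real.Gamma (k + a + 1))⁻¹ * x ^ k)) = fun x =>
        ((-1 : ℝ) ^ k * (n.descFactorial k : ℝ) * (k.factorial : ℝ)⁻¹ *
          (Real.Gamma (k + a + 1))⁻¹) * (weight a x * x ^ (m + k)) := by
      funext x; rw [pow_add]; ring
    rw [e, integral_const_mul, integral_weight_mul_pow ha, hd,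
      show a + ((m + k : ℕ) : ℝ) + 1 = a + 1 + k + m by push_cast; ring,
      Gamma_add_nat_eq hpos, show (k : ℝ) + a + 1 = a + 1 + k by ring]
    field_simp
  have h2 : ∀ x, weight a x * x ^ m * laguerreNorm a n x = ∑ k ∈ Finset.range (n + 1),
      weight a x * x ^ m * ((-1 : ℝ) ^ k * (n.descFactorial k : ℝ) *
      (k.factorial : ℝ)⁻¹ * (Real.Gamma (k + a + 1))⁻¹ * x ^ k) := fun x => by
    rw [laguerreNorm, Finset.mul_sum]
  simp_rw [h2]
  rw [integral_finsetSum, fwdDiff_iter_eq_sum_shift, Finset.mul_sum]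
  · refine Finset.sum_congr rfl fun k hk => ?_
    have hk' : k ≤ n := Nat.lt_succ_iff.1 (Finset.mem_range.1 hk)
    rw [h1, nsmul_one, zsmul_eq_mul]
    push_cast
    have hs : (-1 : ℝ) ^ n * (-1) ^ (n - k) = (-1) ^ k := by
      rw [← pow_add, show n + (n - k) = k + 2 * (n - k) by omega, pow_add, pow_mul]; simp
    rw [← hs]; ring
  · intro k _
    refine ((integrable_weight_mul_pow ha (m + k)).const_mul ((-1 : ℝ) ^ k *
      (n.descFactorial k : ℝ) * (k.factorial : ℝ)⁻¹ * (Real.Gamma (k + a + 1))⁻¹)).congr ?_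
    exact Eventually.of_forall fun x => by simp only [pow_add]; ring

theorem integrable_weight_mul_laguerreNorm_mul (ha : -1 < a) (m n : ℕ) :
    Integrable fun x => weight a x * (laguerreNorm a m x * laguerreNorm a n x) := by
  have h : ∀ x, weight a x * (laguerreNorm a m x * laguerreNorm a n x) =
      ∑ k ∈ Finset.range (m + 1), ((-1 : ℝ) ^ k * (m.descFactorial k : ℝ) *
        (k.factorial : ℝ)⁻¹ * (Real.Gamma (k + a + 1))⁻¹) *
        (weight a x * x ^ k * laguerreNorm a n x) := by
    intro x
    rw [laguerreNorm, Finset.sum_mul, Finset.mul_sum]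
    exact Finset.sum_congr rfl fun k _ => by ring
  simp_rw [h]
  exact integrable_finsetSum _ fun k _ =>
    (integrable_weight_mul_pow_mul_laguerreNorm ha k n).const_mul _

theorem integral_weight_mul_laguerreNorm_mul_of_le (ha : -1 < a) {m n : ℕ} (hmn : m ≤ n) :
    ∫ x, weight a x * (laguerreNorm a m x * laguerreNorm a n x) =
      if m = n then (n.factorial : ℝ) / Real.Gamma (a + n + 1) else 0 := by
  have h : ∀ x, weight a x * (laguerreNorm a m x * laguerreNorm a n x) =
      ∑ k ∈ Finset.range (m + 1), ((-1 : ℝ) ^ k * (m.descFactorial k : ℝ) *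
        (k.factorial : ℝ)⁻¹ * (Real.Gamma (k + a + 1))⁻¹) *
        (weight a x * x ^ k * laguerreNorm a n x) := by
    intro x
    rw [laguerreNorm, Finset.sum_mul, Finset.mul_sum]
    exact Finset.sum_congr rfl fun k _ => by ring
  simp_rw [h]
  rw [integral_finsetSum _ fun k _ =>
    (integrable_weight_mul_pow_mul_laguerreNorm ha k n).const_mul _]
  simp_rw [integral_const_mul, integral_weight_mul_pow_mul_laguerreNorm ha]
  have hz : ∀ k < n, (fwdDiff 1)^[n] (ascPochhammer ℝ k).eval (a + 1) = 0 := fun k hk => by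
    rw [Polynomial.fwdDiff_iter_eq_zero_of_degree_lt (by rwa [ascPochhammer_natDegree])]; rfl
  rw [Finset.sum_range_succ, Finset.sum_eq_zero fun k hk => by
    rw [hz k ((Finset.mem_range.1 hk).trans_le hmn)]; simp, zero_add]
  split_ifs with hmn'
  · subst hmn'
    have hd := Polynomial.fwdDiff_iter_degree_eq_factorial (ascPochhammer ℝ m)
    rw [ascPochhammer_natDegree, (monic_ascPochhammer ℝ m).leadingCoeff] at hd
    have hf : (m.factorial : ℝ) ≠ 0 := by exact_mod_cast m.factorial_ne_zero
    have hs : (-1 : ℝ) ^ m * (-1) ^ m = 1 := by rw [← mul_pow]; simp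
    rw [hd, Nat.descFactorial_self, show (m : ℝ) + a + 1 = a + m + 1 by ring]
    simp only [one_smul, Pi.natCast_apply]
    rw [mul_assoc ((-1 : ℝ) ^ m), mul_inv_cancel₀ hf]
    linear_combination (m.factorial / Real.Gamma (a + m + 1)) * hs
  · rw [hz m (lt_of_le_of_ne hmn hmn')]; simp

/-- The normalized Laguerre function. -/
def lagFun (a : ℝ) (n : ℕ) (x : ℝ) : ℝ :=
  √(weight a x) * (√(Real.Gamma (a + n + 1) / n.factorial) * laguerreNorm a n x)

theorem Gamma_div_factorial_pos (ha : -1 < a) (n : ℕ) :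
    0 < Real.Gamma (a + n + 1) / n.factorial := by
  have : (0 : ℝ) ≤ n := n.cast_nonneg
  exact div_pos (Real.Gamma_pos_of_pos (by linarith)) (by exact_mod_cast n.factorial_pos)

theorem lagFun_mul_lagFun (a : ℝ) (m n : ℕ) (x : ℝ) :
    lagFun a m x * lagFun a n x = √(Real.Gamma (a + m + 1) / m.factorial) *
      √(Real.Gamma (a + n + 1) / n.factorial) *
        (weight a x * (laguerreNorm a m x * laguerreNorm a n x)) := by
  unfold lagFun
  linear_combination (√(Real.Gamma (a + m + 1) / m.factorial) *
      √(Real.Gamma (a + n + 1) / n.factorial) * (laguerreNorm a m x * laguerreNorm a n x)) *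
      Real.mul_self_sqrt (weight_nonneg a x)

theorem measurable_lagFun (a : ℝ) (n : ℕ) : Measurable (lagFun a n) :=
  (measurable_weight a).sqrt.mul ((continuous_laguerreNorm a n).measurable.const_mul _)

theorem integrable_lagFun_mul (ha : -1 < a) (m n : ℕ) :
    Integrable fun x => lagFun a m x * lagFun a n x := by
  simp_rw [lagFun_mul_lagFun]
  exact (integrable_weight_mul_laguerreNorm_mul ha m n).const_mul _

/-- The Laguerre functions are orthonormal. -/
theorem integral_lagFun_mul (ha : -1 < a) (m n : ℕ) :
    ∫ x, lagFun a m x * lagFun a n x = if m = n then 1 else 0 := by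
  wlog h : m ≤ n generalizing m n
  · rw [← integral_congr_ae (Eventually.of_forall fun x => mul_comm (lagFun a n x) (lagFun a m x)),
      this n m (le_of_not_ge h)]
    simp only [eq_comm]
  simp_rw [lagFun_mul_lagFun]
  rw [integral_const_mul, integral_weight_mul_laguerreNorm_mul_of_le ha h]
  split_ifs with hmn
  · subst hmn
    have hG := Gamma_div_factorial_pos ha m
    rw [Real.mul_self_sqrt hG.le, ← inv_div (Real.Gamma (a + m + 1)), mul_inv_cancel₀ hG.ne']
  · rw [mul_zero]

theorem kernelN_eq_sum_lagFun (ha : -1 < a) (N : ℕ) (x y : ℝ) :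
    kernelN a N x y = ∑ n ∈ Finset.range N, lagFun a n x * lagFun a n y := by
  unfold kernelN
  rw [Real.sqrt_mul (weight_nonneg a x), Finset.mul_sum]
  refine Finset.sum_congr rfl fun n _ => ?_
  have hG := Gamma_div_factorial_pos ha n
  rw [laguerreL_eq, laguerreL_eq, lagFun, lagFun]
  set G := Real.Gamma (a + n + 1) / n.factorial
  have h := Real.mul_self_sqrt hG.le
  have e : G * laguerreNorm a n x * (G * laguerreNorm a n y) / G =
      G * (laguerreNorm a n x * laguerreNorm a n y) := by field_simp
  rw [e]
  linear_combination (-(√(weight a x) * √(weight a y) *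
    (laguerreNorm a n x * laguerreNorm a n y))) * h

/-- The Laguerre functions rescaled by the factor `c`, again normalized. -/
def lagScaled (a c : ℝ) (n : ℕ) (x : ℝ) : ℝ := √c⁻¹ * lagFun a n (x / c)

theorem lagScaled_mul (a : ℝ) {c : ℝ} (hc : 0 < c) (m n : ℕ) (x : ℝ) :
    lagScaled a c m x * lagScaled a c n x = c⁻¹ * (lagFun a m (x / c) * lagFun a n (x / c)) := by
  have h := Real.mul_self_sqrt (inv_pos.2 hc).le
  unfold lagScaled
  linear_combination (lagFun a m (x / c) * lagFun a n (x / c)) * h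

theorem measurable_lagScaled (a c : ℝ) (n : ℕ) : Measurable (lagScaled a c n) :=
  ((measurable_lagFun a n).comp (measurable_id.div_const c)).const_mul _

theorem integrable_lagScaled_mul (ha : -1 < a) {c : ℝ} (hc : 0 < c) (m n : ℕ) :
    Integrable fun x => lagScaled a c m x * lagScaled a c n x := by
  simp_rw [lagScaled_mul a hc]
  exact ((integrable_lagFun_mul ha m n).comp_div hc.ne').const_mul _

theorem memLp_lagScaled (ha : -1 < a) {c : ℝ} (hc : 0 < c) (n : ℕ) :
    MemLp (lagScaled a c n) 2 volume := by
  rw [memLp_two_iff_integrable_sq (measurable_lagScaled a c n).aestronglyMeasurable]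
  simpa only [sq] using integrable_lagScaled_mul ha hc n n

theorem integral_lagScaled_mul (ha : -1 < a) {c : ℝ} (hc : 0 < c) (m n : ℕ) :
    ∫ x, lagScaled a c m x * lagScaled a c n x = if m = n then 1 else 0 := by
  simp_rw [lagScaled_mul a hc]
  rw [integral_const_mul, Measure.integral_comp_div (fun x => lagFun a m x * lagFun a n x),
    integral_lagFun_mul ha, abs_of_pos hc, smul_eq_mul, ← mul_assoc, inv_mul_cancel₀ hc.ne',
    one_mul]

theorem kernelN_scaled_eq_sum (ha : -1 < a) {c : ℝ} (hc : 0 < c) (N : ℕ) (x y : ℝ) :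
    c⁻¹ * kernelN a N (x / c) (y / c) =
      ∑ n : Fin N, lagScaled a c n x * lagScaled a c n y := by
  have h := Real.mul_self_sqrt (inv_pos.2 hc).le
  rw [kernelN_eq_sum_lagFun ha, Finset.sum_range, Finset.mul_sum]
  refine Finset.sum_congr rfl fun n _ => ?_
  unfold lagScaled
  linear_combination (-(lagFun a n (x / c) * lagFun a n (y / c))) * h

/-- The Gram matrices of the Laguerre functions on corresponding intervals agree. -/
theorem integral_lagScaled_mul_mu (a : ℝ) {c : ℝ} (hc : 0 < c) (s : ℝ) (m n : ℕ) :
    ∫ x, lagScaled a c m x * lagScaled a c n x ∂(mu s) =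
      ∫ x, lagFun a m x * lagFun a n x ∂(mu (s / c)) := by
  simp_rw [lagScaled_mul a hc]
  rw [integral_const_mul, mu, mu, ← integral_indicator measurableSet_Ioo,
    ← integral_indicator measurableSet_Ioo]
  have e : (Set.indicator (Set.Ioo 0 s) fun x => lagFun a m (x / c) * lagFun a n (x / c)) =
      fun x => (Set.indicator (Set.Ioo 0 (s / c)) fun x => lagFun a m x * lagFun a n x) (x / c) := by
    funext x
    have hiff : x ∈ Set.Ioo 0 s ↔ x / c ∈ Set.Ioo 0 (s / c) := by
      simp only [Set.mem_Ioo, div_pos_iff_of_pos_right hc, div_lt_div_iff_of_pos_right hc]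
    by_cases hx : x ∈ Set.Ioo 0 s
    · rw [Set.indicator_of_mem hx, Set.indicator_of_mem (hiff.1 hx)]
    · rw [Set.indicator_of_notMem hx, Set.indicator_of_notMem fun h => hx (hiff.2 h)]
  rw [e, Measure.integral_comp_div, abs_of_pos hc, smul_eq_mul, ← mul_assoc,
    inv_mul_cancel₀ hc.ne', one_mul]

end LaguerreFunctions

/-! ### The kernels as bounded kernels with weight `x ^ (a / 2)` -/

section KernelBounds

variable {a s : ℝ}

instance (s : ℝ) : IsFiniteMeasure (mu s) := by unfold mu; infer_instance

theorem ae_mem_mu (s : ℝ) : ∀ᵐ x ∂(mu s), x ∈ Set.Ioo 0 s := ae_restrict_mem measurableSet_Ioo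

theorem measurable_rpow_half (a : ℝ) : Measurable fun x : ℝ => x ^ (a / 2) := by fun_prop

theorem memLp_rpow_half (ha : -1 < a) (s : ℝ) : MemLp (fun x : ℝ => x ^ (a / 2)) 2 (mu s) := by
  rw [memLp_two_iff_integrable_sq (measurable_rpow_half a).aestronglyMeasurable]
  rcases le_or_gt s 0 with hs | hs
  · simp [mu, Set.Ioo_eq_empty_of_le hs]
  have h := (intervalIntegral.intervalIntegrable_rpow' (a := 0) (b := s) ha).1
  refine (h.mono_set Set.Ioo_subset_Ioc_self).congr ?_
  filter_upwards [ae_restrict_mem measurableSet_Ioo] with x hx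
  rw [← Real.rpow_natCast, ← Real.rpow_mul hx.1.le]
  congr 1; push_cast; ring

theorem measurable_radialAvg (a : ℝ) {g : ℝ → ℝ → ℝ} (hg : Continuous (Function.uncurry g)) :
    Measurable (Function.uncurry (radialAvg a g)) := by
  have h : StronglyMeasurable fun q : (ℝ × ℝ) × ℝ =>
      q.2 ^ a * g (q.2 * q.1.1) (q.2 * q.1.2) := by
    refine Measurable.stronglyMeasurable (Measurable.mul (by fun_prop) ?_)
    exact (hg.comp (by fun_prop : Continuous fun q : (ℝ × ℝ) × ℝ =>
      (q.2 * q.1.1, q.2 * q.1.2))).measurable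
  have h2 := (h.integral_prod_right' (ν := volume.restrict (Set.Ioc (0 : ℝ) 1))).measurable
  have e : Function.uncurry (radialAvg a g) = fun p => ∫ t, t ^ a * g (t * p.1) (t * p.2)
      ∂(volume.restrict (Set.Ioc (0 : ℝ) 1)) := by
    funext p
    rw [Function.uncurry, radialAvg, intervalIntegral.integral_of_le zero_le_one]
  rw [e]
  exact h2

theorem exists_abs_radialAvg_le (ha : -1 < a) (s : ℝ) {g : ℝ → ℝ → ℝ}
    (hg : Continuous (Function.uncurry g)) :
    ∃ M, 0 ≤ M ∧ ∀ x ∈ Set.Ioo 0 s, ∀ y ∈ Set.Ioo 0 s, |radialAvg a g x y| ≤ M := by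
  obtain ⟨K, hK⟩ := (isCompact_Icc.prod isCompact_Icc).exists_bound_of_continuousOn
    (s := Set.Icc 0 s ×ˢ Set.Icc 0 s) hg.continuousOn
  have ha1 : 0 < a + 1 := by linarith
  refine ⟨|K| / (a + 1), by positivity, fun x hx y hy => ?_⟩
  refine abs_integral_rpow_mul_le ha fun t ht => ?_
  have hmem : ∀ z ∈ Set.Ioo 0 s, t * z ∈ Set.Icc 0 s := fun z hz =>
    ⟨mul_nonneg ht.1.le hz.1.le, (mul_le_of_le_one_left hz.1.le ht.2).trans hz.2.le⟩
  exact (hK (t * x, t * y) ⟨hmem x hx, hmem y hy⟩).trans (le_abs_self K)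

theorem exists_weightedKernel (ha : -1 < a) (s : ℝ) {g k : ℝ → ℝ → ℝ}
    (hg : Continuous (Function.uncurry g))
    (hk : ∀ x y, 0 < x → 0 < y → k x y = x ^ (a / 2) * radialAvg a g x y * y ^ (a / 2)) :
    ∃ M, 0 ≤ M ∧
      WeightedKernel (Set.Ioo 0 s) (fun x => x ^ (a / 2)) M (radialAvg a g) k := by
  obtain ⟨M, hM, h⟩ := exists_abs_radialAvg_le ha s hg
  exact ⟨M, hM, measurable_radialAvg a hg, fun x hx y hy => hk x y hx.1 hy.1, h⟩

theorem continuous_genInf (a : ℝ) : Continuous (Function.uncurry (genInf a)) := by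
  have := continuous_besselEntire a
  unfold genInf Function.uncurry
  fun_prop

theorem continuous_genL2 (a : ℝ) : Continuous (Function.uncurry (genL2 a)) := by
  have h1 := continuous_besselEntire a
  have h2 := continuous_besselEntire' a
  have h3 := continuous_corrLeft a
  unfold genL2 Function.uncurry
  fun_prop

theorem continuous_genN (ha : -1 < a) (n : ℕ) : Continuous (Function.uncurry (genN a n)) := by
  have h1 := (isSystemSolution_laguerre ha n).continuous_left
  have h2 := (isSystemSolution_laguerre ha n).continuous_right
  unfold genN Function.uncurry
  fun_prop

theorem exists_weightedKernel_kernelN (ha : -1 < a) (n : ℕ) (s : ℝ) :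
    ∃ M, 0 ≤ M ∧ ∃ α, WeightedKernel (Set.Ioo 0 (s / scale a n)) (fun x => x ^ (a / 2)) M α
      (kernelN a (n + 1)) := by
  have hc := scale_pos ha n
  set c := scale a n with hcdef
  obtain ⟨M, hM, h⟩ := exists_abs_radialAvg_le ha s (continuous_genN ha n)
  set b := c * (c ^ (a / 2) * c ^ (a / 2)) with hb
  have hb0 : 0 < b := by positivity
  have hmem : ∀ x ∈ Set.Ioo 0 (s / c), c * x ∈ Set.Ioo 0 s := fun x hx =>
    ⟨mul_pos hc hx.1, by rw [mul_comm]; exact (lt_div_iff₀ hc).1 hx.2⟩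
  refine ⟨b * M, by positivity, fun x y => b * radialAvg a (genN a n) (c * x) (c * y), ?_, ?_, ?_⟩
  · exact ((measurable_radialAvg a (continuous_genN ha n)).comp
      (by fun_prop : Measurable fun p : ℝ × ℝ => (c * p.1, c * p.2))).const_mul b
  · intro x hx y hy
    have e := kernelN_eq ha n (hmem x hx).1 (hmem y hy).1
    rw [← hcdef, mul_div_cancel_left₀ _ hc.ne', mul_div_cancel_left₀ _ hc.ne',
      Real.mul_rpow hc.le hx.1.le, Real.mul_rpow hc.le hy.1.le, inv_mul_eq_iff_eq_mul₀ hc.ne'] at e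
    rw [e, hb]
    ring
  · intro x hx y hy
    rw [abs_mul, abs_of_pos hb0]
    exact mul_le_mul_of_nonneg_left (h _ (hmem x hx) _ (hmem y hy)) hb0.le

/-- The Laguerre kernel for `n + 1` eigenvalues at the hard edge scale. -/
def kernelScaled (a : ℝ) (n : ℕ) (x y : ℝ) : ℝ :=
  (scale a n)⁻¹ * kernelN a (n + 1) (x / scale a n) (y / scale a n)

theorem kernelScaled_eq_sum (ha : -1 < a) (n : ℕ) (x y : ℝ) :
    kernelScaled a n x y =
      ∑ i : Fin (n + 1), lagScaled a (scale a n) i x * lagScaled a (scale a n) i y :=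
  kernelN_scaled_eq_sum ha (scale_pos ha n) (n + 1) x y

/-- The kernels and their approximations have a common bound. -/
theorem exists_uniform_weightedKernel (ha : -1 < a) (hs : 0 < s) :
    ∃ M, 1 ≤ M ∧
      WeightedKernel (Set.Ioo 0 s) (fun x => x ^ (a / 2)) M (radialAvg a (genInf a))
        (kernelInf a) ∧
      WeightedKernel (Set.Ioo 0 s) (fun x => x ^ (a / 2)) M (radialAvg a (genL2 a))
        (kernelL2 a) ∧
      ∀ᶠ n in atTop, WeightedKernel (Set.Ioo 0 s) (fun x => x ^ (a / 2)) M
        (radialAvg a (genN a n)) (kernelScaled a n) := by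
  obtain ⟨M1, h10, h1⟩ := exists_weightedKernel ha s (continuous_genInf a)
    fun x y hx hy => kernelInf_eq ha hx hy
  obtain ⟨M2, h20, h2⟩ := exists_weightedKernel ha s (continuous_genL2 a)
    fun x y hx hy => kernelL2_eq ha hx hy
  obtain ⟨C, hC, h3⟩ := exists_radialAvg_expansion ha hs
  refine ⟨1 + (M1 + M2 + C), by linarith, h1.mono (by linarith), h2.mono (by linarith), ?_⟩
  filter_upwards [h3] with n hn
  refine ⟨measurable_radialAvg a (continuous_genN ha n),
    fun x hx y hy => kernelN_eq ha n hx.1 hy.1, fun x hx y hy => ?_⟩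
  have i0 := (invN_pos n).le
  have e1 : invN n ^ 2 * |radialAvg a (genL2 a) x y| ≤ M2 :=
    (mul_le_of_le_one_left (abs_nonneg _) (pow_le_one₀ i0 (invN_le_one n))).trans
      (h2.abs_le x hx y hy)
  have e2 : C * invN n ^ 3 ≤ C := mul_le_of_le_one_right hC (pow_le_one₀ i0 (invN_le_one n))
  have e3 := abs_add_le (radialAvg a (genN a n) x y - (radialAvg a (genInf a) x y +
    invN n ^ 2 * radialAvg a (genL2 a) x y)) (radialAvg a (genInf a) x y +
    invN n ^ 2 * radialAvg a (genL2 a) x y)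
  have e4 := abs_add_le (radialAvg a (genInf a) x y) (invN n ^ 2 * radialAvg a (genL2 a) x y)
  rw [abs_mul, abs_of_nonneg (pow_nonneg i0 2)] at e4
  rw [sub_add_cancel] at e3
  linarith [hn x hx y hy, h1.abs_le x hx y hy]

/-- The rescaled Laguerre kernels converge to the Bessel kernel at the rate `1 / N ^ 2`. -/
theorem exists_radialAvg_sub_le (ha : -1 < a) (hs : 0 < s) :
    ∃ C, 0 ≤ C ∧ ∀ᶠ n in atTop, ∀ x ∈ Set.Ioo 0 s, ∀ y ∈ Set.Ioo 0 s,
      |radialAvg a (genN a n) x y - radialAvg a (genInf a) x y| ≤ C * invN n ^ 2 := by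
  obtain ⟨M, hM, h2⟩ := exists_abs_radialAvg_le ha s (continuous_genL2 a)
  obtain ⟨C, hC, h3⟩ := exists_radialAvg_expansion ha hs
  refine ⟨C + M, by linarith, ?_⟩
  filter_upwards [h3] with n hn x hx y hy
  have i0 := (invN_pos n).le
  have e1 : invN n ^ 2 * |radialAvg a (genL2 a) x y| ≤ invN n ^ 2 * M :=
    mul_le_mul_of_nonneg_left (h2 x hx y hy) (pow_nonneg i0 2)
  have e2 : C * invN n ^ 3 ≤ C * invN n ^ 2 :=
    mul_le_mul_of_nonneg_left (pow_le_pow_of_le_one i0 (invN_le_one n) (by norm_num)) hC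
  have e3 := abs_add_le (radialAvg a (genN a n) x y - (radialAvg a (genInf a) x y +
    invN n ^ 2 * radialAvg a (genL2 a) x y)) (invN n ^ 2 * radialAvg a (genL2 a) x y)
  rw [abs_mul (invN n ^ 2), abs_of_nonneg (pow_nonneg i0 2)] at e3
  have e4 : radialAvg a (genN a n) x y - (radialAvg a (genInf a) x y +
    invN n ^ 2 * radialAvg a (genL2 a) x y) + invN n ^ 2 * radialAvg a (genL2 a) x y =
    radialAvg a (genN a n) x y - radialAvg a (genInf a) x y := by ring
  rw [e4] at e3
  linarith [hn x hx y hy]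

end KernelBounds

/-! ### Positivity and compactness of the Bessel operator -/

section BesselOperator

variable {a s : ℝ}

/-- The compression of an orthogonal projection to a subset satisfies `T² ≤ T`. -/
theorem norm_sq_sum_rankOneOp_le {N : ℕ} {u : Fin N → ℝ → ℝ} (S : Set ℝ)
    (hu : ∀ i, MemLp (u i) 2 volume) (hu' : ∀ i, MemLp (u i) 2 (volume.restrict S))
    (horth : ∀ i j, ∫ x, u i x * u j x = if i = j then 1 else 0)
    (f : Lp ℝ 2 (volume.restrict S)) :
    ‖(∑ i, rankOneOp ((hu' i).toLp (u i)) ((hu' i).toLp (u i))) f‖ ^ 2 ≤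
      inner ℝ f ((∑ i, rankOneOp ((hu' i).toLp (u i)) ((hu' i).toLp (u i))) f) := by
  set c : Fin N → ℝ := fun i => inner ℝ ((hu' i).toLp (u i)) f with hc
  have hT : (∑ i, rankOneOp ((hu' i).toLp (u i)) ((hu' i).toLp (u i))) f =
      ∑ i, c i • (hu' i).toLp (u i) := by
    simp [hc]
  have hint : ∀ (ν : Measure ℝ), (∀ i, MemLp (u i) 2 ν) →
      ∫ x, (∑ i, c i * u i x) ^ 2 ∂ν = ∑ i, ∑ j, c i * (c j * ∫ x, u i x * u j x ∂ν) := by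
    intro ν hν
    have e : ∀ x, (∑ i, c i * u i x) ^ 2 = ∑ i, ∑ j, c i * (c j * (u i x * u j x)) := by
      intro x
      rw [sq, Finset.sum_mul_sum]
      exact Finset.sum_congr rfl fun i _ => Finset.sum_congr rfl fun j _ => by ring
    have hi : ∀ i j, Integrable (fun x => u i x * u j x) ν := fun i j =>
      (hν i).integrable_mul (hν j)
    simp_rw [e]
    rw [integral_finsetSum _ fun i _ => integrable_finsetSum _ fun j _ =>
      ((hi i j).const_mul _).const_mul _]
    refine Finset.sum_congr rfl fun i _ => ?_
    rw [integral_finsetSum _ fun j _ => ((hi i j).const_mul _).const_mul _]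
    simp_rw [integral_const_mul]
  have h1 : ‖∑ i, c i • (hu' i).toLp (u i)‖ ^ 2 =
      ∫ x, (∑ i, c i * u i x) ^ 2 ∂(volume.restrict S) := by
    rw [hint _ hu', ← real_inner_self_eq_norm_sq, sum_inner]
    refine Finset.sum_congr rfl fun i _ => ?_
    rw [inner_sum]
    refine Finset.sum_congr rfl fun j _ => ?_
    rw [real_inner_smul_left, real_inner_smul_right, inner_toLp_toLp]
  have h2 : ∫ x, (∑ i, c i * u i x) ^ 2 ∂(volume.restrict S) ≤
      ∫ x, (∑ i, c i * u i x) ^ 2 := by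
    refine setIntegral_le_integral ?_ (Eventually.of_forall fun x => sq_nonneg _)
    exact (memLp_finsetSum _ fun i _ => (hu i).const_mul (c i)).integrable_sq
  have h3 : ∫ x, (∑ i, c i * u i x) ^ 2 = ∑ i, c i * c i := by
    rw [hint _ hu]
    simp [horth]
  have h4 : inner ℝ f (∑ i, c i • (hu' i).toLp (u i)) = ∑ i, c i * c i := by
    rw [inner_sum]
    refine Finset.sum_congr rfl fun i _ => ?_
    rw [real_inner_smul_right, real_inner_comm]
  rw [hT, h1, h4, ← h3]
  exact h2

theorem isCompactOperator_rankOneOp {H : Type*} [NormedAddCommGroup H] [InnerProductSpace ℝ H]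
    (u v : H) : IsCompactOperator (rankOneOp u v) := by
  have h : IsCompactOperator (innerSL ℝ v : H → ℝ) :=
    isCompactOperator_of_locallyCompactSpace_dom (innerSL ℝ v)
  exact h.clm_comp (ContinuousLinearMap.toSpanSingleton ℝ u)

/-- The Bessel operator is the norm limit of the rescaled Laguerre operators. -/
theorem tendsto_laguerreOperator (ha : -1 < a) (hs : 0 < s) {T : Lp ℝ 2 (mu s) →L[ℝ] Lp ℝ 2 (mu s)}
    (hT : IsIntegralOperator (mu s) (kernelInf a) T)
    {Tn : ℕ → Lp ℝ 2 (mu s) →L[ℝ] Lp ℝ 2 (mu s)}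
    (hTn : ∀ n, IsIntegralOperator (mu s) (kernelScaled a n) (Tn n)) :
    Tendsto Tn atTop (𝓝 T) := by
  obtain ⟨M, -, h1, -, h2⟩ := exists_uniform_weightedKernel ha hs
  obtain ⟨C, hC, h3⟩ := exists_radialAvg_sub_le ha hs
  rw [tendsto_iff_norm_sub_tendsto_zero]
  have h0 : Tendsto (fun n => C * invN n ^ 2 * ∫ t, (t ^ (a / 2)) ^ 2 ∂(mu s)) atTop (𝓝 0) := by
    simpa using ((tendsto_invN.pow 2).const_mul C).mul_const (∫ t, (t ^ (a / 2)) ^ 2 ∂(mu s))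
  refine squeeze_zero' (Eventually.of_forall fun n => norm_nonneg _) ?_ h0
  filter_upwards [h2, h3] with n hn hn'
  exact hn.norm_sub_le h1 (mul_nonneg hC (pow_nonneg (invN_pos n).le 2)) (ae_mem_mu s)
    (measurable_rpow_half a) (memLp_rpow_half ha s) hn' (hTn n) hT

theorem memLp_lagScaled_mu (ha : -1 < a) {c : ℝ} (hc : 0 < c) (n : ℕ) (s : ℝ) :
    MemLp (lagScaled a c n) 2 (mu s) :=
  (memLp_lagScaled ha hc n).restrict _

theorem isIntegralOperator_kernelScaled (ha : -1 < a) (s : ℝ) (n : ℕ) :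
    IsIntegralOperator (mu s) (kernelScaled a n) (∑ i : Fin (n + 1),
      rankOneOp ((memLp_lagScaled_mu ha (scale_pos ha n) i s).toLp _)
        ((memLp_lagScaled_mu ha (scale_pos ha n) i s).toLp _)) := by
  have h := isIntegralOperator_finiteRank
    (fun i : Fin (n + 1) => memLp_lagScaled_mu ha (scale_pos ha n) i s)
    (fun i : Fin (n + 1) => memLp_lagScaled_mu ha (scale_pos ha n) i s)
  have e : kernelScaled a n = fun x y => ∑ i : Fin (n + 1),
      lagScaled a (scale a n) i x * lagScaled a (scale a n) i y := by
    funext x y; exact kernelScaled_eq_sum ha n x y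
  rw [e]
  exact h

/-- The Bessel operator is a norm limit of operators of finite rank. -/
theorem isCompactOperator_bessel (ha : -1 < a) (hs : 0 < s)
    {T : Lp ℝ 2 (mu s) →L[ℝ] Lp ℝ 2 (mu s)}
    (hT : IsIntegralOperator (mu s) (kernelInf a) T) : IsCompactOperator T := by
  refine isCompactOperator_of_tendsto
    (tendsto_laguerreOperator ha hs hT (isIntegralOperator_kernelScaled ha s))
    (Eventually.of_forall fun n => ?_)
  have : ∀ (t : Finset (Fin (n + 1))), IsCompactOperator (↑(∑ i ∈ t,
      rankOneOp ((memLp_lagScaled_mu ha (scale_pos ha n) i s).toLp _)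
        ((memLp_lagScaled_mu ha (scale_pos ha n) i s).toLp _)) : Lp ℝ 2 (mu s) → Lp ℝ 2 (mu s)) := by
    intro t
    induction t using Finset.cons_induction with
    | empty => rw [Finset.sum_empty]; exact isCompactOperator_zero
    | cons i t hi ih => rw [Finset.sum_cons]; exact (isCompactOperator_rankOneOp _ _).add ih
  exact this _

/-- The Bessel operator satisfies `T² ≤ T`, as a limit of compressed projections. -/
theorem norm_sq_bessel_le (ha : -1 < a) (hs : 0 < s) {T : Lp ℝ 2 (mu s) →L[ℝ] Lp ℝ 2 (mu s)}
    (hT : IsIntegralOperator (mu s) (kernelInf a) T) (f : Lp ℝ 2 (mu s)) :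
    ‖T f‖ ^ 2 ≤ inner ℝ f (T f) := by
  have h := tendsto_laguerreOperator ha hs hT (isIntegralOperator_kernelScaled ha s)
  have h1 := ((ContinuousLinearMap.apply ℝ (Lp ℝ 2 (mu s)) f).continuous.tendsto T).comp h
  refine le_of_tendsto_of_tendsto' (h1.norm.pow 2)
    ((tendsto_const_nhds (x := f)).inner (𝕜 := ℝ) h1) fun n => ?_
  exact norm_sq_sum_rankOneOp_le (u := fun i : Fin (n + 1) => lagScaled a (scale a n) i)
    (Set.Ioo 0 s) (fun i => memLp_lagScaled ha (scale_pos ha n) i)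
    (fun i => memLp_lagScaled_mu ha (scale_pos ha n) i s)
    (fun i j => by rw [integral_lagScaled_mul ha (scale_pos ha n)]; simp [Fin.ext_iff]) f

end BesselOperator

/-! ### Analyticity and the absence of the eigenvalue one -/

section Analytic

variable {a s : ℝ}

/-- An everywhere convergent power series that vanishes on an interval vanishes identically. -/
theorem powerSeries_eq_zero {d : ℕ → ℝ} (hd : ∀ x : ℝ, Summable fun m => ‖d m * x ^ m‖) {p q : ℝ}
    (hpq : p < q) (h : ∀ᵐ x ∂(volume.restrict (Set.Ioo p q)), ∑' m, d m * x ^ m = 0) (x : ℝ) :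
    ∑' m, d m * x ^ m = 0 := by
  set P := FormalMultilinearSeries.ofScalars ℝ d with hP
  have hsum : P.sum = fun x => ∑' m, d m * x ^ m := by
    have := FormalMultilinearSeries.ofScalarsSum_eq_tsum (E := ℝ) (c := d)
    simpa [FormalMultilinearSeries.ofScalarsSum] using this
  have hr : P.radius = ⊤ := P.radius_eq_top_of_summable_norm fun r => by
    refine (hd r).congr fun m => ?_
    rw [hP, FormalMultilinearSeries.ofScalars_norm, norm_mul, norm_pow, NNReal.norm_eq]
  have hP1 := P.hasFPowerSeriesOnBall (by rw [hr]; exact ENNReal.coe_lt_top)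
  rw [hsum, hr] at hP1
  have han : AnalyticOnNhd ℝ (fun x => ∑' m, d m * x ^ m) Set.univ := by
    simpa using hP1.analyticOnNhd
  have heq : Set.EqOn (fun x => ∑' m, d m * x ^ m) (fun _ => 0) (Set.Ioo p q) :=
    Measure.eqOn_open_of_ae_eq h isOpen_Ioo (han.continuousOn.mono (Set.subset_univ _))
      continuousOn_const
  have hmid : (p + q) / 2 ∈ Set.Ioo p q := ⟨by linarith, by linarith⟩
  exact han.eqOn_zero_of_preconnected_of_eventuallyEq_zero isPreconnected_univ
    (Set.mem_univ ((p + q) / 2)) (by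
      filter_upwards [isOpen_Ioo.mem_nhds hmid] with y hy using heq hy) (Set.mem_univ x)

/-- Up to the weight `x ^ (a / 2)`, functions in the range of the Bessel operator are entire. -/
theorem exists_powerSeries_radialAvg (ha : -1 < a) {h : ℝ → ℝ} (hh : Integrable h (mu s)) :
    ∃ d : ℕ → ℝ, (∀ x : ℝ, Summable fun m => ‖d m * x ^ m‖) ∧
      ∀ x, ∫ y, radialAvg a (genInf a) x y * h y ∂(mu s) = ∑' m, d m * x ^ m := by
  set τ : Measure ℝ := volume.restrict (Set.Ioc (0 : ℝ) 1) with hτ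
  have hmem : ∀ᵐ p ∂(τ.prod (mu s)), p ∈ Set.Ioc (0 : ℝ) 1 ×ˢ Set.Ioo 0 s := by
    rw [hτ, mu, Measure.prod_restrict]
    exact ae_restrict_mem (measurableSet_Ioc.prod measurableSet_Ioo)
  have hbd : ∀ φ : ℝ × ℝ → ℝ, Continuous φ → ∃ K, ∀ᵐ p ∂(τ.prod (mu s)), ‖φ p‖ ≤ K := by
    intro φ hφ
    obtain ⟨K, hK⟩ := (isCompact_Icc.prod isCompact_Icc).exists_bound_of_continuousOn
      (s := Set.Icc (0 : ℝ) 1 ×ˢ Set.Icc 0 s) hφ.continuousOn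
    refine ⟨K, ?_⟩
    filter_upwards [hmem] with p hp
    exact hK p ⟨Set.Ioc_subset_Icc_self hp.1, Set.Ioo_subset_Icc_self hp.2⟩
  have hB := continuous_besselEntire a
  have hta : Integrable (fun t : ℝ => t ^ a) τ :=
    (intervalIntegral.intervalIntegrable_rpow' (a := 0) (b := 1) ha).1
  -- the part of the integrand that does not depend on `x`
  set G : ℝ × ℝ → ℝ := fun p => 4 ^ (-a) / 4 * besselEntire a (p.1 * p.2) * (p.1 ^ a * h p.2) with hG
  have hmulint : ∀ (f φ : ℝ × ℝ → ℝ), Integrable f (τ.prod (mu s)) → Continuous φ →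
      Integrable (fun p => φ p * f p) (τ.prod (mu s)) := by
    intro f φ hf hφ
    obtain ⟨K, hK⟩ := hbd φ hφ
    exact hf.bdd_mul hφ.aestronglyMeasurable hK
  have hGint : Integrable G (τ.prod (mu s)) :=
    hmulint _ (fun p => 4 ^ (-a) / 4 * besselEntire a (p.1 * p.2)) (hta.mul_prod hh) (by fun_prop)
  have hle : ∀ (m : ℕ) (x : ℝ), ∀ᵐ p ∂(τ.prod (mu s)),
      ‖besselCoeff a m * (p.1 * x) ^ m * G p‖ ≤ ‖besselCoeff a m * x ^ m‖ * ‖G p‖ := by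
    intro m x
    filter_upwards [hmem] with p hp
    rw [norm_mul, norm_mul, norm_mul (besselCoeff a m), mul_pow, norm_mul]
    refine mul_le_mul_of_nonneg_right (mul_le_mul_of_nonneg_left ?_ (norm_nonneg _)) (norm_nonneg _)
    refine mul_le_of_le_one_left (norm_nonneg _) ?_
    rw [norm_pow, Real.norm_of_nonneg hp.1.1.le]
    exact pow_le_one₀ hp.1.1.le hp.1.2
  have hint : ∀ (m : ℕ) (x : ℝ),
      Integrable (fun p => besselCoeff a m * (p.1 * x) ^ m * G p) (τ.prod (mu s)) := fun m x =>
    hmulint G (fun p => besselCoeff a m * (p.1 * x) ^ m) hGint (by fun_prop)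
  have hnorm : ∀ (m : ℕ) (x : ℝ),
      ∫ p, ‖besselCoeff a m * (p.1 * x) ^ m * G p‖ ∂(τ.prod (mu s)) ≤
        ‖besselCoeff a m * x ^ m‖ * ∫ p, ‖G p‖ ∂(τ.prod (mu s)) := fun m x => by
    rw [← integral_const_mul]
    exact integral_mono_ae (hint m x).norm (hGint.norm.const_mul _) (hle m x)
  have hterm : ∀ (m : ℕ) (x : ℝ), ∫ p, besselCoeff a m * (p.1 * x) ^ m * G p ∂(τ.prod (mu s)) =
      (∫ p, besselCoeff a m * (p.1 * 1) ^ m * G p ∂(τ.prod (mu s))) * x ^ m := fun m x => by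
    rw [← integral_mul_const]
    congr 1
    funext p
    rw [mul_pow, mul_one]; ring
  refine ⟨fun m => ∫ p, besselCoeff a m * (p.1 * 1) ^ m * G p ∂(τ.prod (mu s)), fun x => ?_,
    fun x => ?_⟩
  · refine Summable.of_nonneg_of_le (fun m => norm_nonneg _) (fun m => ?_)
      ((summable_norm_besselCoeff a x).mul_right (∫ p, ‖G p‖ ∂(τ.prod (mu s))))
    rw [← hterm]
    exact (norm_integral_le_integral_norm _).trans (hnorm m x)
  · have hs := hasSum_integral_of_summable_integral_norm (hint · x)
      (Summable.of_nonneg_of_le (fun m => integral_nonneg fun p => norm_nonneg _) (hnorm · x)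
        ((summable_norm_besselCoeff a x).mul_right _))
    simp_rw [← hterm]
    rw [hs.tsum_eq]
    have e : (fun p => ∑' m, besselCoeff a m * (p.1 * x) ^ m * G p) =
        fun p => besselEntire a (p.1 * x) * G p := by
      funext p; rw [tsum_mul_right]; rfl
    rw [e, integral_prod_symm _ (hmulint G (fun p => besselEntire a (p.1 * x)) hGint (by fun_prop))]
    congr 1
    funext y
    rw [radialAvg, intervalIntegral.integral_of_le zero_le_one, ← integral_mul_const]
    congr 1
    funext t
    simp only [hG, genInf]
    ring

/-- The Bessel operator on `(0, s)` does not have the eigenvalue one: an eigenfunction, extended by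
zero to `(0, 2 s)`, would be an eigenfunction there, hence analytic up to the weight, and vanish. -/
theorem eq_zero_of_bessel_apply_eq (ha : -1 < a) (hs : 0 < s)
    {T : Lp ℝ 2 (mu s) →L[ℝ] Lp ℝ 2 (mu s)} (hT : IsIntegralOperator (mu s) (kernelInf a) T)
    {f : Lp ℝ 2 (mu s)} (hf : T f = f) : f = 0 := by
  have hs2 : 0 < 2 * s := by linarith
  have hsub : Set.Ioo 0 s ⊆ Set.Ioo 0 (2 * s) := Set.Ioo_subset_Ioo_right (by linarith)
  have hres : (mu (2 * s)).restrict (Set.Ioo 0 s) = mu s := by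
    rw [mu, mu, Measure.restrict_restrict measurableSet_Ioo, Set.inter_eq_left.2 hsub]
  obtain ⟨M, hM, hk, -⟩ := exists_uniform_weightedKernel ha hs2
  obtain ⟨T', hT', -⟩ := hk.exists_isIntegralOperator (zero_le_one.trans hM) (ae_mem_mu _)
    (measurable_rpow_half a) (memLp_rpow_half ha _)
  set g0 : ℝ → ℝ := Set.indicator (Set.Ioo 0 s) f with hg0
  have hg0m : MemLp g0 2 (mu (2 * s)) := by
    rw [hg0, memLp_indicator_iff_restrict measurableSet_Ioo, hres]
    exact Lp.memLp f
  set g := hg0m.toLp g0 with hg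
  have hgae : g =ᵐ[mu (2 * s)] g0 := hg0m.coeFn_toLp
  set Φ : ℝ → ℝ := fun x => ∫ y, kernelInf a x y * f y ∂(mu s) with hΦ
  have hT'g : T' g =ᵐ[mu (2 * s)] Φ := by
    refine (hT' g).2.trans (Eventually.of_forall fun x => ?_)
    have hint : ∀ F : ℝ → ℝ, ∫ y, F y ∂(mu s) =
        ∫ y, (Set.Ioo 0 s).indicator F y ∂(mu (2 * s)) := fun F => by
      rw [← hres, integral_indicator measurableSet_Ioo]
    simp only [hΦ]
    rw [hint]
    refine integral_congr_ae ?_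
    filter_upwards [hgae] with y hy
    rw [hy, hg0]
    by_cases hy' : y ∈ Set.Ioo 0 s
    · rw [Set.indicator_of_mem hy', Set.indicator_of_mem hy']
    · rw [Set.indicator_of_notMem hy', Set.indicator_of_notMem hy', mul_zero]
  have hΦf : Φ =ᵐ[mu s] f := by
    have := (hT f).2
    rw [hf] at this
    exact this.symm
  have hΦf' : ∀ᵐ x ∂(mu (2 * s)), x ∈ Set.Ioo 0 s → Φ x = f x := by
    refine (ae_restrict_iff' measurableSet_Ioo).1 ?_
    have hae : ∀ p : ℝ → Prop, (∀ᵐ x ∂(mu s), p x) →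
        ∀ᵐ x ∂((mu (2 * s)).restrict (Set.Ioo 0 s)), p x := fun p hp => by rwa [hres]
    exact hae _ hΦf
  -- both the inner product and the norm only see the interval `(0, s)`
  have hin : inner ℝ g (T' g) = inner ℝ g g := by
    rw [hg, inner_toLp, inner_toLp]
    refine integral_congr_ae ?_
    filter_upwards [hT'g, hΦf', hgae] with x h1 h2 h3
    change g0 x * T' g x = g0 x * g x
    rw [h1, h3, hg0]
    by_cases hx : x ∈ Set.Ioo 0 s
    · rw [Set.indicator_of_mem hx, h2 hx]
    · rw [Set.indicator_of_notMem hx, zero_mul, zero_mul]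
  have hle := norm_sq_bessel_le ha hs2 hT' g
  have hTg : T' g = g := by
    have h1 := norm_sub_sq_real (T' g) g
    have h2 : inner ℝ (T' g) g = ‖g‖ ^ 2 := by
      rw [real_inner_comm, hin, real_inner_self_eq_norm_sq]
    rw [hin, real_inner_self_eq_norm_sq] at hle
    rw [h2] at h1
    have h3 : ‖T' g - g‖ ^ 2 = 0 := le_antisymm (by linarith) (sq_nonneg _)
    exact sub_eq_zero.1 (norm_eq_zero.1 (pow_eq_zero_iff (two_ne_zero)|>.1 h3))
  obtain ⟨d, hd, hd'⟩ := exists_powerSeries_radialAvg (s := s) ha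
    (h := fun y => y ^ (a / 2) * f y) ((memLp_rpow_half ha s).integrable_mul (Lp.memLp f))
  have hΦd : ∀ x, 0 < x → Φ x = x ^ (a / 2) * ∑' m, d m * x ^ m := by
    intro x hx
    rw [← hd', ← integral_const_mul, hΦ]
    refine integral_congr_ae ?_
    filter_upwards [ae_mem_mu s] with y hy
    rw [kernelInf_eq ha hx hy.1]; ring
  have hzero : ∀ᵐ x ∂(volume.restrict (Set.Ioo s (2 * s))), ∑' m, d m * x ^ m = 0 := by
    have h1 : ∀ᵐ x ∂(mu (2 * s)), Φ x = g0 x := by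
      filter_upwards [hT'g, hgae] with x h1 h2
      rw [← h1, hTg, h2]
    have h2 := ae_restrict_of_ae_restrict_of_subset
      (Set.Ioo_subset_Ioo_left hs.le : Set.Ioo s (2 * s) ⊆ Set.Ioo 0 (2 * s)) h1
    filter_upwards [h2, ae_restrict_mem measurableSet_Ioo] with x hx hxm
    have hx0 : 0 < x := hs.trans hxm.1
    rw [hΦd x hx0, hg0, Set.indicator_of_notMem fun h => (h.2.trans hxm.1).false] at hx
    exact (mul_eq_zero.1 hx).resolve_left (Real.rpow_pos_of_pos hx0 _).ne'
  have hall := powerSeries_eq_zero hd (by linarith) hzero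
  refine (Lp.eq_zero_iff_ae_eq_zero).2 ?_
  filter_upwards [hΦf, ae_mem_mu s] with x hx hxm
  rw [← hx, hΦd x hxm.1, hall x, mul_zero]
  rfl

/-- By the Fredholm alternative only an eigenvalue can obstruct invertibility. -/
theorem isUnit_one_sub_bessel (ha : -1 < a) (hs : 0 < s) {ξ : ℝ} (hξ0 : 0 < ξ) (hξ1 : ξ ≤ 1)
    {T : Lp ℝ 2 (mu s) →L[ℝ] Lp ℝ 2 (mu s)} (hT : IsIntegralOperator (mu s) (kernelInf a) T) :
    IsUnit (1 - ξ • T) := by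
  have hc : IsCompactOperator (ξ • T) := (isCompactOperator_bessel ha hs hT).smul ξ
  rcases hc.hasEigenvalue_or_mem_resolventSet (μ := (1 : ℝ)) one_ne_zero with h | h
  · obtain ⟨f, hf⟩ := h.exists_hasEigenvector
    have h1 : ξ • T f = f := by simpa using hf.apply_eq_smul
    refine absurd ?_ hf.2
    by_contra hne
    -- an eigenvalue `1 / ξ` of an operator with `T ^ 2 ≤ T` is at most one
    have h2 := norm_sq_bessel_le ha hs hT f
    have h3 : T f = ξ⁻¹ • f := by
      rw [← h1, smul_smul, inv_mul_cancel₀ hξ0.ne', one_smul, h1]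
    have hpos : 0 < ‖f‖ ^ 2 := by positivity
    rw [h3, norm_smul, real_inner_smul_right, real_inner_self_eq_norm_sq, mul_pow,
      Real.norm_of_nonneg (inv_pos.2 hξ0).le] at h2
    have h4 := le_of_mul_le_mul_right h2 hpos
    rw [sq] at h4
    have h5 : ξ⁻¹ ≤ 1 := by
      have := inv_pos.2 hξ0
      nlinarith
    have h6 : ξ = 1 := le_antisymm hξ1 (by
      have := mul_le_mul_of_nonneg_left h5 hξ0.le
      rwa [mul_inv_cancel₀ hξ0.ne', mul_one] at this)
    rw [h6, one_smul] at h1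
    exact hne (eq_zero_of_bessel_apply_eq ha hs hT h1)
  · rw [spectrum.mem_resolventSet_iff] at h
    simpa using h

end Analytic

/-! ### The gap probability as a finite determinant -/

section GapProbability

variable {a : ℝ}

/-- The Gram matrix of the first `N` Laguerre functions on `(0, r)`. -/
def lagGram (a : ℝ) (N : ℕ) (r : ℝ) : Matrix (Fin N) (Fin N) ℝ :=
  Matrix.of fun i j => ∫ x, lagFun a i x * lagFun a j x ∂(mu r)

/-- The Laguerre kernel is degenerate, so its Fredholm determinant has size `N`. -/
theorem fredholmDet_kernelN_eq (ha : -1 < a) (N : ℕ) (ξ r : ℝ) :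
    fredholmDet (mu r) (fun x y => ξ * kernelN a N x y) = (1 - ξ • lagGram a N r).det := by
  have h := fredholmDet_sum (μ := mu r) (fun (i : Fin N) x => ξ * lagFun a i x)
    (fun (i : Fin N) x => lagFun a i x) fun i j => by
      refine (((integrable_lagFun_mul ha i j).restrict (s := Set.Ioo 0 r)).const_mul ξ).congr
        (Eventually.of_forall fun x => ?_)
      ring
  have e : (fun x y => ξ * kernelN a N x y) =
      fun x y => ∑ i : Fin N, ξ * lagFun a i x * lagFun a i y := by
    funext x y
    rw [kernelN_eq_sum_lagFun ha, Finset.sum_range, Finset.mul_sum]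
    simp only [mul_assoc]
  rw [e, h]
  congr 2
  ext i j
  rw [Matrix.smul_apply, lagGram, Matrix.of_apply, Matrix.of_apply, smul_eq_mul,
    ← integral_const_mul]
  congr 1
  funext x
  ring

theorem fredholmDet_kernelScaled_eq (ha : -1 < a) (n : ℕ) (ξ s : ℝ) :
    fredholmDet (mu s) (fun x y => ξ * kernelScaled a n x y) =
      (1 - ξ • lagGram a (n + 1) (s / scale a n)).det := by
  have hc := scale_pos ha n
  have h := fredholmDet_sum (μ := mu s) (fun (i : Fin (n + 1)) x => ξ * lagScaled a (scale a n) i x)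
    (fun (i : Fin (n + 1)) x => lagScaled a (scale a n) i x) fun i j => by
      refine (((integrable_lagScaled_mul ha hc i j).restrict (s := Set.Ioo 0 s)).const_mul
        ξ).congr (Eventually.of_forall fun x => ?_)
      ring
  have e : (fun x y => ξ * kernelScaled a n x y) = fun x y => ∑ i : Fin (n + 1),
      ξ * lagScaled a (scale a n) i x * lagScaled a (scale a n) i y := by
    funext x y
    rw [kernelScaled_eq_sum ha, Finset.mul_sum]
    simp only [mul_assoc]
  rw [e, h]
  congr 2
  ext i j
  rw [Matrix.smul_apply, lagGram, Matrix.of_apply, Matrix.of_apply, smul_eq_mul,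
    ← integral_lagScaled_mul_mu a hc, ← integral_const_mul]
  congr 1
  funext x
  ring

/-- The coefficients of the normalized Laguerre polynomials. -/
def lagCoeff (a : ℝ) (N : ℕ) : Matrix (Fin N) (Fin N) ℝ :=
  Matrix.of fun i k => √(Real.Gamma (a + (i : ℕ) + 1) / (i : ℕ).factorial) *
    ((-1 : ℝ) ^ (k : ℕ) * ((i : ℕ).descFactorial k : ℝ) * ((k : ℕ).factorial : ℝ)⁻¹ *
      (Real.Gamma ((k : ℕ) + a + 1))⁻¹)

theorem det_lagCoeff_ne_zero (ha : -1 < a) (N : ℕ) : (lagCoeff a N).det ≠ 0 := by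
  rw [Matrix.det_of_isLowerTriangular]
  · refine Finset.prod_ne_zero_iff.2 fun i _ => ?_
    have hi : (0 : ℝ) ≤ (i : ℕ) := (i : ℕ).cast_nonneg
    have hG : Real.Gamma ((i : ℕ) + a + 1) ≠ 0 := (Real.Gamma_pos_of_pos (by linarith)).ne'
    have hf : ((i : ℕ).factorial : ℝ) ≠ 0 := by exact_mod_cast (i : ℕ).factorial_ne_zero
    have hs : √(Real.Gamma (a + (i : ℕ) + 1) / (i : ℕ).factorial) ≠ 0 :=
      (Real.sqrt_pos.2 (Gamma_div_factorial_pos ha i)).ne'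
    rw [lagCoeff, Matrix.of_apply, Nat.descFactorial_self]
    exact mul_ne_zero hs (mul_ne_zero (mul_ne_zero (mul_ne_zero (pow_ne_zero _ (by norm_num)) hf)
      (inv_ne_zero hf)) (inv_ne_zero hG))
  · intro i k hik
    have hik' : (i : ℕ) < k := hik
    rw [lagCoeff, Matrix.of_apply, Nat.descFactorial_of_lt hik']
    simp

/-- The determinant of the Laguerre functions is a multiple of the Vandermonde determinant, since
`lagCoeff` is lower triangular. -/
theorem det_lagFun_eq (a : ℝ) (N : ℕ) (x : Fin N → ℝ) :
    (Matrix.of fun i j : Fin N => lagFun a i (x j)).det =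
      (∏ j, √(weight a (x j))) * ((lagCoeff a N).det * (Matrix.vandermonde x).det) := by
  have h1 : (Matrix.of fun i j : Fin N => lagFun a i (x j)) = Matrix.of fun i j =>
      √(weight a (x j)) * (lagCoeff a N * (Matrix.vandermonde x).transpose) i j := by
    ext i j
    rw [Matrix.of_apply, Matrix.of_apply, lagFun, laguerreNorm_eq_sum a i.2, Matrix.mul_apply,
      Finset.sum_range, Finset.mul_sum]
    congr 1
    refine Finset.sum_congr rfl fun k _ => ?_
    rw [lagCoeff, Matrix.of_apply, Matrix.transpose_apply, Matrix.vandermonde_apply]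
    ring
  rw [h1, Matrix.det_mul_row, Matrix.det_mul, Matrix.det_transpose]

/-- Up to a constant the eigenvalue density is the square of the determinant of the normalized
Laguerre functions. -/
theorem eigDensity_mul_eq (a : ℝ) (N : ℕ) (x : Fin N → ℝ) :
    (lagCoeff a N).det ^ 2 * eigDensity a N x =
      (Matrix.of fun i j : Fin N => lagFun a i (x j)).det *
        (Matrix.of fun i j : Fin N => lagFun a i (x j)).det := by
  have hw : ∏ l, weight a (x l) = (∏ l, √(weight a (x l))) ^ 2 := by
    rw [← Finset.prod_pow]
    exact Finset.prod_congr rfl fun l _ => (Real.sq_sqrt (weight_nonneg a _)).symm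
  have hv : (∏ j, ∏ k ∈ Finset.Ioi j, |x k - x j| ^ 2) = (Matrix.vandermonde x).det ^ 2 := by
    rw [Matrix.det_vandermonde, ← Finset.prod_pow]
    refine Finset.prod_congr rfl fun j _ => ?_
    rw [← Finset.prod_pow]
    exact Finset.prod_congr rfl fun k _ => sq_abs _
  rw [det_lagFun_eq, eigDensity, hw, hv]
  ring

/-- The gap probability of the thinned ensemble is a determinant of size `N`: the eigenvalue
density is the square of a determinant of orthonormal functions. -/
theorem gapProb_eq (ha : -1 < a) (N : ℕ) (ξ r : ℝ) :
    gapProb a N ξ (Set.Ioo 0 r) = (1 - ξ • lagGram a N r).det := by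
  -- the factor that each eigenvalue contributes to the expectation
  set χ : ℝ → ℝ := fun t => 1 - ξ * (Set.Ioo 0 r).indicator 1 t with hχ
  have hgap : gapProb a N ξ (Set.Ioo 0 r) =
      (∫ x : Fin N → ℝ, (∏ l, χ (x l)) * eigDensity a N x) / ∫ x : Fin N → ℝ, eigDensity a N x := by
    simp only [gapProb, hχ, Set.indicator_apply, Pi.one_apply]
    congr!
  have hK : (lagCoeff a N).det ^ 2 ≠ 0 := pow_ne_zero _ (det_lagCoeff_ne_zero ha N)
  have hχe : ∀ i j : Fin N, ∀ t, χ t * lagFun a i t * lagFun a j t = lagFun a i t * lagFun a j t -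
      ξ * (Set.Ioo 0 r).indicator (fun t => lagFun a i t * lagFun a j t) t := fun i j t => by
    by_cases ht : t ∈ Set.Ioo 0 r
    · simp only [hχ, Set.indicator_of_mem ht, Pi.one_apply]; ring
    · simp only [hχ, Set.indicator_of_notMem ht]; ring
  have hind : ∀ i j : Fin N, Integrable ((Set.Ioo 0 r).indicator
      fun t => lagFun a i t * lagFun a j t) := fun i j =>
    (integrable_lagFun_mul ha i j).indicator measurableSet_Ioo
  have hnum : (lagCoeff a N).det ^ 2 * ∫ x : Fin N → ℝ,
      (∏ l, χ (x l)) * eigDensity a N x =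
      N.factorial * (1 - ξ • lagGram a N r).det := by
    have h := integral_det_mul_det (μ := volume) (fun (i : Fin N) t => χ t * lagFun a i t)
      (fun (i : Fin N) t => lagFun a i t) fun i j => by
        simp_rw [hχe]
        exact (integrable_lagFun_mul ha i j).sub ((hind i j).const_mul ξ)
    have hmat : (Matrix.of fun i j : Fin N => ∫ t, χ t * lagFun a i t * lagFun a j t) =
        1 - ξ • lagGram a N r := by
      ext i j
      rw [Matrix.of_apply, Matrix.sub_apply, Matrix.smul_apply, lagGram, Matrix.of_apply,
        Matrix.one_apply, smul_eq_mul, mu, ← integral_indicator measurableSet_Ioo]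
      simp_rw [hχe]
      rw [integral_sub (integrable_lagFun_mul ha i j) ((hind i j).const_mul ξ),
        integral_lagFun_mul ha, integral_const_mul]
      simp only [Fin.ext_iff]
    rw [hmat] at h
    rw [← h, ← integral_const_mul, volume_pi]
    refine integral_congr_ae (Eventually.of_forall fun x => ?_)
    have h2 := Matrix.det_mul_row (fun j => χ (x j))
      (Matrix.of fun i j : Fin N => lagFun a i (x j))
    simp only [Matrix.of_apply] at h2
    simp only [h2]
    rw [mul_left_comm, eigDensity_mul_eq, mul_assoc]
  have hden : (lagCoeff a N).det ^ 2 * ∫ x : Fin N → ℝ, eigDensity a N x = N.factorial := by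
    have h := integral_det_mul_det (μ := volume) (fun (i : Fin N) t => lagFun a i t)
      (fun (i : Fin N) t => lagFun a i t) fun i j => integrable_lagFun_mul ha i j
    have hmat : (Matrix.of fun i j : Fin N => ∫ t, lagFun a i t * lagFun a j t) = 1 := by
      ext i j
      rw [Matrix.of_apply, Matrix.one_apply, integral_lagFun_mul ha]
      simp only [Fin.ext_iff]
    rw [hmat, Matrix.det_one, mul_one] at h
    rw [← h, ← integral_const_mul, volume_pi]
    simp_rw [eigDensity_mul_eq]
  have hf : (N.factorial : ℝ) ≠ 0 := by exact_mod_cast N.factorial_ne_zero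
  rw [hgap, ← mul_div_mul_left _ _ hK, hnum, hden, mul_div_cancel_left₀ _ hf]

end GapProbability

/-! ### The expansion of the Fredholm determinant -/

section Expansion

variable {a s : ℝ}

theorem memLp_rpow_half_mul (ha : -1 < a) (s : ℝ) {φ : ℝ → ℝ} (hφ : Continuous φ) :
    MemLp (fun x : ℝ => x ^ (a / 2) * φ x) 2 (mu s) := by
  obtain ⟨K, hK⟩ := isCompact_Icc.exists_bound_of_continuousOn (s := Set.Icc 0 s) hφ.continuousOn
  refine (memLp_rpow_half ha s).of_le_mul (c := K)
    ((measurable_rpow_half a).mul hφ.measurable).aestronglyMeasurable ?_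
  filter_upwards [ae_mem_mu s] with x hx
  rw [norm_mul, mul_comm]
  exact mul_le_mul_of_nonneg_right (hK x (Set.Ioo_subset_Icc_self hx)) (norm_nonneg _)

/-- `J_a(√x)` without the factor `x ^ (a / 2)`. -/
def besselReg (a x : ℝ) : ℝ := 2 ^ (-a) * besselEntire a x

/-- `√x J_a'(√x)` without the factor `x ^ (a / 2)`. -/
def besselRegDeriv (a x : ℝ) : ℝ :=
  2 ^ (-a) * (a * besselEntire a x + 2 * (x * (-1 / 4 * besselEntire (a + 1) x)))

/-- The left factors in a decomposition of the correction kernel into three products. -/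
def corrKernelLeft (a : ℝ) (i : Fin 3) (x : ℝ) : ℝ :=
  x ^ (a / 2) * (![besselReg a x, x * besselReg a x, besselRegDeriv a x] i)

/-- The right factors in a decomposition of the correction kernel into three products. -/
def corrKernelRight (a : ℝ) (i : Fin 3) (y : ℝ) : ℝ :=
  y ^ (a / 2) * (-(1 / 192) * (![a ^ 2 * besselReg a y + y * besselReg a y + 2 * besselRegDeriv a y,
    besselReg a y, besselRegDeriv a y + 2 * besselReg a y] i))

theorem memLp_corrKernelLeft (ha : -1 < a) (s : ℝ) (i : Fin 3) :
    MemLp (corrKernelLeft a i) 2 (mu s) := by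
  have h1 := continuous_besselEntire a
  have h2 := continuous_besselEntire (a + 1)
  unfold corrKernelLeft besselReg besselRegDeriv
  refine memLp_rpow_half_mul ha s ?_
  fin_cases i <;> simp <;> fun_prop

theorem memLp_corrKernelRight (ha : -1 < a) (s : ℝ) (i : Fin 3) :
    MemLp (corrKernelRight a i) 2 (mu s) := by
  have h1 := continuous_besselEntire a
  have h2 := continuous_besselEntire (a + 1)
  unfold corrKernelRight besselReg besselRegDeriv
  refine memLp_rpow_half_mul ha s ?_
  fin_cases i <;> simp <;> fun_prop

theorem kernelL2_eq_sum {x y : ℝ} (hx : 0 < x) (hy : 0 < y) :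
    kernelL2 a x y = ∑ i, corrKernelLeft a i x * corrKernelRight a i y := by
  have e0 : kernelL2 a x y = -(1 / 192) *
      ((a ^ 2 + x + y) * besselJ a (√x) * besselJ a (√y)
      + (√x * besselJ' a (√x)) * (√y * besselJ' a (√y))
      + 2 * besselJ a (√x) * (√y * besselJ' a (√y))
      + 2 * (√x * besselJ' a (√x)) * besselJ a (√y)) := by
    rw [kernelL2, Real.sqrt_mul hx.le]; ring
  rw [e0, sqrt_mul_besselJ'_sqrt a hx, sqrt_mul_besselJ'_sqrt a hy, besselJ_sqrt a hx,
    besselJ_sqrt a hy, Fin.sum_univ_three]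
  simp only [corrKernelLeft, corrKernelRight, besselReg, besselRegDeriv, Matrix.cons_val_zero,
    Matrix.cons_val_one, Matrix.cons_val]
  ring

theorem memLp_const_mul_corrKernelLeft (ha : -1 < a) (ξ s : ℝ) (i : Fin 3) :
    MemLp (fun x => ξ * corrKernelLeft a i x) 2 (mu s) :=
  (memLp_corrKernelLeft ha s i).const_mul ξ

/-- The correction operator has rank at most three. Its product with any bounded operator, in
particular with the resolvent, is therefore trace class, and the trace is that of a matrix. -/
theorem exists_correctionOperator (ha : -1 < a) (ξ s : ℝ)
    (R : Lp ℝ 2 (mu s) →L[ℝ] Lp ℝ 2 (mu s)) :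
    ∃ L, IsIntegralOperator (mu s) (fun x y => ξ * kernelL2 a x y) L ∧
      IsTraceClass (R * L) ∧
      opTrace (R * L) = (Matrix.of fun i j =>
        inner ℝ ((memLp_corrKernelRight ha s i).toLp (corrKernelRight a i))
          (R ((memLp_const_mul_corrKernelLeft ha ξ s j).toLp
            (fun x => ξ * corrKernelLeft a j x)))).trace := by
  refine ⟨_, (isIntegralOperator_finiteRank (memLp_const_mul_corrKernelLeft ha ξ s)
    (memLp_corrKernelRight ha s)).congr (ae_mem_mu s) fun x hx y hy => ?_, ?_, ?_⟩
  · rw [kernelL2_eq_sum hx.1 hy.1, Finset.mul_sum]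
    exact Finset.sum_congr rfl fun i _ => (mul_assoc _ _ _)
  · rw [mul_sum_rankOneOp]
    exact isTraceClass_finiteRank _ _
  · rw [mul_sum_rankOneOp, opTrace_finiteRank]
    rfl

/-- The expansion of the Fredholm determinant of the rescaled Laguerre kernel with `n + 1`
eigenvalues in powers of `1 / (n + 1)`. -/
theorem isBigO_fredholmDet_kernelScaled (ha : -1 < a) (hs : 0 < s) {ξ : ℝ} (hξ0 : 0 < ξ)
    (hξ1 : ξ ≤ 1) :
    (fun n => fredholmDet (mu s) (fun x y => ξ * kernelScaled a n x y) -
      (fredholmDet (mu s) (fun x y => ξ * kernelInf a x y) + invN n ^ 2 *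
        Omega (mu s) (fun x y => ξ * kernelInf a x y) (fun x y => ξ * kernelL2 a x y)))
      =O[atTop] fun n => invN n ^ 3 := by
  obtain ⟨M, hM, hk0, hl0, hkn0⟩ := exists_uniform_weightedKernel ha hs
  obtain ⟨C, hC, hexp⟩ := exists_radialAvg_expansion ha hs
  obtain ⟨C', hC', hsub⟩ := exists_radialAvg_sub_le ha hs
  have hM0 : 0 ≤ M := zero_le_one.trans hM
  have hξM : |ξ| * M ≤ M := mul_le_of_le_one_left hM0 (by rwa [abs_of_pos hξ0])
  have hS := ae_mem_mu s
  have hw := measurable_rpow_half a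
  have hw2 := memLp_rpow_half ha s
  have hw2' := hw2.integrable_sq
  have hk := (hk0.const_mul ξ).mono hξM
  have hl := (hl0.const_mul ξ).mono hξM
  have hkn : ∀ᶠ n in atTop, WeightedKernel (Set.Ioo 0 s) (fun x => x ^ (a / 2)) M
      (fun x y => ξ * radialAvg a (genN a n) x y) (fun x y => ξ * kernelScaled a n x y) := by
    filter_upwards [hkn0] with n hn using (hn.const_mul ξ).mono hξM
  obtain ⟨T, hT, -⟩ := hk0.exists_isIntegralOperator hM0 hS hw hw2
  have hunit := isUnit_one_sub_bessel ha hs hξ0 hξ1 hT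
  have hφ := memLp_const_mul_corrKernelLeft ha ξ s
  obtain ⟨L, hL, -, htr⟩ := exists_correctionOperator ha ξ s (Ring.inverse (1 - ξ • T))
  have hdet := fredholmDet_add_finiteRank hS hw hw2 hk hl hkn
    (δ := fun n => C' * invN n ^ 2) (by simpa using (tendsto_invN.pow 2).const_mul C')
    (by
      filter_upwards [hsub] with n hn x hx y hy
      rw [← mul_sub, abs_mul, abs_of_pos hξ0]
      exact (mul_le_of_le_one_left (abs_nonneg _) hξ1).trans (hn x hx y hy))
    (ι := fun n => Fin (n + 1)) (u := fun n i x => ξ * lagScaled a (scale a n) i x)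
    (v := fun n i x => lagScaled a (scale a n) i x)
    (fun n i => (memLp_lagScaled_mu ha (scale_pos ha n) i s).const_mul ξ)
    (fun n i => memLp_lagScaled_mu ha (scale_pos ha n) i s)
    (Eventually.of_forall fun n x _ y _ => by
      rw [kernelScaled_eq_sum ha, Finset.mul_sum]
      exact Finset.sum_congr rfl fun i _ => (mul_assoc _ _ _).symm)
    hφ (memLp_corrKernelRight ha s)
    (fun x hx y hy => by
      rw [kernelL2_eq_sum hx.1 hy.1, Finset.mul_sum]
      exact Finset.sum_congr rfl fun i _ => (mul_assoc _ _ _).symm)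
    (hT.const_mul ξ) hunit
  set W : Matrix (Fin 3) (Fin 3) ℝ := Matrix.of fun i j =>
    inner ℝ ((memLp_corrKernelRight ha s i).toLp (corrKernelRight a i))
      (Ring.inverse (1 - ξ • T) ((hφ j).toLp (fun x => ξ * corrKernelLeft a j x))) with hW
  set D := fredholmDet (mu s) (fun x y => ξ * kernelInf a x y) with hD
  have hOm : Omega (mu s) (fun x y => ξ * kernelInf a x y) (fun x y => ξ * kernelL2 a x y) =
      -D * W.trace := by
    rw [Omega, (hT.const_mul ξ).integralOperator_eq, hL.integralOperator_eq, htr]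
  -- replacing the kernel by its expansion
  have h1 : (fun n => fredholmDet (mu s) (fun x y => ξ * kernelScaled a n x y) -
      fredholmDet (mu s) (fun x y => ξ * kernelInf a x y + invN n ^ 2 * (ξ * kernelL2 a x y)))
      =O[atTop] fun n => invN n ^ 3 := by
    refine IsBigO.of_bound
      (C * ∑' n, hadamardTerm ((M + M) * ∫ t, (t ^ (a / 2)) ^ 2 ∂(mu s)) n) ?_
    filter_upwards [hkn, hexp] with n h2 h3
    have i0 := (invN_pos n).le
    have h4 : |invN n ^ 2| * M ≤ M := mul_le_of_le_one_left hM0 (by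
      rw [abs_of_nonneg (pow_nonneg i0 2)]; exact pow_le_one₀ i0 (invN_le_one n))
    have h5 := (h2.mono (by linarith : M ≤ M + M)).abs_fredholmDet_sub_le
      ((hk.add (hl.const_mul (invN n ^ 2))).mono (by linarith : M + |invN n ^ 2| * M ≤ M + M))
      (by linarith) (δ := C * invN n ^ 3) (by positivity) hS hw hw2' (fun x hx y hy => by
        have e : ξ * radialAvg a (genN a n) x y - (ξ * radialAvg a (genInf a) x y +
            invN n ^ 2 * (ξ * radialAvg a (genL2 a) x y)) = ξ * (radialAvg a (genN a n) x y -
            (radialAvg a (genInf a) x y + invN n ^ 2 * radialAvg a (genL2 a) x y)) := by ring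
        rw [e, abs_mul, abs_of_pos hξ0]
        exact (mul_le_of_le_one_left (abs_nonneg _) hξ1).trans (h3 x hx y hy))
    rw [Real.norm_eq_abs, Real.norm_of_nonneg (pow_nonneg i0 3)]
    exact h5.trans (le_of_eq (by ring))
  -- the effect of the correction term, to first order
  have h2 : (fun n => D * ((1 - invN n ^ 2 • W).det - (1 - invN n ^ 2 * W.trace)))
      =O[atTop] fun n => invN n ^ 3 := by
    have h3 := (isBigO_det_one_sub_smul W (ε := fun n => invN n ^ 2)
      (by simpa using tendsto_invN.pow 2)).const_mul_left D
    refine h3.trans ?_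
    simp_rw [← pow_mul]
    exact isBigO_invN_pow (by norm_num)
  refine (h1.add h2).congr_left fun n => ?_
  rw [hOm, hdet]
  ring

end Expansion

end HardEdge

end

theorem mainTheorem6 (a : ℝ) (ha : -1 < a) (ξ : ℝ) (hξ0 : 0 < ξ) (hξ1 : ξ ≤ 1)
    (s : ℝ) (hs : 0 < s) :
    -- the objects in the expansion are well defined
    (∀ N : ℕ, 1 ≤ N → HardEdge.FredholmConverges (HardEdge.mu (s / (4 * N + 2 * a)))
      (fun x y => ξ * HardEdge.kernelN a N x y)) ∧
    HardEdge.FredholmConverges (HardEdge.mu s) (fun x y => ξ * HardEdge.kernelInf a x y) ∧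
    (∃ T, HardEdge.IsIntegralOperator (HardEdge.mu s)
      (fun x y => ξ * HardEdge.kernelInf a x y) T) ∧
    (∃ T, HardEdge.IsIntegralOperator (HardEdge.mu s)
      (fun x y => ξ * HardEdge.kernelL2 a x y) T) ∧
    IsUnit (1 - HardEdge.integralOperator (HardEdge.mu s)
      (fun x y => ξ * HardEdge.kernelInf a x y)) ∧
    HardEdge.IsTraceClass
      (Ring.inverse (1 - HardEdge.integralOperator (HardEdge.mu s)
          (fun x y => ξ * HardEdge.kernelInf a x y)) *
        HardEdge.integralOperator (HardEdge.mu s) (fun x y => ξ * HardEdge.kernelL2 a x y)) ∧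
    -- the expansion of the Fredholm determinant
    ((fun N : ℕ =>
        HardEdge.fredholmDet (HardEdge.mu (s / (4 * N + 2 * a)))
            (fun x y => ξ * HardEdge.kernelN a N x y)
          - (HardEdge.fredholmDet (HardEdge.mu s) (fun x y => ξ * HardEdge.kernelInf a x y)
            + 1 / (N : ℝ) ^ 2 * HardEdge.Omega (HardEdge.mu s)
                (fun x y => ξ * HardEdge.kernelInf a x y)
                (fun x y => ξ * HardEdge.kernelL2 a x y)))
      =O[atTop] fun N : ℕ => 1 / (N : ℝ) ^ 3) ∧
    -- the rate of convergence of the gap probability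
    ((fun N : ℕ =>
        HardEdge.gapProb a N ξ (Set.Ioo 0 (s / (4 * N + 2 * a)))
          - HardEdge.fredholmDet (HardEdge.mu s) (fun x y => ξ * HardEdge.kernelInf a x y))
      =O[atTop] fun N : ℕ => 1 / (N : ℝ) ^ 2) := by
  have hscale : ∀ n : ℕ, s / (4 * ((n + 1 : ℕ) : ℝ) + 2 * a) = s / HardEdge.scale a n := fun n => by
    rw [HardEdge.scale]; push_cast; rfl
  have hdetN : ∀ n : ℕ, HardEdge.fredholmDet (HardEdge.mu (s / HardEdge.scale a n))
      (fun x y => ξ * HardEdge.kernelN a (n + 1) x y) =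
      HardEdge.fredholmDet (HardEdge.mu s) (fun x y => ξ * HardEdge.kernelScaled a n x y) :=
    fun n => by
      rw [HardEdge.fredholmDet_kernelN_eq ha, HardEdge.fredholmDet_kernelScaled_eq ha]
  have hinv : ∀ (n j : ℕ), 1 / ((n + 1 : ℕ) : ℝ) ^ j = HardEdge.invN n ^ j := fun n j => by
    rw [HardEdge.invN, one_div_pow]; push_cast; rfl
  have hshift : ∀ {f : ℕ → ℝ} {j : ℕ},
      (fun n => f (n + 1)) =O[atTop] (fun n => HardEdge.invN n ^ j) →
      f =O[atTop] fun N : ℕ => 1 / (N : ℝ) ^ j := fun {f j} h => by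
    rw [← map_add_atTop_eq_nat 1, isBigO_map]
    refine h.congr_right fun n => ?_
    exact (hinv n j).symm
  obtain ⟨M, hM, hk, hl, -⟩ := HardEdge.exists_uniform_weightedKernel ha hs
  have hM0 : 0 ≤ M := zero_le_one.trans hM
  have hw := HardEdge.measurable_rpow_half a
  have hw2 := HardEdge.memLp_rpow_half ha
  obtain ⟨T, hT, -⟩ := hk.exists_isIntegralOperator hM0 (HardEdge.ae_mem_mu s) hw (hw2 s)
  obtain ⟨L, hL, htrace, -⟩ := HardEdge.exists_correctionOperator ha ξ s (Ring.inverse (1 - ξ • T))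
  have hexp := HardEdge.isBigO_fredholmDet_kernelScaled ha hs hξ0 hξ1
  refine ⟨fun N hN => ?_, ?_, ⟨_, hT.const_mul ξ⟩, ⟨L, hL⟩, ?_, ?_, hshift ?_, hshift ?_⟩
  · obtain ⟨n, rfl⟩ := Nat.exists_eq_add_of_le' hN
    obtain ⟨M', hM', α, h⟩ := HardEdge.exists_weightedKernel_kernelN ha n s
    rw [hscale]
    exact (h.const_mul ξ).fredholmConverges (by positivity) (HardEdge.ae_mem_mu _) hw
      (hw2 _).integrable_sq
  · exact (hk.const_mul ξ).fredholmConverges (by positivity) (HardEdge.ae_mem_mu s) hw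
      (hw2 s).integrable_sq
  · rw [(hT.const_mul ξ).integralOperator_eq]
    exact HardEdge.isUnit_one_sub_bessel ha hs hξ0 hξ1 hT
  · rw [(hT.const_mul ξ).integralOperator_eq, hL.integralOperator_eq]
    exact htrace
  · refine hexp.congr_left fun n => ?_
    rw [hscale, hdetN, hinv]
  · -- the determinant of the gap probability differs from the limit by the term of order two
    have h2 := (isBigO_refl (fun n => HardEdge.invN n ^ 2) atTop).const_mul_left
      (HardEdge.Omega (HardEdge.mu s) (fun x y => ξ * HardEdge.kernelInf a x y)
        (fun x y => ξ * HardEdge.kernelL2 a x y))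
    refine ((hexp.trans (HardEdge.isBigO_invN_pow (by norm_num : 2 ≤ 3))).add h2).congr_left
      fun n => ?_
    rw [hscale, HardEdge.gapProb_eq ha, ← HardEdge.fredholmDet_kernelScaled_eq ha]
    ring
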